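/- Conventions. Let $d\ge 2$ be an integer. A finite undirected graph $G=(V,E)$ is $d$-claw free if no induced subgraph is a star with one centre and $d$ leaves. For $w:V\to\mathbb R_{>0}$ and $S\subseteq V$ put $w(S)=\sum_{v\in S}w(v)$ and $w^2(S)=\sum_{v\in S}w(v)^2$, and for $U,W\subseteq V$ let $N(U,W)$ be the set of $x\in W$ that lie in $U$ or have a neighbour in $U$. An independent set $A$ is an $r$-approximation for the maximum weight independent set problem (MWIS) if $w(B)\le r\cdot w(A)$ for every independent set $B$. The local improvement algorithm starts with $A=\emptyset$ and, as long as there is an independent set $X$ with $|X|\le (d-1)^2+(d-1)$ and $w^2((A\setminus N(X,A))\cup X)>w^2(A)$, replaces $A$ by $(A\setminus N(X,A))\cup X$ for some such $X$; it returns the final $A$. For a real $N>1$, the scaled and truncated algorithm first computes a greedy solution $A'$ (repeatedly add a heaviest vertex that is neither in nor adjacent to the current set), rescales $w$ so that $w(A')=N\cdot|V|$, rounds all weights down to integers, deletes the vertices of rounded weight $0$, and applies the local improvement algorithm to the remaining graph with the rounded weights. Let $\rho_d=\frac d2-\frac1{63{,}700{,}992}$ for $d\ge 3$, and $\rho_2=1$.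 The running time is the number of steps of a random access machine with arrays of natural and of real numbers whose operations are indirect addressing, addition, subtraction and comparison. A graph is given by its number $n$ of vertices, its adjacency matrix and its weights. Theorem. 1. Let $G$ be $d$-claw free, $w>0$ and $N>1$. For all choices of the greedy solution and of the improvements $X$, the scaled and truncated algorithm performs at most $(d-1)^2N^2|V|^2$ iterations, and the set it returns is a $\rho_d\cdot\frac{N}{N-1}$-approximation for the MWIS in $(G,w)$. 2. For every $d\ge 2$ there is a program that, given a $d$-claw free graph on $n$ vertices with positive real weights and a real $\epsilon'>0$, returns, within a number of steps bounded by a polynomial (depending only on $d$) in $n+\lceil 1/\epsilon'\rceil$, a set that is a possible result of the scaled and truncated algorithm for some $N>1$ and that is a $(\rho_d+\epsilon')$-approximation for the MWIS. In particular, for $d\ge3$ this is a $\left(\frac d2-\frac1{63{,}700{,}992}+\epsilon'\right)$-approximation. 3. For every $d\ge2$ there is a program that computes, in time polynomial in $n$, a $\frac d2$-approximation for the MWIS in $d$-claw free graphs on $n$ vertices with positive real weights. 4. For a family $\mathcal S$ of finite sets of size at most $k$, the conflict graph (vertices: the members of $\mathcal S$; edges: pairs of distinct members with non-empty intersection) is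 $(k+1)$-claw free. For every $k\ge1$ there is a program that, given $n$ sets of at most $k$ natural numbers each (as lists of elements), positive real weights, and a real $\epsilon'>0$, returns, within a number of steps bounded by a polynomial (depending only on $k$) in $n+\lceil1/\epsilon'\rceil$, a pairwise disjoint sub-collection that is a possible result of the scaled and truncated algorithm (with $d=k+1$, for some $N>1$) on the conflict graph, and whose weight, multiplied by $\rho_{k+1}+\epsilon'$, is at least the weight of every pairwise disjoint sub-collection. For $k\ge2$, $\rho_{k+1}+\epsilon'=\frac{k+1}2-\frac1{63{,}700{,}992}+\epsilon'$. -/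

import Mathlib

/-! ### Claws, neighbourhoods, weights -/

namespace ClawFreeMWIS

/-- `G` is `d`-claw free (`d ≥ 1`): no induced subgraph of `G` is a star with a centre `c` and a
set `T` of `d` talons. -/
def ClawFree {V : Type*} (d : ℕ) (G : SimpleGraph V) : Prop :=
  ¬ ∃ (c : V) (T : Finset V), T.card = d ∧ (∀ t ∈ T, G.Adj c t) ∧ G.IsIndepSet (T : Set V)

section Algorithm

variable {V : Type*}

open Classical in
/-- The neighbourhood `N(U, W) = {w ∈ W : ∃ u ∈ U, {u, w} ∈ E ∨ u = w}`. -/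
noncomputable def nbhd (G : SimpleGraph V) (U W : Finset V) : Finset V :=
  W.filter (fun w => ∃ u ∈ U, G.Adj u w ∨ u = w)

/-- `w(S)`. -/
noncomputable def wt (w : V → ℝ) (S : Finset V) : ℝ := ∑ v ∈ S, w v

/-- `w²(S)`, the sum of the squared weights. -/
noncomputable def wtSq (w : V → ℝ) (S : Finset V) : ℝ := ∑ v ∈ S, w v ^ 2

open Classical in
/-- The set `(A \ N(X, A)) ∪ X`. -/
noncomputable def exchange (G : SimpleGraph V) (A X : Finset V) : Finset V :=
  (A \ nbhd G X A) ∪ X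

/-- `X` is a local improvement of `w²(A)`. -/
def IsLocalImprovement (d : ℕ) (G : SimpleGraph V) (w : V → ℝ) (A X : Finset V) : Prop :=
  G.IsIndepSet (X : Set V) ∧ X.card ≤ (d - 1) ^ 2 + (d - 1) ∧
    wtSq w A < wtSq w (exchange G A X)

/-- `Run d G w U i A`: the local improvement algorithm, applied to the subgraph of `G` induced on
`U` with weights `w`, can hold the set `A` after exactly `i` iterations. It starts with the empty
set and replaces `A` by `(A \ N(X, A)) ∪ X` for an arbitrary local improvement `X`. (`U` is the
whole vertex set if no vertex has been deleted.) -/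
inductive Run (d : ℕ) (G : SimpleGraph V) (w : V → ℝ) (U : Finset V) : ℕ → Finset V → Prop
  | start : Run d G w U 0 ∅
  | step {i : ℕ} {A X : Finset V} : Run d G w U i A → X ⊆ U → IsLocalImprovement d G w A X →
      Run d G w U (i + 1) (exchange G A X)

/-- The local improvement algorithm on the subgraph induced on `U` can return `A`. -/
def Returns (d : ℕ) (G : SimpleGraph V) (w : V → ℝ) (U A : Finset V) : Prop :=
  (∃ i, Run d G w U i A) ∧ ¬ ∃ X, X ⊆ U ∧ IsLocalImprovement d G w A X

open Classical in
/-- The sets the greedy algorithm passes through: it repeatedly adds a vertex of maximum weight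
among those that are neither in the current set nor adjacent to it. -/
inductive GreedyReaches (G : SimpleGraph V) (w : V → ℝ) : Finset V → Prop
  | start : GreedyReaches G w ∅
  | step {A : Finset V} {v : V} : GreedyReaches G w A → nbhd G {v} A = ∅ →
      (∀ u, nbhd G {u} A = ∅ → w u ≤ w v) → GreedyReaches G w (insert v A)

/-- `A` is a solution returned by the greedy algorithm. -/
def IsGreedySolution (G : SimpleGraph V) (w : V → ℝ) (A : Finset V) : Prop :=
  GreedyReaches G w A ∧ ∀ v, nbhd G {v} A ≠ ∅

variable [Fintype V]

/-- The weight function rescaled so that the greedy solution `A'` gets weight `N * |V|`, and then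
rounded down. -/
noncomputable def truncWeight (N : ℝ) (w : V → ℝ) (A' : Finset V) (v : V) : ℝ :=
  (⌊N * Fintype.card V / wt w A' * w v⌋₊ : ℝ)

open Classical in
/-- The vertices that are kept: those of non-zero truncated weight. -/
noncomputable def keptVertices (N : ℝ) (w : V → ℝ) (A' : Finset V) : Finset V :=
  Finset.univ.filter (fun v => truncWeight N w A' v ≠ 0)

/-- `A` can be returned by the scaled and truncated local improvement algorithm with parameter
`N`: compute a greedy solution `A'`, rescale so that `w(A') = N * |V|`, truncate, delete the
vertices of truncated weight `0`, and run the local improvement algorithm. -/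
def ScaledReturns (d : ℕ) (N : ℝ) (G : SimpleGraph V) (w : V → ℝ) (A : Finset V) : Prop :=
  ∃ A', IsGreedySolution G w A' ∧
    Returns d G (truncWeight N w A') (keptVertices N w A') A

end Algorithm

/-- `A` is an `r`-approximate solution to the maximum weight independent set problem. -/
def IsApproxMWIS {V : Type*} (r : ℝ) (G : SimpleGraph V) (w : V → ℝ) (A : Finset V) : Prop :=
  G.IsIndepSet (A : Set V) ∧
    ∀ B : Finset V, G.IsIndepSet (B : Set V) → wt w B ≤ r * wt w A

/-- The guarantee `d/2 - 1/63700992`. For `d = 2` this number is below `1`, where no algorithm can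
achieve it; the local improvement algorithm is optimal then, so the guarantee is `1`. -/
noncomputable def approxRatio (d : ℕ) : ℝ :=
  if d = 2 then 1 else (d : ℝ) / 2 - 1 / 63700992

/-! ### Weighted `k`-set packing -/

/-- The conflict graph of an indexed family of sets: edges are the non-empty intersections. -/
def conflictGraph {ι α : Type*} (S : ι → Finset α) : SimpleGraph ι where
  Adj i j := i ≠ j ∧ ¬ Disjoint (S i) (S j)
  symm := ⟨fun _ _ h => ⟨h.1.symm, fun h' => h.2 h'.symm⟩⟩
  loopless := ⟨fun _ h => h.1 rfl⟩

/-- The indices in `A` pick pairwise disjoint sets whose total weight is within a factor `r` of that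
of every pairwise disjoint sub-collection. -/
def IsApproxPacking {ι α : Type*} (r : ℝ) (S : ι → Finset α) (w : ι → ℝ) (A : Finset ι) :
    Prop :=
  (A : Set ι).PairwiseDisjoint S ∧
    ∀ B : Finset ι, (B : Set ι).PairwiseDisjoint S → wt w B ≤ r * wt w A

end ClawFreeMWIS

/-! ### A random access machine with a step count

The memory consists of arrays of natural numbers and arrays of real numbers. Array names are fixed
in the program, indices are computed at run time. The only arithmetic operations are addition and
subtraction, and numbers can be compared: there is no multiplication, no division, no rounding, and
no conversion of a real into a natural number. Hence the bit length of the numbers grows by at most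
a constant in each step, and on rational inputs the step count is polynomially related to the
running time of a Turing machine. -/

namespace RAM

/-- The memory: `nat a i` and `real a i` are the entries with index `i` of the arrays with name
`a`. -/
structure Store where
  nat : ℕ → ℕ → ℕ
  real : ℕ → ℕ → ℝ

/-- Expressions for natural numbers; `sub` is truncated subtraction. -/
inductive NatExpr
  | const (c : ℕ)
  | get (a : ℕ) (i : NatExpr)
  | add (e f : NatExpr)
  | sub (e f : NatExpr)

/-- Expressions for real numbers. -/
inductive RealExpr
  | zero
  | one
  | get (a : ℕ) (i : NatExpr)
  | add (e f : RealExpr)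
  | sub (e f : RealExpr)

/-- Tests. -/
inductive Test
  | natLt (e f : NatExpr)
  | realLt (e f : RealExpr)
  | not (b : Test)
  | and (b c : Test)

/-- Programs. -/
inductive Prog
  | skip
  | setNat (a : ℕ) (i e : NatExpr)
  | setReal (a : ℕ) (i : NatExpr) (e : RealExpr)
  | seq (P Q : Prog)
  | ite (b : Test) (P Q : Prog)
  | while (b : Test) (P : Prog)

def NatExpr.eval (σ : Store) : NatExpr → ℕ
  | .const c => c
  | .get a i => σ.nat a (i.eval σ)
  | .add e f => e.eval σ + f.eval σ
  | .sub e f => e.eval σ - f.eval σ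

noncomputable def RealExpr.eval (σ : Store) : RealExpr → ℝ
  | .zero => 0
  | .one => 1
  | .get a i => σ.real a (i.eval σ)
  | .add e f => e.eval σ + f.eval σ
  | .sub e f => e.eval σ - f.eval σ

def Test.holds (σ : Store) : Test → Prop
  | .natLt e f => e.eval σ < f.eval σ
  | .realLt e f => e.eval σ < f.eval σ
  | .not b => ¬ b.holds σ
  | .and b c => b.holds σ ∧ c.holds σ

/-- Overwrite one entry of an array of natural numbers. -/
def Store.setNat (σ : Store) (a i x : ℕ) : Store where
  nat := Function.update σ.nat a (Function.update (σ.nat a) i x)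
  real := σ.real

/-- Overwrite one entry of an array of real numbers. -/
noncomputable def Store.setReal (σ : Store) (a i : ℕ) (x : ℝ) : Store where
  nat := σ.nat
  real := Function.update σ.real a (Function.update (σ.real a) i x)

/-- `Exec P σ t σ'`: started with memory `σ`, the program `P` halts with memory `σ'` after `t`
steps. Each assignment and each evaluation of a test counts as one step; as the expressions of a
program have fixed size, this is the number of elementary operations up to a constant factor. -/
inductive Exec : Prog → Store → ℕ → Store → Prop
  | skip (σ : Store) : Exec .skip σ 1 σ
  | setNat (σ : Store) (a : ℕ) (i e : NatExpr) :
      Exec (.setNat a i e) σ 1 (σ.setNat a (i.eval σ) (e.eval σ))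
  | setReal (σ : Store) (a : ℕ) (i : NatExpr) (e : RealExpr) :
      Exec (.setReal a i e) σ 1 (σ.setReal a (i.eval σ) (e.eval σ))
  | seq {P Q : Prog} {σ σ' σ'' : Store} {s t : ℕ} :
      Exec P σ s σ' → Exec Q σ' t σ'' → Exec (.seq P Q) σ (s + t) σ''
  | ite_true {b : Test} {P Q : Prog} {σ σ' : Store} {t : ℕ} :
      b.holds σ → Exec P σ t σ' → Exec (.ite b P Q) σ (t + 1) σ'
  | ite_false {b : Test} {P Q : Prog} {σ σ' : Store} {t : ℕ} :
      ¬ b.holds σ → Exec Q σ t σ' → Exec (.ite b P Q) σ (t + 1) σ'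
  | while_false {b : Test} {P : Prog} {σ : Store} :
      ¬ b.holds σ → Exec (.while b P) σ 1 σ
  | while_true {b : Test} {P : Prog} {σ σ' σ'' : Store} {s t : ℕ} :
      b.holds σ → Exec P σ s σ' → Exec (.while b P) σ' t σ'' →
        Exec (.while b P) σ (s + t + 1) σ''

open Classical in
/-- The memory holds a graph on `n` vertices with weights: `nat 0` holds `n`, `nat 1` the adjacency
matrix, row by row, and `real 0` the weights. All other entries are arbitrary. -/
structure EncodesGraph (σ : Store) {n : ℕ} (G : SimpleGraph (Fin n)) (w : Fin n → ℝ) : Prop where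
  size : σ.nat 0 0 = n
  adj : ∀ u v : Fin n, σ.nat 1 (u * n + v) = if G.Adj u v then 1 else 0
  weight : ∀ v : Fin n, σ.real 0 v = w v

/-- The memory holds a family of `n` sets, each of at most `k` natural numbers, with weights:
`nat 0` holds `n`, the entries `i * k, …, i * k + (k - 1)` of `nat 3` list the elements of the
`i`-th set in any order (`x + 1` stands for the element `x`, and `0` for no element), and `real 0`
holds the weights. All other entries are arbitrary. -/
structure EncodesSets (σ : Store) (k : ℕ) {n : ℕ} (S : Fin n → Finset ℕ) (w : Fin n → ℝ) :
    Prop where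
  size : σ.nat 0 0 = n
  mem : ∀ (i : Fin n) (x : ℕ), x ∈ S i ↔ ∃ j < k, σ.nat 3 (i * k + j) = x + 1
  weight : ∀ i : Fin n, σ.real 0 i = w i

/-- The set computed by a program is read off from the array `nat 2`. -/
def output (σ : Store) (n : ℕ) : Finset (Fin n) :=
  Finset.univ.filter (fun v => σ.nat 2 v = 1)

end RAM

/-! The heart is a bound for a set `A` that no small exchange improves in `w²`, against an arbitrary
independent set `B`. Put `D = d - 1`, let `N(u)` be the closed neighbourhood in `A` of `u ∈ B`, and
let `c(u) = w(u) - w(N(u))/2` be the surplus. Claw-freeness bounds the degrees between `A` and `B`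
by `D`, so the terms `w(N(u))/2` sum to at most `D/2 · w(A)`. For fixed `v ∈ A`, inserting all `u`
of positive gain at `v` is no improvement, so these gains sum to at most `w(v)`
(`LocalOpt.sum_relGain_le`). At its heaviest neighbour, `u` gains at least `2c(u)`. Hence the
positive surpluses sum to at most `w(A)/2`, and `w(B) ≤ (D+1)/2 · w(A) = d/2 · w(A)`.

To get below `d/2` for `D ≥ 2`, suppose that this is nearly attained (`LocalOpt.weight_le`). Then
there is hardly any waste or negative surplus, and the incidences have total weight close to `D ·
w(A)`. Little waste forces almost all surplus onto "singles", vertices with one neighbour of about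
their own weight and otherwise negligible neighbours (`LocalOpt.single_of_waste_le`). Singles are
matched injectively with vertices of `A` that carry nearly all of `w(A)`, yet they account for only
about one of the `D` incidences. So some other `u` sees mostly vertices matched to singles.
Inserting `u` together with these singles recovers most of what `u` removes, which bounds `w(u)²` by
little more than `w(N(u))²/10` (`LocalOpt.sq_le_of_not_single`). This contradicts `w(u)` being about
`w(N(u))/2` or more. For `D = 1`, local optimality gives `w(u) ≤ w(N(u))` directly.

Truncated weights are integers, so each iteration raises `w²` by at least `1`; the greedy solution
is a `(d - 1)`-approximation, so `w²` never exceeds `((d - 1) N |V|)²`. Rounding loses at most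
`|V|`, which is a fraction of at most `1/N` for any set as heavy as the greedy one. Taking `N - 1 ≥
d/ε` makes the loss in the guarantee at most `ε`. For the `d/2`-approximation with `d ≥ 3` a
constant `N` is enough, since the margin below `d/2` absorbs the loss.

The programs enumerate all tuples of `(d-1)² + (d-1)` vertices by nested loops, and replace products
and rounding by repeated addition; all counters stay polynomially bounded. Correctness and step
counts are proved together in a Hoare-style calculus (`RAM.Within`). Set packing is reduced to its
conflict graph. -/

namespace ClawFreeMWIS

/-! ### Local optimality: the combinatorial core -/

section Core

variable {V : Type*}

open Classical in
/-- The set of elements of `A` related to `u`. -/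
noncomputable def rel (r : V → V → Prop) (A : Finset V) (u : V) : Finset V := A.filter (r u)

/-- The part of the weight of `u` not covered by half the weight of its neighbours. -/
noncomputable def surplus (r : V → V → Prop) (A : Finset V) (w : V → ℝ) (u : V) : ℝ :=
  w u - (∑ v ∈ rel r A u, w v) / 2

open Classical in
/-- The gain in squared weight, relative to `w v`, that `u` brings to an improvement that removes
`v` anyway. -/
noncomputable def relGain (r : V → V → Prop) (A : Finset V) (w : V → ℝ) (u v : V) : ℝ :=
  (w u ^ 2 - ∑ x ∈ (rel r A u).erase v, w x ^ 2) / w v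

/-- The total positive gain of `u`, minus twice its positive surplus. -/
noncomputable def waste (r : V → V → Prop) (A : Finset V) (w : V → ℝ) (u : V) : ℝ :=
  ∑ v ∈ rel r A u, max (relGain r A w u v) 0 - 2 * max (surplus r A w u) 0

open Classical in
/-- `A` and `B` have bounded mutual degrees, and no small subset of `B` improves `A`. -/
structure LocalOpt (r : V → V → Prop) (D : ℕ) (A B : Finset V) (w : V → ℝ) : Prop where
  posA : ∀ v ∈ A, 0 < w v
  posB : ∀ u ∈ B, 0 < w u
  degA : ∀ u ∈ B, (rel r A u).card ≤ D
  degB : ∀ v ∈ A, (B.filter (fun u => r u v)).card ≤ D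
  opt : ∀ X ⊆ B, X.card ≤ D ^ 2 + D →
    ∑ u ∈ X, w u ^ 2 ≤ ∑ v ∈ A.filter (fun v => ∃ u ∈ X, r u v), w v ^ 2

variable {r : V → V → Prop} {D : ℕ} {A B : Finset V} {w : V → ℝ}

lemma mem_rel {u v : V} : v ∈ rel r A u ↔ v ∈ A ∧ r u v := by
  classical
  simp [rel]

lemma sum_biUnion_le {ι : Type*} [DecidableEq V] {s : Finset ι} {t : ι → Finset V} {F : V → ℝ}
    (hF : ∀ x, 0 ≤ F x) : ∑ x ∈ s.biUnion t, F x ≤ ∑ i ∈ s, ∑ x ∈ t i, F x := by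
  classical
  induction s using Finset.induction_on with
  | empty => simp
  | insert i s hi ih =>
    rw [Finset.biUnion_insert, Finset.sum_insert hi]
    have h1 := Finset.sum_union_inter (s₁ := t i) (s₂ := s.biUnion t) (f := F)
    have h2 : 0 ≤ ∑ x ∈ t i ∩ s.biUnion t, F x := Finset.sum_nonneg fun _ _ => hF _
    linarith

/-- Double counting over the pairs of related vertices. -/
lemma sum_rel_comm (F : V → V → ℝ) :
    ∑ u ∈ B, ∑ v ∈ rel r A u, F u v = ∑ v ∈ A, ∑ u ∈ rel (fun v u => r u v) B v, F u v := by
  apply Finset.sum_comm'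
  intro x y
  simp only [mem_rel]
  tauto

namespace LocalOpt

lemma card_rel_swap (h : LocalOpt r D A B w) {v : V} (hv : v ∈ A) :
    (rel (fun v u => r u v) B v).card ≤ D := by
  have := h.degB v hv
  unfold rel
  convert this

/-- A vertex of `B` without neighbours in `A` could be added alone at no cost; `1 ≤ D` makes a
single insertion admissible. -/
lemma rel_nonempty (h : LocalOpt r D A B w) (hD : 1 ≤ D) {u : V} (hu : u ∈ B) :
    (rel r A u).Nonempty := by
  classical
  by_contra hne
  rw [Finset.not_nonempty_iff_eq_empty] at hne
  have h1 := h.opt {u} (by simpa using hu) (by simp; omega)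
  have h2 : A.filter (fun v => ∃ u' ∈ ({u} : Finset V), r u' v) = ∅ := by
    rw [← hne]; ext v; simp [mem_rel]
  rw [h2] at h1
  have := h.posB u hu
  simp at h1
  nlinarith [pow_pos this 2]

/-- Inserting a set of related vertices of `v` gains at most `w v`. -/
lemma sum_relGain_le (h : LocalOpt r D A B w) {v : V} (hv : v ∈ A) :
    ∑ u ∈ rel (fun v u => r u v) B v, max (relGain r A w u v) 0 ≤ w v := by
  classical
  have hp := h.posA v hv
  -- The vertices of positive gain are inserted together: `v` is paid for once, and every other
  -- removed vertex is charged to the members of `X` that remove it.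
  set X := (rel (fun v u => r u v) B v).filter (fun u => 0 < relGain r A w u v) with hX
  have hXB : X ⊆ B := fun u hu => by
    simp only [hX, Finset.mem_filter, mem_rel] at hu; exact hu.1.1
  have hcard : X.card ≤ D ^ 2 + D :=
    (Finset.card_filter_le _ _).trans ((h.card_rel_swap hv).trans (Nat.le_add_left _ _))
  have h1 := h.opt X hXB hcard
  have h2 : A.filter (fun x => ∃ u ∈ X, r u x) ⊆
      insert v (X.biUnion fun u => (rel r A u).erase v) := by
    intro x hx
    simp only [Finset.mem_filter] at hx
    obtain ⟨hxA, u, hu, hux⟩ := hx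
    by_cases hxv : x = v
    · simp [hxv]
    · simp only [Finset.mem_insert, Finset.mem_biUnion, Finset.mem_erase, mem_rel]
      exact Or.inr ⟨u, hu, hxv, hxA, hux⟩
  have h3 : ∑ x ∈ A.filter (fun x => ∃ u ∈ X, r u x), w x ^ 2 ≤
      w v ^ 2 + ∑ u ∈ X, ∑ x ∈ (rel r A u).erase v, w x ^ 2 := by
    refine (Finset.sum_le_sum_of_subset_of_nonneg h2 fun _ _ _ => sq_nonneg _).trans ?_
    rw [Finset.sum_insert (by simp)]
    gcongr
    exact sum_biUnion_le fun _ => sq_nonneg _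
  have h4 : ∑ u ∈ rel (fun v u => r u v) B v, max (relGain r A w u v) 0 =
      ∑ u ∈ X, relGain r A w u v := by
    rw [hX, Finset.sum_filter]
    refine Finset.sum_congr rfl fun u _ => ?_
    split_ifs with hu
    · exact max_eq_left hu.le
    · exact max_eq_right (not_lt.1 hu)
  rw [h4]
  have h5 : (∑ u ∈ X, relGain r A w u v) * w v =
      ∑ u ∈ X, w u ^ 2 - ∑ u ∈ X, ∑ x ∈ (rel r A u).erase v, w x ^ 2 := by
    rw [Finset.sum_mul, ← Finset.sum_sub_distrib]
    refine Finset.sum_congr rfl fun u _ => ?_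
    unfold relGain
    field_simp
  nlinarith

/-- The total budget which surplus and waste have to share. -/
lemma sum_relGain_total (h : LocalOpt r D A B w) :
    ∑ u ∈ B, ∑ v ∈ rel r A u, max (relGain r A w u v) 0 ≤ ∑ v ∈ A, w v := by
  rw [sum_rel_comm]
  exact Finset.sum_le_sum fun v hv => h.sum_relGain_le hv

lemma exists_heaviest (h : LocalOpt r D A B w) (hD : 1 ≤ D) :
    ∃ m : V → V, ∀ u ∈ B, m u ∈ rel r A u ∧ ∀ x ∈ rel r A u, w x ≤ w (m u) := by
  have : ∀ u, ∃ m, u ∈ B → m ∈ rel r A u ∧ ∀ x ∈ rel r A u, w x ≤ w m := by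
    intro u
    by_cases hu : u ∈ B
    · obtain ⟨m, hm, hm'⟩ := Finset.exists_max_image _ w (h.rel_nonempty hD hu)
      exact ⟨m, fun _ => ⟨hm, hm'⟩⟩
    · exact ⟨u, fun h => absurd h hu⟩
  choose m hm using this
  exact ⟨m, hm⟩

/-- The gain at a vertex `v`, written through the surplus. -/
lemma relGain_mul {u v : V} (hv : v ∈ rel r A u) (hp : 0 < w v) [DecidableEq V] :
    relGain r A w u v * w v = 2 * surplus r A w u * w v + (w u - w v) ^ 2 +
      ∑ x ∈ (rel r A u).erase v, w x * (w v - w x) := by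
  have h1 : relGain r A w u v * w v = w u ^ 2 - ∑ x ∈ (rel r A u).erase v, w x ^ 2 := by
    unfold relGain
    rw [div_mul_cancel₀ _ hp.ne']
    congr!
  have h2 : ∑ x ∈ rel r A u, w x = w v + ∑ x ∈ (rel r A u).erase v, w x :=
    (Finset.add_sum_erase _ _ hv).symm
  have h3 : ∑ x ∈ (rel r A u).erase v, w x * (w v - w x) =
      w v * (∑ x ∈ (rel r A u).erase v, w x) - ∑ x ∈ (rel r A u).erase v, w x ^ 2 := by
    rw [Finset.mul_sum, ← Finset.sum_sub_distrib]
    exact Finset.sum_congr rfl fun _ _ => by ring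
  rw [h1, h3]
  unfold surplus
  rw [h2]
  ring

/-- This is the last term of `relGain_mul`; its sign at a heaviest neighbour makes the gain there at
least twice the surplus. -/
lemma relGain_heaviest_nonneg (h : LocalOpt r D A B w) {u m : V} [DecidableEq V]
    (hmax : ∀ x ∈ rel r A u, w x ≤ w m) :
    0 ≤ ∑ x ∈ (rel r A u).erase m, w x * (w m - w x) := by
  refine Finset.sum_nonneg fun x hx => ?_
  have hx := Finset.mem_of_mem_erase hx
  have := h.posA x (mem_rel.1 hx).1
  have := hmax x hx
  nlinarith

/-- A vertex of positive surplus wastes at least what it gains at the other neighbours, and the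
defect at its heaviest neighbour. -/
lemma le_waste (h : LocalOpt r D A B w) {u m : V} [DecidableEq V]
    (hm : m ∈ rel r A u) (hc : 0 ≤ surplus r A w u) :
    ((w u - w m) ^ 2 + ∑ x ∈ (rel r A u).erase m, w x * (w m - w x)) / w m +
      ∑ x ∈ (rel r A u).erase m, max (relGain r A w u x) 0 ≤ waste r A w u := by
  have hp := h.posA m (mem_rel.1 hm).1
  have h1 := relGain_mul (w := w) hm hp
  have h2 : relGain r A w u m = 2 * surplus r A w u +
      ((w u - w m) ^ 2 + ∑ x ∈ (rel r A u).erase m, w x * (w m - w x)) / w m := by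
    field_simp
    linarith
  unfold waste
  rw [← Finset.add_sum_erase _ _ hm, max_eq_left hc]
  have := le_max_left (relGain r A w u m) 0
  linarith

/-- The gain at the heaviest neighbour alone covers twice a positive surplus; without positive
surplus nothing is subtracted. -/
lemma waste_nonneg (h : LocalOpt r D A B w) {u m : V} (hm : m ∈ rel r A u)
    (hmax : ∀ x ∈ rel r A u, w x ≤ w m) :
    0 ≤ waste r A w u := by
  classical
  have hp := h.posA m (mem_rel.1 hm).1
  rcases le_or_gt 0 (surplus r A w u) with hc | hc
  · refine le_trans ?_ (h.le_waste hm hc)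
    have h1 := h.relGain_heaviest_nonneg hmax
    have : 0 ≤ ∑ x ∈ (rel r A u).erase m, max (relGain r A w u x) 0 :=
      Finset.sum_nonneg fun _ _ => le_max_right _ _
    positivity
  · unfold waste
    rw [max_eq_right hc.le]
    have : 0 ≤ ∑ x ∈ rel r A u, max (relGain r A w u x) 0 :=
      Finset.sum_nonneg fun _ _ => le_max_right _ _
    linarith

/-- A vertex that wastes little has one neighbour of about its own weight, and the other neighbours
are negligible. -/
lemma single_of_waste_le (h : LocalOpt r D A B w) {u m : V} [DecidableEq V] (hm : m ∈ rel r A u)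
    (hmax : ∀ x ∈ rel r A u, w x ≤ w m)
    (hc : 0 < surplus r A w u) (hf : waste r A w u ≤ 1 / 500 * surplus r A w u) :
    9 / 20 * w m ≤ surplus r A w u ∧
      ∑ x ∈ (rel r A u).erase m, w x ≤ 1 / 250 * surplus r A w u := by
  have hp := h.posA m (mem_rel.1 hm).1
  have hw := h.le_waste hm hc.le
  have hQ0 := h.relGain_heaviest_nonneg hmax
  set s := ∑ x ∈ (rel r A u).erase m, w x with hs
  set Q := ∑ x ∈ (rel r A u).erase m, w x * (w m - w x) with hQ
  set c := surplus r A w u with hcdef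
  have hcs : c = w u - (w m + s) / 2 := by
    rw [hcdef, surplus, hs, Finset.add_sum_erase _ _ hm]
  have hG : 0 ≤ ∑ x ∈ (rel r A u).erase m, max (relGain r A w u x) 0 :=
    Finset.sum_nonneg fun _ _ => le_max_right _ _
  have hq : (w u - w m) ^ 2 + Q ≤ 1 / 500 * c * w m := by
    rw [← div_le_iff₀ hp]; linarith
  -- If a second neighbour had at least half the weight of `m`, smallness of `Q` would make it
  -- nearly as heavy as `m`. The gain there would then be nearly `2c` or more, but it counts
  -- entirely as waste.
  have hsmall : ∀ x ∈ (rel r A u).erase m, w x < w m / 2 := by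
    intro x0 hx0
    by_contra hx
    push Not at hx
    have hx0r := Finset.mem_of_mem_erase hx0
    have hx0p := h.posA x0 (mem_rel.1 hx0r).1
    have hx0m := hmax x0 hx0r
    have h1 : w x0 * (w m - w x0) ≤ Q := by
      refine Finset.single_le_sum (f := fun x => w x * (w m - w x)) (fun x hx => ?_) hx0
      have hx := Finset.mem_of_mem_erase hx
      have := h.posA x (mem_rel.1 hx).1
      have := hmax x hx
      nlinarith
    have h2 : w m * (w m - w x0) ≤ 2 * Q := by nlinarith
    have h3 : relGain r A w u x0 ≤ 1 / 500 * c := by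
      have h4 : max (relGain r A w u x0) 0 ≤
          ∑ x ∈ (rel r A u).erase m, max (relGain r A w u x) 0 :=
        Finset.single_le_sum (f := fun x => max (relGain r A w u x) 0)
          (fun _ _ => le_max_right _ _) hx0
      have h5 : 0 ≤ ((w u - w m) ^ 2 + Q) / w m := by positivity
      have := le_max_left (relGain r A w u x0) 0
      linarith
    have h4 : relGain r A w u x0 * w x0 = w u ^ 2 - ∑ x ∈ (rel r A u).erase x0, w x ^ 2 := by
      unfold relGain
      rw [div_mul_cancel₀ _ hx0p.ne']
      congr!
    have h5 : ∑ x ∈ (rel r A u).erase x0, w x ^ 2 =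
        w m ^ 2 - w x0 ^ 2 + ∑ x ∈ (rel r A u).erase m, w x ^ 2 := by
      have e1 := Finset.add_sum_erase _ (fun x => w x ^ 2) hm
      have e2 := Finset.add_sum_erase _ (fun x => w x ^ 2) hx0r
      linarith
    have h6 : Q = w m * s - ∑ x ∈ (rel r A u).erase m, w x ^ 2 := by
      rw [hQ, hs, Finset.mul_sum, ← Finset.sum_sub_distrib]
      exact Finset.sum_congr rfl fun _ _ => by ring
    have h7 : relGain r A w u x0 * w x0 ≤ 1 / 500 * c * w m :=
      (mul_le_mul_of_nonneg_right h3 hx0p.le).trans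
        (mul_le_mul_of_nonneg_left hx0m (by positivity))
    have h8 : 0 < c * w m := mul_pos hc hp
    have hs' : s = 2 * w u - w m - 2 * c := by linarith
    have h9 : relGain r A w u x0 * w x0 =
        (w u - w m) ^ 2 + 2 * w m * c + Q - (w m - w x0) * (w m + w x0) := by
      rw [h4, h5, ← sub_eq_zero]
      have : ∑ x ∈ (rel r A u).erase m, w x ^ 2 = w m * s - Q := by linarith
      rw [this, hs']; ring
    nlinarith [sq_nonneg (w u - w m)]
  -- Each of the other neighbours `x` now satisfies `w m - w x ≥ w m / 2`.
  have hs2 : s * (w m / 2) ≤ Q := by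
    rw [hs, hQ, Finset.sum_mul]
    refine Finset.sum_le_sum fun x hx => ?_
    have h1 := hsmall x hx
    have h2 := h.posA x (mem_rel.1 (Finset.mem_of_mem_erase hx)).1
    nlinarith
  have hs3 : s ≤ 1 / 250 * c := by
    have : s * w m ≤ 1 / 250 * c * w m := by nlinarith [sq_nonneg (w u - w m)]
    exact le_of_mul_le_mul_right this hp
  refine ⟨?_, hs3⟩
  -- If `c < 9/20 · w m`, then `(w u - w m)² ≤ c · w m / 500` gives `w u ≥ 97/100 · w m`. As `s ≤ c
  -- / 250`, the surplus `c = w u - (w m + s)/2` is then above `9/20 · w m` after all.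
  by_contra hlt
  push Not at hlt
  have h1 : (w u - w m) ^ 2 ≤ (3 / 100 * w m) ^ 2 := by nlinarith
  have h2 := abs_le_of_sq_le_sq' h1 (by positivity)
  linarith [h2.1]

/-- A vertex `u` that is not a single, together with the singles at its neighbours, is no
improvement. -/
lemma sq_le_of_not_single (h : LocalOpt r D A B w) [DecidableEq V] (hD : 1 ≤ D)
    {m : V → V} {T : Finset V} (hTB : T ⊆ B)
    (hm : ∀ u ∈ B, m u ∈ rel r A u) (hinj : Set.InjOn m T)
    (hgain : ∀ u ∈ T, 9 / 10 * w (m u) ≤ relGain r A w u (m u))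
    {u : V} (hu : u ∈ B) (huT : u ∉ T) :
    w u ^ 2 ≤ (∑ v ∈ (rel r A u).filter (fun v => v ∉ T.image m), w v) ^ 2 +
      1 / 10 * (∑ v ∈ rel r A u, w v) ^ 2 := by
  set S := T.filter (fun t => m t ∈ rel r A u) with hS
  have hSB : S ⊆ B := (Finset.filter_subset _ _).trans hTB
  have hSinj : Set.InjOn m S := fun x hx y hy => hinj (Finset.filter_subset _ _ hx)
    (Finset.filter_subset _ _ hy)
  have himg : S.image m = (rel r A u).filter (fun v => v ∈ T.image m) := by
    ext v
    simp only [hS, Finset.mem_image, Finset.mem_filter]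
    constructor
    · rintro ⟨t, ⟨ht, h1⟩, rfl⟩; exact ⟨h1, t, ht, rfl⟩
    · rintro ⟨h1, t, ht, rfl⟩; exact ⟨t, ⟨ht, h1⟩, rfl⟩
  have hScard : S.card ≤ D := by
    rw [← Finset.card_image_of_injOn hSinj, himg]
    exact (Finset.card_filter_le _ _).trans (h.degA u hu)
  have huS : u ∉ S := fun hh => huT (Finset.filter_subset _ _ hh)
  -- At most `D + 1` vertices are inserted, and `D + 1 ≤ D² + D` because `1 ≤ D`.
  have h1 := h.opt (insert u S) (Finset.insert_subset hu hSB) (by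
    rw [Finset.card_insert_of_notMem huS]
    nlinarith)
  rw [Finset.sum_insert huS] at h1
  -- The vertex `m t` of each inserted single `t` is removed by `u` anyway, so the singles only pay
  -- for their remaining neighbours.
  have h2 : ∀ x ∈ A, (∃ u' ∈ insert u S, r u' x) →
      x ∈ rel r A u ∪ S.biUnion fun t => (rel r A t).erase (m t) := by
    rintro x hxA ⟨t, ht, htx⟩
    simp only [Finset.mem_union, Finset.mem_biUnion, Finset.mem_erase]
    rcases Finset.mem_insert.1 ht with rfl | ht
    · exact Or.inl (mem_rel.2 ⟨hxA, htx⟩)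
    · by_cases hx : x = m t
      · left; rw [hx]; exact (Finset.mem_filter.1 ht).2
      · exact Or.inr ⟨t, ht, hx, mem_rel.2 ⟨hxA, htx⟩⟩
  have h3 : w u ^ 2 + ∑ x ∈ S, w x ^ 2 ≤
      ∑ x ∈ rel r A u, w x ^ 2 + ∑ t ∈ S, ∑ x ∈ (rel r A t).erase (m t), w x ^ 2 := by
    refine h1.trans <| (Finset.sum_le_sum_of_subset_of_nonneg
      (t := rel r A u ∪ S.biUnion fun t => (rel r A t).erase (m t)) (fun x hx => ?_)
      fun _ _ _ => sq_nonneg _).trans ?_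
    · simp only [Finset.mem_filter] at hx
      exact h2 x hx.1 hx.2
    have e1 := Finset.sum_union_inter (s₁ := rel r A u)
      (s₂ := S.biUnion fun t => (rel r A t).erase (m t)) (f := fun x => w x ^ 2)
    have e2 : 0 ≤ ∑ x ∈ rel r A u ∩ S.biUnion (fun t => (rel r A t).erase (m t)), w x ^ 2 :=
      Finset.sum_nonneg fun _ _ => sq_nonneg _
    have e3 := sum_biUnion_le (s := S) (t := fun t => (rel r A t).erase (m t))
      (F := fun x => w x ^ 2) fun _ => sq_nonneg _
    linarith
  -- Each single gives back nine tenths of the squared weight of `m t`; the missing tenth is the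
  -- second term of the bound.
  have h4 : ∑ t ∈ S, (9 / 10 * w (m t) ^ 2) ≤
      ∑ t ∈ S, w t ^ 2 - ∑ t ∈ S, ∑ x ∈ (rel r A t).erase (m t), w x ^ 2 := by
    rw [← Finset.sum_sub_distrib]
    refine Finset.sum_le_sum fun t ht => ?_
    have htT : t ∈ T := (Finset.filter_subset _ _ ht)
    have hp := h.posA _ (mem_rel.1 (hm t (hTB htT))).1
    have e1 := hgain t htT
    have e2 : relGain r A w t (m t) * w (m t) =
        w t ^ 2 - ∑ x ∈ (rel r A t).erase (m t), w x ^ 2 := by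
      unfold relGain
      rw [div_mul_cancel₀ _ hp.ne']
      congr!
    nlinarith
  have h5 : ∑ t ∈ S, (9 / 10 * w (m t) ^ 2) =
      9 / 10 * ∑ v ∈ (rel r A u).filter (fun v => v ∈ T.image m), w v ^ 2 := by
    rw [← himg, Finset.sum_image hSinj, Finset.mul_sum]
  have h6 := Finset.sum_filter_add_sum_filter_not (rel r A u) (fun v => v ∈ T.image m)
    (fun v => w v ^ 2)
  have hsq : ∀ s ⊆ A, ∑ v ∈ s, w v ^ 2 ≤ (∑ v ∈ s, w v) ^ 2 := fun s hs =>
    Finset.sum_sq_le_sq_sum_of_nonneg fun v hv => (h.posA v (hs hv)).le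
  have hrel : rel r A u ⊆ A := fun x hx => (mem_rel.1 hx).1
  have h7 := hsq _ hrel
  have h8 := hsq _ ((Finset.filter_subset (fun v => v ∉ T.image m) _).trans hrel)
  have h9 : 0 ≤ ∑ v ∈ (rel r A u).filter (fun v => v ∉ T.image m), w v ^ 2 :=
    Finset.sum_nonneg fun _ _ => sq_nonneg _
  linarith

lemma sum_rel_weight_eq :
    ∑ u ∈ B, ∑ v ∈ rel r A u, w v = ∑ v ∈ A, ((rel (fun v u => r u v) B v).card : ℝ) * w v := by
  rw [sum_rel_comm]
  simp

lemma sum_rel_weight_le (h : LocalOpt r D A B w) :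
    ∑ u ∈ B, ∑ v ∈ rel r A u, w v ≤ D * ∑ v ∈ A, w v := by
  rw [sum_rel_weight_eq, Finset.mul_sum]
  refine Finset.sum_le_sum fun v hv => ?_
  have := h.card_rel_swap hv
  have hp := h.posA v hv
  gcongr

/-! ### Approximation guarantees of local optima. -/

/-- For `D = 1` a locally optimal set is optimal. -/
theorem weight_le_of_degree_one (h : LocalOpt r D A B w) (hD : D = 1) :
    ∑ u ∈ B, w u ≤ ∑ v ∈ A, w v := by
  classical
  have h1 := h.sum_rel_weight_le
  rw [hD, Nat.cast_one, one_mul] at h1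
  refine le_trans (Finset.sum_le_sum fun u hu => ?_) h1
  -- Inserting `u` alone gives `w(u)² ≤ w²(N(u)) ≤ w(N(u))²`.
  have h2 := h.opt {u} (by simpa using hu) (by simp; omega)
  have h3 : A.filter (fun v => ∃ u' ∈ ({u} : Finset V), r u' v) = rel r A u := by
    ext v; simp [mem_rel]
  rw [h3, Finset.sum_singleton] at h2
  have hpos : ∀ v ∈ rel r A u, 0 ≤ w v := fun v hv => (h.posA v (mem_rel.1 hv).1).le
  exact le_of_sq_le_sq (h2.trans (Finset.sum_sq_le_sq_sum_of_nonneg hpos))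
    (Finset.sum_nonneg hpos)

/-- The approximation guarantee of a locally optimal set. -/
theorem weight_le (h : LocalOpt r D A B w) (hD : 2 ≤ D) :
    ∑ u ∈ B, w u ≤ (((D : ℝ) + 1) / 2 - 1 / 63700992) * ∑ v ∈ A, w v := by
  classical
  by_contra hcon
  push Not at hcon
  obtain ⟨m, hm⟩ := h.exists_heaviest (by omega)
  have hmA : ∀ u ∈ B, m u ∈ A := fun u hu => (mem_rel.1 (hm u hu).1).1
  have hmpos : ∀ u ∈ B, 0 < w (m u) := fun u hu => h.posA _ (hmA u hu)
  set δ : ℝ := 1 / 63700992 with hδ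
  set S := ∑ v ∈ A, w v with hS
  have hDr : (2 : ℝ) ≤ D := by exact_mod_cast hD
  have hSpos : 0 < S := by
    rcases A.eq_empty_or_nonempty with hA | hA
    · exfalso
      have hB : B = ∅ := by
        by_contra hB
        obtain ⟨u, hu⟩ := Finset.nonempty_iff_ne_empty.2 hB
        have := hmA u hu
        simp [hA] at this
      simp [hS, hA, hB] at hcon
    · exact Finset.sum_pos (fun v hv => h.posA v hv) hA
  let c := surplus r A w
  let f := waste r A w
  -- The singles: positive surplus, and waste negligible in comparison.
  set T := B.filter (fun u => 0 < c u ∧ f u ≤ 1 / 500 * c u) with hT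
  have hTB : T ⊆ B := Finset.filter_subset _ _
  have hsingle : ∀ u ∈ T, 9 / 20 * w (m u) ≤ c u ∧
      ∑ x ∈ (rel r A u).erase (m u), w x ≤ 1 / 250 * c u := by
    intro u hu
    have hu' := Finset.mem_filter.1 hu
    exact h.single_of_waste_le (hm u hu'.1).1 (hm u hu'.1).2 hu'.2.1 hu'.2.2
  have hgain2 : ∀ u ∈ T, 2 * c u ≤ relGain r A w u (m u) := by
    intro u hu
    have hub := hTB hu
    have e1 := relGain_mul (w := w) (hm u hub).1 (hmpos u hub)
    have e2 := h.relGain_heaviest_nonneg (hm u hub).2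
    refine le_of_mul_le_mul_right ?_ (hmpos u hub)
    nlinarith [sq_nonneg (w u - w (m u))]
  have hgain : ∀ u ∈ T, 9 / 10 * w (m u) ≤ relGain r A w u (m u) := fun u hu => by
    have := hgain2 u hu
    have := (hsingle u hu).1
    linarith
  have hgainle : ∀ v ∈ A, ∀ U ⊆ T, (∀ u ∈ U, m u = v) →
      ∑ u ∈ U, relGain r A w u v ≤ w v := by
    intro v hv U hU hUv
    refine le_trans ?_ (h.sum_relGain_le hv)
    refine (Finset.sum_le_sum fun u _ => le_max_left _ 0).trans ?_
    refine Finset.sum_le_sum_of_subset_of_nonneg (fun u hu => ?_) fun _ _ _ => le_max_right _ _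
    have huB := hTB (hU hu)
    refine mem_rel.2 ⟨huB, ?_⟩
    have := (mem_rel.1 (hm u huB).1).2
    rwa [hUv u hu] at this
  have hcle : ∀ u ∈ T, c u ≤ w (m u) / 2 := fun u hu => by
    have e1 := hgainle (m u) (hmA u (hTB hu)) {u} (by simpa using hu) (by simp)
    have e2 := hgain2 u hu
    simp only [Finset.sum_singleton] at e1
    linarith
  -- Two singles with the same `m` would gain `18/10` of its weight there, but the total gain is at
  -- most its weight.
  have hinj : Set.InjOn m T := by
    intro x hx y hy hxy
    by_contra hne
    have e1 := hgainle (m x) (hmA x (hTB hx)) {x, y} (by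
      intro z hz
      simp only [Finset.mem_insert, Finset.mem_singleton] at hz
      rcases hz with rfl | rfl <;> assumption) (by simp [hxy])
    rw [Finset.sum_pair hne] at e1
    have e2 := hgain x hx
    have e3 := hgain y hy
    rw [← hxy] at e3
    have := hmpos x (hTB hx)
    linarith
  set Gd := T.image m with hGd
  have hGdA : Gd ⊆ A := fun v hv => by
    obtain ⟨u, hu, rfl⟩ := Finset.mem_image.1 hv
    exact hmA u (hTB hu)
  have hGdsum : ∑ v ∈ Gd, w v = ∑ u ∈ T, w (m u) := Finset.sum_image hinj
  have hGdS : ∑ v ∈ Gd, w v ≤ S :=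
    Finset.sum_le_sum_of_subset_of_nonneg hGdA fun v hv _ => (h.posA v hv).le
  set E := ∑ u ∈ B, ∑ v ∈ rel r A u, w v with hE
  have hEle : E ≤ D * S := h.sum_rel_weight_le
  set Cp := ∑ u ∈ B, max (c u) 0 with hCp
  set Cm := ∑ u ∈ B, max (-c u) 0 with hCm
  have hC : Cp - Cm = ∑ u ∈ B, w u - E / 2 := by
    rw [hCp, hCm, hE, Finset.sum_div, ← Finset.sum_sub_distrib, ← Finset.sum_sub_distrib]
    refine Finset.sum_congr rfl fun u _ => ?_
    change max (c u) 0 - max (-c u) 0 = c u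
    rcases le_total 0 (c u) with h0 | h0
    · rw [max_eq_left h0, max_eq_right (by linarith)]; ring
    · rw [max_eq_right h0, max_eq_left (by linarith)]; ring
  have hCm0 : 0 ≤ Cm := Finset.sum_nonneg fun _ _ => le_max_right _ _
  have hf0 : ∀ u ∈ B, 0 ≤ f u := fun u hu => h.waste_nonneg (hm u hu).1 (hm u hu).2
  have hfsum : ∑ u ∈ B, f u + 2 * Cp ≤ S := by
    have e1 : ∑ u ∈ B, f u = ∑ u ∈ B, ∑ v ∈ rel r A u, max (relGain r A w u v) 0 - 2 * Cp := by
      rw [hCp, Finset.mul_sum, ← Finset.sum_sub_distrib]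
      rfl
    have := h.sum_relGain_total
    linarith
  have hfnn : 0 ≤ ∑ u ∈ B, f u := Finset.sum_nonneg hf0
  have hsplit := Finset.sum_filter_add_sum_filter_not B (fun u => 0 < c u ∧ f u ≤ 1 / 500 * c u)
    (fun u => max (c u) 0)
  have hTsum : ∑ u ∈ T, max (c u) 0 ≤ (∑ v ∈ Gd, w v) / 2 := by
    rw [hGdsum, Finset.sum_div]
    refine Finset.sum_le_sum fun u hu => ?_
    rw [max_eq_left (Finset.mem_filter.1 hu).2.1.le]
    exact hcle u hu
  -- A vertex of positive surplus outside `T` wastes more than `1/500` of it, so the total waste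
  -- controls the surplus outside `T`.
  have hnT : ∑ u ∈ B.filter (fun u => ¬ (0 < c u ∧ f u ≤ 1 / 500 * c u)), max (c u) 0 ≤
      500 * ∑ u ∈ B, f u := by
    rw [Finset.mul_sum]
    refine (Finset.sum_le_sum (g := fun u => 500 * f u) fun u hu => ?_).trans
      (Finset.sum_le_sum_of_subset_of_nonneg (Finset.filter_subset _ _) fun u hu _ => by
        have := hf0 u hu; positivity)
    obtain ⟨huB, hu⟩ := Finset.mem_filter.1 hu
    have e1 := hf0 u huB
    rcases le_or_gt (c u) 0 with h0 | h0
    · rw [max_eq_right h0]; positivity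
    · rw [max_eq_left h0.le]
      have : ¬ f u ≤ 1 / 500 * c u := fun hh => hu ⟨h0, hh⟩
      push Not at this
      linarith
  -- Let `x` be the weight of the neighbours and `b` its part outside `Gd`. If the inequality
  -- failed, then `w u ≥ 4/10 · x` and `b ≤ x/10`, so `sq_le_of_not_single` would give `16/100 · x²
  -- ≤ 1/100 · x² + 10/100 · x²`.
  have hnot : ∀ u ∈ B.filter (fun u => u ∉ T), ∑ v ∈ rel r A u, w v ≤
      10 * ∑ v ∈ (rel r A u).filter (fun v => v ∉ Gd), w v + 10 * max (-c u) 0 := by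
    intro u hu
    obtain ⟨huB, huT⟩ := Finset.mem_filter.1 hu
    have e1 := h.sq_le_of_not_single (by omega) hTB (fun u hu => (hm u hu).1) hinj hgain huB huT
    rw [← hGd] at e1
    have e2 : w u = c u + (∑ v ∈ rel r A u, w v) / 2 := by
      change _ = w u - _ + _
      ring
    have e3 := le_max_left (-c u) 0
    have e4 := le_max_right (-c u) 0
    have e5 : 0 ≤ ∑ v ∈ (rel r A u).filter (fun v => v ∉ Gd), w v :=
      Finset.sum_nonneg fun v hv => (h.posA v (mem_rel.1 (Finset.mem_filter.1 hv).1).1).le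
    set b := ∑ v ∈ (rel r A u).filter (fun v => v ∉ Gd), w v
    set x := ∑ v ∈ rel r A u, w v
    set k := max (-c u) 0
    by_contra hlt
    push Not at hlt
    have e6 : 4 / 10 * x ≤ w u := by linarith
    have e7 : b ≤ x / 10 := by linarith
    have e8 : 0 < x := by linarith
    have e9 : (4 / 10 * x) ^ 2 ≤ w u ^ 2 := by gcongr
    have e10 : b ^ 2 ≤ (x / 10) ^ 2 := by gcongr
    nlinarith [pow_pos e8 2]
  have hsum := Finset.sum_le_sum hnot
  rw [Finset.sum_add_distrib, ← Finset.mul_sum, ← Finset.mul_sum] at hsum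
  have hbeta : ∑ u ∈ B.filter (fun u => u ∉ T), ∑ v ∈ (rel r A u).filter (fun v => v ∉ Gd), w v ≤
      D * (S - ∑ v ∈ Gd, w v) := by
    have e0 : ∀ u, (rel r A u).filter (fun v => v ∉ Gd) = rel r (A \ Gd) u := by
      intro u; ext v; simp only [Finset.mem_filter, mem_rel, Finset.mem_sdiff]; tauto
    simp only [e0]
    have e1 : ∑ u ∈ B, ∑ v ∈ rel r (A \ Gd) u, w v ≤ D * ∑ v ∈ A \ Gd, w v := by
      rw [sum_rel_comm, Finset.mul_sum]
      refine Finset.sum_le_sum fun v hv => ?_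
      have hvA := (Finset.mem_sdiff.1 hv).1
      have := h.card_rel_swap hvA
      have hp := h.posA v hvA
      rw [Finset.sum_const, nsmul_eq_mul]
      gcongr
    have e2 : ∑ v ∈ A \ Gd, w v = S - ∑ v ∈ Gd, w v := by
      have := Finset.sum_sdiff (f := w) hGdA
      linarith
    rw [e2] at e1
    refine le_trans (Finset.sum_le_sum_of_subset_of_nonneg (Finset.filter_subset _ _) ?_) e1
    intro u _ _
    exact Finset.sum_nonneg fun v hv => (h.posA v (Finset.mem_sdiff.1 (mem_rel.1 hv).1).1).le
  have hcm : ∑ u ∈ B.filter (fun u => u ∉ T), max (-c u) 0 ≤ Cm :=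
    Finset.sum_le_sum_of_subset_of_nonneg (Finset.filter_subset _ _) fun _ _ _ => le_max_right _ _
  have hTE : ∑ u ∈ T, ∑ v ∈ rel r A u, w v ≤ 1002 / 1000 * ∑ v ∈ Gd, w v := by
    rw [hGdsum, Finset.mul_sum]
    refine Finset.sum_le_sum fun u hu => ?_
    rw [← Finset.add_sum_erase _ _ (hm u (hTB hu)).1]
    have := (hsingle u hu).2
    have := hcle u hu
    linarith
  have hEsplit : ∑ u ∈ T, ∑ v ∈ rel r A u, w v +
      ∑ u ∈ B.filter (fun u => u ∉ T), ∑ v ∈ rel r A u, w v = E := by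
    have e := Finset.sum_filter_add_sum_filter_not B (fun u => u ∈ T)
      (fun u => ∑ v ∈ rel r A u, w v)
    have e1 : B.filter (fun u => u ∈ T) = T := by
      ext u; simp only [Finset.mem_filter]; exact ⟨fun h => h.2, fun h => ⟨hTB h, h⟩⟩
    rwa [e1] at e
  -- Under `hcon` every estimate behind `(D + 1)/2` is tight up to a multiple of `δ S`. In `k4`, `Cp
  -- ≥ (1/2 - δ) S` and the surplus outside `T` is at most `500 · 2δ S`; doubling gives `2δ +
  -- 2000δ`.
  have k1 : Cm ≤ δ * S := by nlinarith
  have k2 : (D - 2 * δ) * S ≤ E := by nlinarith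
  have k3 : ∑ u ∈ B, f u ≤ 2 * δ * S := by nlinarith
  have k4 : S - ∑ v ∈ Gd, w v ≤ 2002 * δ * S := by nlinarith
  have k5 : D * (S - ∑ v ∈ Gd, w v) ≤ D * (2002 * δ * S) := by gcongr
  have k0 : E ≤ 1002 / 1000 * S + 10 * (D * (S - ∑ v ∈ Gd, w v)) + 10 * Cm := by
    linarith only [hTE, hsum, hbeta, hcm, hEsplit, hGdS]
  have k6 : (D - 2 * δ) * S ≤ 1002 / 1000 * S + 10 * (D * (2002 * δ * S)) + 10 * (δ * S) := by
    refine k2.trans (k0.trans ?_)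
    gcongr
  -- The incidences have weight nearly `D · S`, but those of singles give only `1002/1000 · S` and
  -- the others are of order `δ`. This is impossible for `D ≥ 2`, and the value of `δ` leaves ample
  -- room here.
  have k7 : (D - 2 * δ) ≤ 1002 / 1000 + 10 * (D * (2002 * δ)) + 10 * δ := by
    refine le_of_mul_le_mul_right ?_ hSpos
    linarith
  rw [hδ] at k7
  linarith

end LocalOpt

end Core

end ClawFreeMWIS

namespace ClawFreeMWIS

/-! ### The scaled and truncated algorithm: iterations and guarantee -/

section Guarantee

variable {V : Type*} {G : SimpleGraph V} {d : ℕ} {w : V → ℝ}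

lemma mem_nbhd {U W : Finset V} {x : V} :
    x ∈ nbhd G U W ↔ x ∈ W ∧ ∃ u ∈ U, G.Adj u x ∨ u = x := by
  classical
  simp [nbhd]

lemma nbhd_singleton_eq_empty {A : Finset V} {v : V} :
    nbhd G {v} A = ∅ ↔ ∀ x ∈ A, ¬ (G.Adj v x ∨ v = x) := by
  rw [Finset.eq_empty_iff_forall_notMem]
  simp only [mem_nbhd, Finset.mem_singleton, exists_eq_left, not_and]

/-- The case `u = x` in `nbhd` disappears, since a vertex of `A ∩ X` is removed and put back. -/
lemma mem_exchange {A X : Finset V} {v : V} :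
    v ∈ exchange G A X ↔ v ∈ X ∨ (v ∈ A ∧ ∀ u ∈ X, ¬ G.Adj u v) := by
  classical
  simp only [exchange, Finset.mem_union, Finset.mem_sdiff, mem_nbhd]
  constructor
  · rintro (⟨h1, h2⟩ | h)
    · exact Or.inr ⟨h1, fun u hu hadj => h2 ⟨h1, u, hu, Or.inl hadj⟩⟩
    · exact Or.inl h
  · rintro (h | ⟨h1, h2⟩)
    · exact Or.inr h
    · by_cases hX : v ∈ X
      · exact Or.inr hX
      · refine Or.inl ⟨h1, ?_⟩
        rintro ⟨-, u, hu, hadj | rfl⟩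
        · exact h2 u hu hadj
        · exact hX hu

lemma isIndepSet_iff {S : Finset V} :
    G.IsIndepSet (S : Set V) ↔ ∀ u ∈ S, ∀ v ∈ S, ¬ G.Adj u v := by
  constructor
  · intro h u hu v hv hadj
    exact h hu hv hadj.ne hadj
  · intro h u hu v hv _
    exact h u hu v hv

lemma isIndepSet_exchange {A X : Finset V} (hA : G.IsIndepSet (A : Set V))
    (hX : G.IsIndepSet (X : Set V)) : G.IsIndepSet (exchange G A X : Set V) := by
  rw [isIndepSet_iff] at *
  intro u hu v hv hadj
  rw [mem_exchange] at hu hv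
  rcases hu with hu | hu <;> rcases hv with hv | hv
  · exact hX u hu v hv hadj
  · exact hv.2 u hu hadj
  · exact hu.2 v hv hadj.symm
  · exact hA u hu.1 v hv.1 hadj

lemma Run.indep_and_subset {U : Finset V} {i : ℕ} {A : Finset V} (h : Run d G w U i A) :
    G.IsIndepSet (A : Set V) ∧ A ⊆ U := by
  induction h with
  | start => simp
  | step _ hX himp ih =>
    refine ⟨isIndepSet_exchange ih.1 himp.1, fun v hv => ?_⟩
    rcases mem_exchange.1 hv with hv | hv
    · exact hX hv
    · exact ih.2 hv.1

lemma wtSq_exchange (A X : Finset V) :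
    wtSq w (exchange G A X) = wtSq w A - wtSq w (nbhd G X A) + wtSq w X := by
  classical
  unfold wtSq
  have hdisj : Disjoint (A \ nbhd G X A) X := by
    rw [Finset.disjoint_left]
    intro v hv hX
    rw [Finset.mem_sdiff, mem_nbhd] at hv
    exact hv.2 ⟨hv.1, v, hX, Or.inr rfl⟩
  have h1 : exchange G A X = (A \ nbhd G X A) ∪ X := by
    unfold exchange
    congr!
  have h2 : nbhd G X A ⊆ A := fun v hv => (mem_nbhd.1 hv).1
  rw [h1, Finset.sum_union hdisj, ← Finset.sum_sdiff h2]
  ring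

/-- An independent set contains at most `d - 1` vertices equal or adjacent to a given one. -/
lemma ClawFree.card_closedNbhd_le (hG : ClawFree d G) (hd : 2 ≤ d) {S : Finset V}
    (hS : G.IsIndepSet (S : Set V)) (v : V) {T : Finset V} (hTS : T ⊆ S)
    (hT : ∀ u ∈ T, G.Adj v u ∨ v = u) : T.card ≤ d - 1 := by
  classical
  rw [isIndepSet_iff] at hS
  by_cases hv : v ∈ T
  · have : T ⊆ {v} := by
      intro u hu
      rcases hT u hu with h | h
      · exact absurd h (hS v (hTS hv) u (hTS hu))
      · simp [h]
    have := Finset.card_le_card this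
    simp at this
    omega
  · by_contra hcard
    obtain ⟨T', hT', hT'card⟩ := Finset.exists_subset_card_eq (show d ≤ T.card by omega)
    refine hG ⟨v, T', hT'card, fun t ht => ?_, ?_⟩
    · rcases hT t (hT' ht) with h | h
      · exact h
      · exact absurd (h ▸ hT' ht) hv
    · rw [isIndepSet_iff]
      exact fun u hu x hx => hS u (hTS (hT' hu)) x (hTS (hT' hx))

/-- Equality is part of the relation, so a vertex common to `A` and `B` counts as its own neighbour;
the vertices of `A` related to `X` are then exactly `nbhd G X A`. -/
lemma localOpt_of_no_improvement (hG : ClawFree d G) (hd : 2 ≤ d) {U A B : Finset V}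
    (hpos : ∀ v ∈ U, 0 < w v) (hAU : A ⊆ U) (hBU : B ⊆ U) (hA : G.IsIndepSet (A : Set V))
    (hB : G.IsIndepSet (B : Set V)) (hopt : ¬ ∃ X, X ⊆ U ∧ IsLocalImprovement d G w A X) :
    LocalOpt (fun u v => G.Adj u v ∨ u = v) (d - 1) A B w where
  posA v hv := hpos v (hAU hv)
  posB v hv := hpos v (hBU hv)
  degA u _ := hG.card_closedNbhd_le hd hA u (fun _ hx => (mem_rel.1 hx).1)
    fun _ hx => (mem_rel.1 hx).2
  degB v _ := by
    refine hG.card_closedNbhd_le hd hB v (fun x hx => ?_) fun x hx => ?_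
    · simp only [Finset.mem_filter] at hx
      exact hx.1
    · simp only [Finset.mem_filter] at hx
      exact hx.2.imp (fun h => h.symm) (fun h => h.symm)
  opt X hX hcard := by
    classical
    by_contra hlt
    push Not at hlt
    refine hopt ⟨X, hX.trans hBU, ?_, hcard, ?_⟩
    · rw [isIndepSet_iff] at hB ⊢
      exact fun u hu v hv => hB u (hX hu) v (hX hv)
    · rw [wtSq_exchange]
      have h1 : wtSq w (nbhd G X A) < wtSq w X := by
        refine lt_of_eq_of_lt (Finset.sum_congr ?_ fun _ _ => rfl) hlt
        ext v
        simp only [mem_nbhd, Finset.mem_filter]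
      linarith

lemma approxRatio_nonneg (hd : 2 ≤ d) : 0 ≤ approxRatio d := by
  unfold approxRatio
  split_ifs
  · norm_num
  · have : (2 : ℝ) ≤ d := by exact_mod_cast hd
    linarith

lemma approxRatio_le (d : ℕ) : approxRatio d ≤ d / 2 := by
  unfold approxRatio
  split_ifs with h
  · rw [h]; norm_num
  · linarith

/-- The guarantee for a local optimum. -/
theorem wt_le_of_no_improvement (hG : ClawFree d G) (hd : 2 ≤ d) {U A B : Finset V}
    (hpos : ∀ v ∈ U, 0 < w v) (hAU : A ⊆ U) (hBU : B ⊆ U) (hA : G.IsIndepSet (A : Set V))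
    (hB : G.IsIndepSet (B : Set V)) (hopt : ¬ ∃ X, X ⊆ U ∧ IsLocalImprovement d G w A X) :
    wt w B ≤ approxRatio d * wt w A := by
  have h := localOpt_of_no_improvement hG hd hpos hAU hBU hA hB hopt
  unfold approxRatio wt
  split_ifs with hd2
  · rw [one_mul]
    exact h.weight_le_of_degree_one (by omega)
  · have h1 := h.weight_le (by omega)
    have h2 : ((d - 1 : ℕ) : ℝ) + 1 = d := by
      rw [Nat.cast_sub (by omega)]; simp
    rwa [h2] at h1

/-! ### Domination by the greedy solution. -/

/-- The vertex that first blocks `u` was chosen while `u` was still available, so it is at least as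
heavy. -/
lemma GreedyReaches.dominates {A : Finset V} (h : GreedyReaches G w A) :
    G.IsIndepSet (A : Set V) ∧
      ∀ u, nbhd G {u} A ≠ ∅ → ∃ v ∈ A, (G.Adj v u ∨ v = u) ∧ w u ≤ w v := by
  classical
  induction h with
  | start => simp [nbhd_singleton_eq_empty]
  | @step A v _ hv hmax ih =>
    constructor
    · rw [nbhd_singleton_eq_empty] at hv
      rw [isIndepSet_iff] at ih ⊢
      intro x hx y hy hadj
      rw [Finset.mem_insert] at hx hy
      rcases hx with rfl | hx <;> rcases hy with rfl | hy
      · exact G.loopless.irrefl _ hadj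
      · exact hv y hy (Or.inl hadj)
      · exact hv x hx (Or.inl hadj.symm)
      · exact ih.1 x hx y hy hadj
    · intro u hu
      by_cases hu' : nbhd G {u} A = ∅
      · have h1 := hmax u hu'
        rw [Ne, nbhd_singleton_eq_empty] at hu
        push Not at hu
        obtain ⟨x, hx, hux⟩ := hu
        rw [nbhd_singleton_eq_empty] at hu'
        rcases Finset.mem_insert.1 hx with rfl | hx
        · refine ⟨x, Finset.mem_insert_self _ _, ?_, h1⟩
          rcases hux with h | h
          · exact Or.inl h.symm
          · exact Or.inr h.symm
        · exact absurd hux (hu' x hx)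
      · obtain ⟨x, hx, hux⟩ := ih.2 u hu'
        exact ⟨x, Finset.mem_insert_of_mem hx, hux⟩

lemma IsGreedySolution.exists_dominating {A : Finset V} (h : IsGreedySolution G w A) (u : V) :
    ∃ v ∈ A, (G.Adj v u ∨ v = u) ∧ w u ≤ w v :=
  h.1.dominates.2 u (h.2 u)

lemma IsGreedySolution.weight_le {A : Finset V} (h : IsGreedySolution G w A)
    (hpos : ∀ v, 0 < w v) (u : V) : w u ≤ wt w A := by
  obtain ⟨v, hv, -, hle⟩ := h.exists_dominating u
  exact hle.trans (Finset.single_le_sum (fun x _ => (hpos x).le) hv)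

/-- The greedy solution is a `(d - 1)`-approximation. -/
theorem IsGreedySolution.isApproxMWIS (hG : ClawFree d G) (hd : 2 ≤ d) (hpos : ∀ v, 0 < w v)
    {A : Finset V} (h : IsGreedySolution G w A) : IsApproxMWIS ((d : ℝ) - 1) G w A := by
  classical
  refine ⟨h.1.dominates.1, fun B hB => ?_⟩
  -- Each vertex of `B` is charged to a greedy vertex in its closed neighbourhood that is at least
  -- as heavy; by claw-freeness a greedy vertex receives at most `d - 1` charges.
  choose f hfA hf hfw using h.exists_dominating
  calc wt w B ≤ ∑ u ∈ B, w (f u) := Finset.sum_le_sum fun u _ => hfw u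
    _ = ∑ v ∈ A, ∑ u ∈ B with f u = v, w (f u) :=
        (Finset.sum_fiberwise_of_maps_to (fun u _ => hfA u) _).symm
    _ ≤ ∑ v ∈ A, ((d : ℝ) - 1) * w v := Finset.sum_le_sum fun v _ => by
        have h1 : ∑ u ∈ B with f u = v, w (f u) = ∑ u ∈ B with f u = v, w v :=
          Finset.sum_congr rfl fun u hu => by rw [(Finset.mem_filter.1 hu).2]
        rw [h1, Finset.sum_const, nsmul_eq_mul]
        have h2 := hG.card_closedNbhd_le hd hB v (Finset.filter_subset (fun u => f u = v) B)
          fun u hu => by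
            have := hf u
            rwa [(Finset.mem_filter.1 hu).2] at this
        have h3 : ((B.filter fun u => f u = v).card : ℝ) ≤ (d : ℝ) - 1 := by
          have : ((d - 1 : ℕ) : ℝ) = (d : ℝ) - 1 := by rw [Nat.cast_sub (by omega)]; simp
          rw [← this]
          exact_mod_cast h2
        exact mul_le_mul_of_nonneg_right h3 (hpos v).le
    _ = ((d : ℝ) - 1) * wt w A := by rw [wt, Finset.mul_sum]

lemma IsApproxMWIS.mono {r r' : ℝ} {A : Finset V} (h : IsApproxMWIS r G w A)
    (hpos : ∀ v, 0 < w v) (hr : r ≤ r') : IsApproxMWIS r' G w A :=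
  ⟨h.1, fun B hB => (h.2 B hB).trans
    (mul_le_mul_of_nonneg_right hr (Finset.sum_nonneg fun v _ => (hpos v).le))⟩

/-- With integral weights each strict increase of `w²` is an increase by at least `1`. -/
lemma Run.le_wtSq {U : Finset V} {i : ℕ} {A : Finset V} (hint : ∀ v, ∃ k : ℕ, w v = k)
    (h : Run d G w U i A) : (i : ℝ) ≤ wtSq w A := by
  choose k hk using hint
  have hcast : ∀ S : Finset V, wtSq w S = ((∑ v ∈ S, k v ^ 2 : ℕ) : ℝ) := fun S => by
    simp [wtSq, hk]
  induction h with
  | start => simp [wtSq]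
  | step _ _ himp ih =>
    have h1 := himp.2.2
    rw [hcast] at ih h1 ⊢
    rw [hcast] at h1
    norm_cast at *
    omega

/-! ### Rescaling and truncation. -/

variable [Fintype V]

lemma truncWeight_le {N : ℝ} (hN : 1 < N) (hpos : ∀ v, 0 < w v) (A' : Finset V) (v : V) :
    truncWeight N w A' v ≤ N * Fintype.card V / wt w A' * w v := by
  have h0 : 0 ≤ wt w A' := Finset.sum_nonneg fun v _ => (hpos v).le
  exact Nat.floor_le (mul_nonneg (by positivity) (hpos v).le)

lemma truncWeight_nonneg {N : ℝ} (A' : Finset V) (v : V) : 0 ≤ truncWeight N w A' v :=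
  Nat.cast_nonneg _

lemma wt_truncWeight_le {N : ℝ} (hN : 1 < N) (hpos : ∀ v, 0 < w v) (A' S : Finset V) :
    wt (truncWeight N w A') S ≤ N * Fintype.card V / wt w A' * wt w S := by
  unfold wt
  rw [Finset.mul_sum]
  exact Finset.sum_le_sum fun _ _ => truncWeight_le hN hpos _ _

/-- The number of iterations. -/
theorem Run.iterations_le (hG : ClawFree d G) (hd : 2 ≤ d) {N : ℝ} (hN : 1 < N)
    (hpos : ∀ v, 0 < w v) {A' : Finset V} (hA' : IsGreedySolution G w A') {i : ℕ} {A : Finset V}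
    (h : Run d G (truncWeight N w A') (keptVertices N w A') i A) :
    (i : ℝ) ≤ ((d : ℝ) - 1) ^ 2 * N ^ 2 * (Fintype.card V : ℝ) ^ 2 := by
  have hdr : (2 : ℝ) ≤ d := by exact_mod_cast hd
  refine (h.le_wtSq fun v => ⟨_, rfl⟩).trans ?_
  have h1 : wtSq (truncWeight N w A') A ≤ (wt (truncWeight N w A') A) ^ 2 :=
    Finset.sum_sq_le_sq_sum_of_nonneg fun v _ => truncWeight_nonneg A' v
  have h0 : 0 ≤ wt w A' := Finset.sum_nonneg fun v _ => (hpos v).le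
  -- Rescaled, the greedy solution weighs `N · |V|`, every independent set at most `d - 1` times as
  -- much, and rounding down only decreases weights.
  have h2 : wt (truncWeight N w A') A ≤ ((d : ℝ) - 1) * (N * Fintype.card V) := by
    refine (wt_truncWeight_le hN hpos A' A).trans ?_
    have h3 := (hA'.isApproxMWIS hG hd hpos).2 A h.indep_and_subset.1
    calc N * Fintype.card V / wt w A' * wt w A
        ≤ N * Fintype.card V / wt w A' * (((d : ℝ) - 1) * wt w A') := by gcongr
      _ = ((d : ℝ) - 1) * (N * Fintype.card V / wt w A' * wt w A') := by ring
      _ ≤ ((d : ℝ) - 1) * (N * Fintype.card V) := by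
          refine mul_le_mul_of_nonneg_left ?_ (by linarith)
          rcases h0.eq_or_lt with h | h
          · rw [← h, mul_zero]; positivity
          · rw [div_mul_cancel₀ _ h.ne']
  have h3 : 0 ≤ wt (truncWeight N w A') A := Finset.sum_nonneg fun v _ => truncWeight_nonneg A' v
  calc _ ≤ _ := h1
    _ ≤ (((d : ℝ) - 1) * (N * Fintype.card V)) ^ 2 := by gcongr
    _ = _ := by ring

/-- The guarantee of the scaled and truncated algorithm. -/
theorem ScaledReturns.isApproxMWIS (hG : ClawFree d G) (hd : 2 ≤ d) {N : ℝ} (hN : 1 < N)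
    (hpos : ∀ v, 0 < w v) {A : Finset V} (h : ScaledReturns d N G w A) :
    IsApproxMWIS (approxRatio d * (N / (N - 1))) G w A := by
  classical
  obtain ⟨A', hA', ⟨i, hrun⟩, hopt⟩ := h
  refine ⟨hrun.indep_and_subset.1, ?_⟩
  have hρ := approxRatio_nonneg hd
  -- A set lighter than `A'` may be replaced by the independent set `A'`. For the remaining `B` the
  -- rescaled weight is at least `N · |V|`.
  suffices key : ∀ B : Finset V, G.IsIndepSet (B : Set V) → wt w A' ≤ wt w B →
      wt w B ≤ approxRatio d * (N / (N - 1)) * wt w A by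
    intro B hB
    rcases le_total (wt w A') (wt w B) with hle | hle
    · exact key B hB hle
    · exact hle.trans (key A' hA'.1.dominates.1 le_rfl)
  intro B hB hle
  have h0 : 0 ≤ wt w A' := Finset.sum_nonneg fun v _ => (hpos v).le
  rcases isEmpty_or_nonempty V with hV | ⟨⟨v₀⟩⟩
  · have : B = ∅ := Finset.eq_empty_of_isEmpty B
    have h2 : A = ∅ := Finset.eq_empty_of_isEmpty A
    simp [this, h2, wt]
  have hWpos : 0 < wt w A' := (hpos v₀).trans_le (hA'.weight_le hpos v₀)
  have hcard : (0 : ℝ) < Fintype.card V := by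
    exact_mod_cast Fintype.card_pos_iff.2 ⟨v₀⟩
  set s := N * Fintype.card V / wt w A' with hs
  have hspos : 0 < s := by positivity
  have hsW : s * wt w A' = N * Fintype.card V := by rw [hs]; field_simp
  set tw := truncWeight N w A' with htw
  set U := keptVertices N w A' with hU
  have hUmem : ∀ v, v ∈ U ↔ tw v ≠ 0 := fun v => by simp [hU, keptVertices, htw]
  have h1 : wt tw (B ∩ U) ≤ approxRatio d * wt tw A := by
    refine wt_le_of_no_improvement hG hd (fun v hv => ?_) hrun.indep_and_subset.2
      Finset.inter_subset_right hrun.indep_and_subset.1 ?_ hopt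
    · exact lt_of_le_of_ne (truncWeight_nonneg A' v) (Ne.symm ((hUmem v).1 hv))
    · rw [isIndepSet_iff] at hB ⊢
      exact fun u hu v hv => hB u (Finset.mem_of_mem_inter_left hu) v
        (Finset.mem_of_mem_inter_left hv)
  have h2 : wt tw (B ∩ U) = wt tw B := by
    refine Finset.sum_subset Finset.inter_subset_left fun v hv hv' => ?_
    by_contra hne
    exact hv' (Finset.mem_inter.2 ⟨hv, (hUmem v).2 hne⟩)
  have h3 : s * wt w B - Fintype.card V ≤ wt tw B := by
    have h4 : s * wt w B - B.card ≤ wt tw B := by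
      unfold wt
      rw [Finset.mul_sum, Finset.card_eq_sum_ones, Nat.cast_sum, ← Finset.sum_sub_distrib]
      refine Finset.sum_le_sum fun v _ => ?_
      have := Nat.lt_floor_add_one (s * w v)
      change s * w v - _ ≤ (⌊s * w v⌋₊ : ℝ)
      push_cast
      linarith
    have h5 : (B.card : ℝ) ≤ Fintype.card V := by exact_mod_cast Finset.card_le_univ B
    linarith
  have h4 : N * Fintype.card V ≤ s * wt w B := by
    rw [← hsW]; gcongr
  -- The rounding loss is at most `|V| ≤ s · w(B) / N`.
  have h5 : (N - 1) * (s * wt w B) ≤ N * wt tw B := by nlinarith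
  have h6 : wt tw A ≤ s * wt w A := wt_truncWeight_le hN hpos A' A
  have h7 : (N - 1) * (s * wt w B) ≤ N * (approxRatio d * (s * wt w A)) := by
    refine h5.trans ?_
    rw [← h2]
    exact mul_le_mul_of_nonneg_left (h1.trans (mul_le_mul_of_nonneg_left h6 hρ)) (by linarith)
  have hN1 : 0 < N - 1 := by linarith
  have h8 : (N - 1) * wt w B ≤ N * (approxRatio d * wt w A) := by
    refine le_of_mul_le_mul_left ?_ hspos
    linarith
  have h9 : approxRatio d * (N / (N - 1)) * wt w A =
      N * (approxRatio d * wt w A) / (N - 1) := by ring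
  rw [h9, le_div_iff₀ hN1]
  linarith

/-- A truncation parameter of order `1 / ε` costs at most `ε` in the guarantee. -/
theorem ScaledReturns.isApproxMWIS_add (hG : ClawFree d G) (hd : 2 ≤ d) {m : ℕ} {ε : ℝ}
    (hε : 0 < ε) (hm : (d : ℝ) ≤ m * ε) (hpos : ∀ v, 0 < w v) {A : Finset V}
    (h : ScaledReturns d ((m + 1 : ℕ) : ℝ) G w A) :
    IsApproxMWIS (approxRatio d + ε) G w A := by
  have hdr : (2 : ℝ) ≤ d := by exact_mod_cast hd
  have hm0 : (0 : ℝ) < m := by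
    by_contra h0
    nlinarith
  have hN : (1 : ℝ) < ((m + 1 : ℕ) : ℝ) := by push_cast; linarith
  refine (h.isApproxMWIS hG hd hN hpos).mono hpos ?_
  have h1 := approxRatio_le d
  push_cast
  -- `N / (N - 1) = 1 + 1/m` for `N = m + 1`, and `approxRatio d ≤ d/2` makes the extra term at most
  -- `ε`.
  have h2 : approxRatio d * ((m + 1 : ℝ) / (m + 1 - 1)) = approxRatio d + approxRatio d / m := by
    rw [add_sub_cancel_right]
    field_simp
  rw [h2]
  gcongr
  rw [div_le_iff₀ hm0]
  linarith

end Guarantee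

/-! ### Conflict graphs -/

lemma isIndepSet_conflictGraph {ι α : Type*} {S : ι → Finset α} {A : Finset ι} :
    (conflictGraph S).IsIndepSet (A : Set ι) ↔ (A : Set ι).PairwiseDisjoint S := by
  constructor
  · intro h i hi j hj hij
    by_contra hd
    exact h hi hj hij ⟨hij, hd⟩
  · intro h i hi j hj hij hadj
    exact hadj.2 (h hi hj hij)

lemma IsApproxMWIS.isApproxPacking {ι α : Type*} {S : ι → Finset α} {w : ι → ℝ} {r : ℝ}
    {A : Finset ι} (h : IsApproxMWIS r (conflictGraph S) w A) : IsApproxPacking r S w A :=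
  ⟨isIndepSet_conflictGraph.1 h.1, fun B hB => h.2 B (isIndepSet_conflictGraph.2 hB)⟩

/-- Each talon shares an element with the centre, and talons are pairwise disjoint, so `k + 1`
talons would need `k + 1` distinct elements of the central set. -/
theorem clawFree_conflictGraph {ι α : Type*} {k : ℕ} {S : ι → Finset α}
    (hS : ∀ i, (S i).card ≤ k) : ClawFree (k + 1) (conflictGraph S) := by
  classical
  rintro ⟨c, T, hcard, hadj, hT⟩
  have hmeet : ∀ t : ι, ∃ x, t ∈ T → x ∈ S c ∧ x ∈ S t := by
    intro t
    by_cases ht : t ∈ T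
    · obtain ⟨x, hx, hx'⟩ := Finset.not_disjoint_iff.1 (hadj t ht).2
      exact ⟨x, fun _ => ⟨hx, hx'⟩⟩
    -- The value outside `T` is irrelevant; that `α` has an element follows from any talon.
    · by_cases hc : Nonempty α
      · exact ⟨hc.some, fun h => absurd h ht⟩
      · have hne : T.Nonempty := by rw [← Finset.card_pos]; omega
        obtain ⟨t', ht'⟩ := hne
        obtain ⟨x, -, -⟩ := Finset.not_disjoint_iff.1 (hadj t' ht').2
        exact absurd ⟨x⟩ hc
  choose f hf using hmeet
  have hle : T.card ≤ (S c).card := by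
    refine Finset.card_le_card_of_injOn f (fun t ht => (hf t ht).1) ?_
    intro s hs t ht hst
    by_contra hne
    have := isIndepSet_conflictGraph.1 hT hs ht hne
    exact Finset.disjoint_left.1 this (hf s hs).2 (hst ▸ (hf t ht).2)
  have := hS c
  omega

end ClawFreeMWIS

/-! ### A calculus of timed specifications for the random access machine -/

namespace RAM

/-- Started in `σ`, the program `P` halts within `T` steps in a memory satisfying `Q`. -/
def Within (P : Prog) (σ : Store) (T : ℕ) (Q : Store → Prop) : Prop :=
  ∃ t σ₁, Exec P σ t σ₁ ∧ t ≤ T ∧ Q σ₁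

/-- `P` contains an assignment to the array `nat a`. -/
def Prog.writesNat (b : ℕ) : Prog → Prop
  | .skip => False
  | .setNat a _ _ => b = a
  | .setReal _ _ _ => False
  | .seq P Q => P.writesNat b ∨ Q.writesNat b
  | .ite _ P Q => P.writesNat b ∨ Q.writesNat b
  | .while _ P => P.writesNat b

/-- `P` contains an assignment to the array `real a`. -/
def Prog.writesReal (b : ℕ) : Prog → Prop
  | .skip => False
  | .setNat _ _ _ => False
  | .setReal a _ _ => b = a
  | .seq P Q => P.writesReal b ∨ Q.writesReal b
  | .ite _ P Q => P.writesReal b ∨ Q.writesReal b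
  | .while _ P => P.writesReal b

/-- The memories `σ` and `σ'` differ only in arrays that `P` writes. -/
structure Frame (P : Prog) (σ σ' : Store) : Prop where
  nat : ∀ a, ¬ P.writesNat a → σ'.nat a = σ.nat a
  real : ∀ a, ¬ P.writesReal a → σ'.real a = σ.real a

lemma Frame.refl (P : Prog) (σ : Store) : Frame P σ σ := ⟨fun _ _ => rfl, fun _ _ => rfl⟩

lemma Frame.trans {P : Prog} {σ σ' σ'' : Store} (h : Frame P σ σ') (h' : Frame P σ' σ'') :
    Frame P σ σ'' :=
  ⟨fun a ha => (h'.nat a ha).trans (h.nat a ha), fun a ha => (h'.real a ha).trans (h.real a ha)⟩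

lemma Frame.mono {P Q : Prog} {σ σ' : Store} (h : Frame P σ σ')
    (hn : ∀ a, P.writesNat a → Q.writesNat a) (hr : ∀ a, P.writesReal a → Q.writesReal a) :
    Frame Q σ σ' :=
  ⟨fun a ha => h.nat a fun h => ha (hn a h), fun a ha => h.real a fun h => ha (hr a h)⟩

lemma Exec.frame {P : Prog} {σ σ' : Store} {t : ℕ} (h : Exec P σ t σ') : Frame P σ σ' := by
  induction h with
  | skip σ => exact Frame.refl _ _
  | setNat σ a i e =>
    exact ⟨fun b hb => Function.update_of_ne hb _ _, fun _ _ => rfl⟩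
  | setReal σ a i e =>
    exact ⟨fun _ _ => rfl, fun b hb => Function.update_of_ne hb _ _⟩
  | seq _ _ ih1 ih2 =>
    exact (ih1.mono (fun _ => Or.inl) fun _ => Or.inl).trans
      (ih2.mono (fun _ => Or.inr) fun _ => Or.inr)
  | ite_true _ _ ih => exact ih.mono (fun _ => Or.inl) fun _ => Or.inl
  | ite_false _ _ ih => exact ih.mono (fun _ => Or.inr) fun _ => Or.inr
  | while_false _ => exact Frame.refl _ _
  | while_true _ _ _ ih1 ih2 => exact Frame.trans ⟨ih1.nat, ih1.real⟩ ih2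

/-! ### Effect of single assignments. -/

@[simp] lemma setNat_real (σ : Store) (a i x : ℕ) : (σ.setNat a i x).real = σ.real := rfl

@[simp] lemma setReal_nat (σ : Store) (a i : ℕ) (x : ℝ) : (σ.setReal a i x).nat = σ.nat := rfl

lemma setNat_nat (σ : Store) (a i x b j : ℕ) :
    (σ.setNat a i x).nat b j = if b = a ∧ j = i then x else σ.nat b j := by
  by_cases hb : b = a
  · subst hb
    by_cases hj : j = i
    · subst hj; simp [Store.setNat]
    · simp [Store.setNat, hj]
  · simp [Store.setNat, hb]

lemma setReal_real (σ : Store) (a i : ℕ) (x : ℝ) (b j : ℕ) :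
    (σ.setReal a i x).real b j = if b = a ∧ j = i then x else σ.real b j := by
  by_cases hb : b = a
  · subst hb
    by_cases hj : j = i
    · subst hj; simp [Store.setReal]
    · simp [Store.setReal, hj]
  · simp [Store.setReal, hb]

@[simp] lemma setNat_nat_same (σ : Store) (a i x : ℕ) : (σ.setNat a i x).nat a i = x := by
  simp [setNat_nat]

lemma setNat_nat_of_ne (σ : Store) {a b : ℕ} (i x : ℕ) (h : b ≠ a) :
    (σ.setNat a i x).nat b = σ.nat b := Function.update_of_ne h _ _

@[simp] lemma setReal_real_same (σ : Store) (a i : ℕ) (x : ℝ) :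
    (σ.setReal a i x).real a i = x := by
  simp [setReal_real]

lemma setReal_real_of_ne (σ : Store) {a b : ℕ} (i : ℕ) (x : ℝ) (h : b ≠ a) :
    (σ.setReal a i x).real b = σ.real b := Function.update_of_ne h _ _

/-! ### Rules for total correctness with step bounds. -/

namespace Within

variable {P P' : Prog} {σ : Store} {T T' : ℕ} {Q Q' R : Store → Prop}

lemma mono (h : Within P σ T Q) (hT : T ≤ T') (hQ : ∀ σ', Frame P σ σ' → Q σ' → Q' σ') :
    Within P σ T' Q' := by
  obtain ⟨t, σ', hex, ht, hq⟩ := h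
  exact ⟨t, σ', hex, ht.trans hT, hQ σ' hex.frame hq⟩

lemma post (h : Within P σ T Q) (hQ : ∀ σ', Frame P σ σ' → Q σ' → Q' σ') : Within P σ T Q' :=
  h.mono le_rfl hQ

lemma skip (h : Q σ) : Within .skip σ 1 Q := ⟨1, σ, .skip σ, le_rfl, h⟩

lemma setNat {a : ℕ} {i e : NatExpr} (h : Q (σ.setNat a (i.eval σ) (e.eval σ))) :
    Within (.setNat a i e) σ 1 Q := ⟨1, _, .setNat σ a i e, le_rfl, h⟩

lemma setReal {a : ℕ} {i : NatExpr} {e : RealExpr} (h : Q (σ.setReal a (i.eval σ) (e.eval σ))) :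
    Within (.setReal a i e) σ 1 Q := ⟨1, _, .setReal σ a i e, le_rfl, h⟩

lemma seq (h : Within P σ T R) (h' : ∀ σ', Frame P σ σ' → R σ' → Within P' σ' T' Q) :
    Within (.seq P P') σ (T + T') Q := by
  obtain ⟨t, σ', hex, ht, hr⟩ := h
  obtain ⟨t', σ'', hex', ht', hq⟩ := h' σ' hex.frame hr
  exact ⟨t + t', σ'', .seq hex hex', by omega, hq⟩

lemma seqNat {a : ℕ} {i e : NatExpr}
    (h : Within P (σ.setNat a (i.eval σ) (e.eval σ)) T Q) :
    Within (.seq (.setNat a i e) P) σ (T + 1) Q := by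
  obtain ⟨t, σ', hex, ht, hr⟩ := h
  exact ⟨1 + t, σ', .seq (.setNat σ a i e) hex, by omega, hr⟩

lemma seqReal {a : ℕ} {i : NatExpr} {e : RealExpr}
    (h : Within P (σ.setReal a (i.eval σ) (e.eval σ)) T Q) :
    Within (.seq (.setReal a i e) P) σ (T + 1) Q := by
  obtain ⟨t, σ', hex, ht, hr⟩ := h
  exact ⟨1 + t, σ', .seq (.setReal σ a i e) hex, by omega, hr⟩

lemma ite {b : Test} (h : b.holds σ → Within P σ T Q) (h' : ¬ b.holds σ → Within P' σ T Q) :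
    Within (.ite b P P') σ (T + 1) Q := by
  by_cases hb : b.holds σ
  · obtain ⟨t, σ', hex, ht, hq⟩ := h hb
    exact ⟨t + 1, σ', .ite_true hb hex, by omega, hq⟩
  · obtain ⟨t, σ', hex, ht, hq⟩ := h' hb
    exact ⟨t + 1, σ', .ite_false hb hex, by omega, hq⟩

/-- A loop whose body uses up a budget `k`. -/
lemma while_budget {b : Test} {I : ℕ → Store → Prop} (k : ℕ) (hI : I k σ)
    (hstep : ∀ k σ', Frame P σ σ' → I k σ' → b.holds σ' →
      Within P σ' T (fun σ'' => ∃ k' < k, I k' σ'')) :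
    Within (.while b P) σ (k * (T + 1) + 1) (fun σ' => (∃ k, I k σ') ∧ ¬ b.holds σ') := by
  induction k using Nat.strong_induction_on generalizing σ with
  | _ k ih =>
    by_cases hb : b.holds σ
    · obtain ⟨t, σ', hex, ht, k', hk', hI'⟩ := hstep k σ (Frame.refl _ _) hI hb
      obtain ⟨t', σ'', hex', ht', hq⟩ := ih k' hk' hI' fun j σ₁ hf =>
        hstep j σ₁ (hex.frame.trans hf)
      refine ⟨t + t' + 1, σ'', .while_true hb hex hex', ?_, hq⟩
      have : (k' + 1) * (T + 1) ≤ k * (T + 1) := Nat.mul_le_mul_right _ hk'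
      nlinarith
    · exact ⟨1, σ, .while_false hb, by omega, ⟨k, hI⟩, hb⟩

end Within

/-! #### Derived expressions, tests and programs -/

/-- The register with name `a`: the entry `0` of the array `nat a`. -/
def reg (a : ℕ) : NatExpr := .get a (.const 0)

/-- The product with a constant. -/
def NatExpr.smul : ℕ → NatExpr → NatExpr
  | 0, _ => .const 0
  | k + 1, e => .add (NatExpr.smul k e) e

/-- A constant real number. -/
def RealExpr.ofNat : ℕ → RealExpr
  | 0 => .zero
  | k + 1 => .add (RealExpr.ofNat k) .one

def Test.or (b c : Test) : Test := .not (.and (.not b) (.not c))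

def Test.eq (e f : NatExpr) : Test := .and (.not (.natLt e f)) (.not (.natLt f e))

def Test.false : Test := .natLt (.const 0) (.const 0)

def Test.true : Test := .not .false

/-- The disjunction of the tests `b 0, …, b (k - 1)`. -/
def Test.orBelow : ℕ → (ℕ → Test) → Test
  | 0, _ => .false
  | k + 1, b => .or (Test.orBelow k b) (b k)

/-- The loop over the values `0, …, lim - 1` of the entry `i` of the array `nat a`. -/
def Prog.forUp (a i : ℕ) (lim : NatExpr) (P : Prog) : Prog :=
  .seq (.setNat a (.const i) (.const 0))
    (.while (.natLt (.get a (.const i)) lim)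
      (.seq P (.setNat a (.const i) (.add (.get a (.const i)) (.const 1)))))

/-- Set the entry `j` of `nat b` to the truth value of the test, for all `j` below the limit. -/
def Prog.mark (b c : ℕ) (lim : NatExpr) (t : Test) : Prog :=
  .forUp c 0 lim (.ite t (.setNat b (reg c) (.const 1)) (.setNat b (reg c) (.const 0)))

/-- Add up the expression over the indices below the limit that satisfy the test. -/
def Prog.sumIf (a c : ℕ) (lim : NatExpr) (t : Test) (e : NatExpr) : Prog :=
  .seq (.setNat a (.const 0) (.const 0))
    (.forUp c 0 lim (.ite t (.setNat a (.const 0) (.add (reg a) e)) .skip))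

/-! ### Evaluation of derived expressions and tests. -/

section Eval

variable (σ : Store)

@[simp] lemma eval_const (c : ℕ) : (NatExpr.const c).eval σ = c := rfl

@[simp] lemma eval_get (a : ℕ) (i : NatExpr) : (NatExpr.get a i).eval σ = σ.nat a (i.eval σ) := rfl

@[simp] lemma eval_add (e f : NatExpr) : (NatExpr.add e f).eval σ = e.eval σ + f.eval σ := rfl

@[simp] lemma eval_reg (a : ℕ) : (reg a).eval σ = σ.nat a 0 := rfl

@[simp] lemma eval_smul (k : ℕ) (e : NatExpr) : (NatExpr.smul k e).eval σ = k * e.eval σ := by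
  induction k with
  | zero => simp [NatExpr.smul]
  | succ k ih => simp [NatExpr.smul, ih, Nat.succ_mul]

@[simp] lemma realEval_zero : RealExpr.zero.eval σ = 0 := rfl

@[simp] lemma realEval_get (a : ℕ) (i : NatExpr) :
    (RealExpr.get a i).eval σ = σ.real a (i.eval σ) := rfl

@[simp] lemma realEval_add (e f : RealExpr) : (RealExpr.add e f).eval σ = e.eval σ + f.eval σ := rfl

@[simp] lemma realEval_ofNat (k : ℕ) : (RealExpr.ofNat k).eval σ = k := by
  induction k with
  | zero => simp [RealExpr.ofNat]
  | succ k ih => simp [RealExpr.ofNat, ih, RealExpr.eval]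

@[simp] lemma holds_natLt (e f : NatExpr) :
    (Test.natLt e f).holds σ ↔ e.eval σ < f.eval σ := Iff.rfl

@[simp] lemma holds_realLt (e f : RealExpr) :
    (Test.realLt e f).holds σ ↔ e.eval σ < f.eval σ := Iff.rfl

@[simp] lemma holds_not (b : Test) : (Test.not b).holds σ ↔ ¬ b.holds σ := Iff.rfl

@[simp] lemma holds_and (b c : Test) : (Test.and b c).holds σ ↔ b.holds σ ∧ c.holds σ := Iff.rfl

@[simp] lemma holds_or (b c : Test) : (Test.or b c).holds σ ↔ b.holds σ ∨ c.holds σ := by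
  simp only [Test.or, holds_not, holds_and]
  tauto

@[simp] lemma holds_eq (e f : NatExpr) : (Test.eq e f).holds σ ↔ e.eval σ = f.eval σ := by
  simp only [Test.eq, holds_not, holds_and, holds_natLt]
  omega

@[simp] lemma holds_false : Test.false.holds σ ↔ False := by simp [Test.false]

@[simp] lemma holds_true : Test.true.holds σ ↔ True := by simp [Test.true]

@[simp] lemma holds_orBelow (k : ℕ) (b : ℕ → Test) :
    (Test.orBelow k b).holds σ ↔ ∃ j < k, (b j).holds σ := by
  induction k with
  | zero => simp [Test.orBelow]
  | succ k ih => rw [Nat.exists_lt_succ_right, ← ih, Test.orBelow, holds_or]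

end Eval

/-! ### Arrays written by derived programs. -/

section Writes

variable (b : ℕ)

@[simp] lemma writesNat_skip : Prog.skip.writesNat b ↔ False := Iff.rfl
@[simp] lemma writesNat_setNat (a : ℕ) (i e : NatExpr) :
    (Prog.setNat a i e).writesNat b ↔ b = a := Iff.rfl
@[simp] lemma writesNat_setReal (a : ℕ) (i : NatExpr) (e : RealExpr) :
    (Prog.setReal a i e).writesNat b ↔ False := Iff.rfl
@[simp] lemma writesNat_seq (P Q : Prog) :
    (Prog.seq P Q).writesNat b ↔ P.writesNat b ∨ Q.writesNat b := Iff.rfl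
@[simp] lemma writesNat_ite (t : Test) (P Q : Prog) :
    (Prog.ite t P Q).writesNat b ↔ P.writesNat b ∨ Q.writesNat b := Iff.rfl
@[simp] lemma writesNat_while (t : Test) (P : Prog) :
    (Prog.while t P).writesNat b ↔ P.writesNat b := Iff.rfl
@[simp] lemma writesNat_forUp (a i : ℕ) (lim : NatExpr) (P : Prog) :
    (Prog.forUp a i lim P).writesNat b ↔ b = a ∨ P.writesNat b := by
  simp only [Prog.forUp, writesNat_seq, writesNat_setNat, writesNat_while]; tauto
@[simp] lemma writesNat_mark (a c : ℕ) (lim : NatExpr) (t : Test) :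
    (Prog.mark a c lim t).writesNat b ↔ b = c ∨ b = a := by
  simp [Prog.mark]
@[simp] lemma writesNat_sumIf (a c : ℕ) (lim : NatExpr) (t : Test) (e : NatExpr) :
    (Prog.sumIf a c lim t e).writesNat b ↔ b = a ∨ b = c := by
  simp only [Prog.sumIf, writesNat_seq, writesNat_forUp, writesNat_ite, writesNat_setNat,
    writesNat_skip]; tauto

@[simp] lemma writesReal_skip : Prog.skip.writesReal b ↔ False := Iff.rfl
@[simp] lemma writesReal_setNat (a : ℕ) (i e : NatExpr) :
    (Prog.setNat a i e).writesReal b ↔ False := Iff.rfl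
@[simp] lemma writesReal_setReal (a : ℕ) (i : NatExpr) (e : RealExpr) :
    (Prog.setReal a i e).writesReal b ↔ b = a := Iff.rfl
@[simp] lemma writesReal_seq (P Q : Prog) :
    (Prog.seq P Q).writesReal b ↔ P.writesReal b ∨ Q.writesReal b := Iff.rfl
@[simp] lemma writesReal_ite (t : Test) (P Q : Prog) :
    (Prog.ite t P Q).writesReal b ↔ P.writesReal b ∨ Q.writesReal b := Iff.rfl
@[simp] lemma writesReal_while (t : Test) (P : Prog) :
    (Prog.while t P).writesReal b ↔ P.writesReal b := Iff.rfl
@[simp] lemma writesReal_forUp (a i : ℕ) (lim : NatExpr) (P : Prog) :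
    (Prog.forUp a i lim P).writesReal b ↔ P.writesReal b := by
  simp [Prog.forUp]
@[simp] lemma writesReal_mark (a c : ℕ) (lim : NatExpr) (t : Test) :
    (Prog.mark a c lim t).writesReal b ↔ False := by
  simp [Prog.mark]
@[simp] lemma writesReal_sumIf (a c : ℕ) (lim : NatExpr) (t : Test) (e : NatExpr) :
    (Prog.sumIf a c lim t e).writesReal b ↔ False := by
  simp [Prog.sumIf]

end Writes

/-! ### Rules for counting loops. -/

namespace Within

variable {P : Prog} {σ : Store} {T L : ℕ} {Q : Store → Prop} {lim e : NatExpr} {t : Test}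

/-- The rule for counting loops, with an invariant that ignores the counter. -/
lemma forUp {a i : ℕ} {I : ℕ → Store → Prop}
    (hI : ∀ j σ' x, I j σ' → I j (σ'.setNat a i x)) (h0 : I 0 σ)
    (hlim : ∀ j σ', Frame (.forUp a i lim P) σ σ' → I j σ' → lim.eval σ' = L)
    (hstep : ∀ j σ', j < L → Frame (.forUp a i lim P) σ σ' → σ'.nat a i = j → I j σ' →
      Within P σ' T (fun σ'' => σ''.nat a i = j ∧ I (j + 1) σ'')) :
    Within (.forUp a i lim P) σ (L * (T + 2) + 2) (I L) := by
  have hF : ∀ {σ₁ σ₂ : Store}, Frame (.seq P (.setNat a (.const i)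
      (.add (.get a (.const i)) (.const 1)))) σ₁ σ₂ → Frame (.forUp a i lim P) σ₁ σ₂ := by
    intro σ₁ σ₂ h
    refine h.mono (fun b hb => ?_) fun b hb => ?_
    · simp only [writesNat_seq, writesNat_setNat] at hb
      simp only [writesNat_forUp]
      tauto
    · simpa using hb
  have hF0 : ∀ x, Frame (.forUp a i lim P) σ (σ.setNat a i x) := fun x =>
    ⟨fun b hb => setNat_nat_of_ne _ _ _ fun h => hb (by simp [h]), fun _ _ => rfl⟩
  refine (seqNat (T := L * (T + 2) + 1) ?_).mono (by omega) fun _ _ h => h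
  simp only [eval_const]
  -- The budget is the number of remaining passes, so the counter is `L - k`.
  refine (while_budget (T := T + 1)
    (I := fun k σ' => k ≤ L ∧ I (L - k) σ' ∧ σ'.nat a i = L - k) L
    ⟨le_rfl, by simpa using hI 0 σ 0 h0, by simp⟩ ?_).mono (by ring_nf; omega) ?_
  · rintro k σ' hf ⟨hk, hIk, hc⟩ hb
    have hf' := (hF0 0).trans (hF hf)
    have hl := hlim _ σ' hf' hIk
    simp only [holds_natLt, eval_get, eval_const, hl, hc] at hb
    refine seq (hstep (L - k) σ' (by omega) hf' hc hIk) ?_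
    rintro σ'' - ⟨hc'', hI''⟩
    refine setNat ⟨k - 1, by omega, by omega, ?_, ?_⟩
    · have : L - (k - 1) = L - k + 1 := by omega
      rw [this]
      exact hI _ _ _ hI''
    · simp only [eval_const, eval_add, eval_get, setNat_nat_same, hc'']
      omega
  · rintro σ' hf ⟨⟨k, hk, hIk, hc⟩, hb⟩
    have hf' := (hF0 0).trans (hF (hf.mono (fun _ h => h) fun _ h => h))
    have hl := hlim _ σ' hf' hIk
    simp only [holds_natLt, eval_get, eval_const, hl, hc] at hb
    have : L - k = L := by omega
    rwa [this] at hIk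

open Classical in
-- The test may rely on the entries of `b` from `j` on being still the old ones, so an array can be
-- updated in place from its own contents, as `insertBest` does with `nat 4`.
lemma mark {b c : ℕ} {p : ℕ → Prop} (hbc : b ≠ c)
    (hlim : ∀ σ', Frame (.mark b c lim t) σ σ' → lim.eval σ' = L)
    (ht : ∀ j σ', j < L → Frame (.mark b c lim t) σ σ' → σ'.nat c 0 = j →
      (∀ x, j ≤ x → σ'.nat b x = σ.nat b x) → (t.holds σ' ↔ p j)) :
    Within (.mark b c lim t) σ (L * 4 + 2)
      (fun σ' => ∀ j < L, σ'.nat b j = if p j then 1 else 0) := by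
  refine (forUp (T := 2) (I := fun j σ' => (∀ x < j, σ'.nat b x = if p x then 1 else 0) ∧
    ∀ x, j ≤ x → σ'.nat b x = σ.nat b x) ?_ (by simp) (fun _ σ' hf _ => hlim σ' hf) ?_).post ?_
  · rintro j σ' x ⟨h1, h2⟩
    rw [setNat_nat_of_ne _ _ _ hbc]
    exact ⟨h1, h2⟩
  · rintro j σ' hj hf hc ⟨h1, h2⟩
    have htj := ht j σ' hj hf hc h2
    refine ite (fun h => setNat ?_) (fun h => setNat ?_)
    all_goals
      rw [htj] at h
      simp only [eval_reg, eval_const, hc, setNat_nat]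
      refine ⟨by simp [hbc.symm], fun x hx => ?_, fun x hx => ?_⟩
      · rcases Nat.lt_succ_iff_lt_or_eq.1 hx with hx | rfl
        · simp only [hx.ne, and_false, if_false, h1 x hx]
        · simp [h]
      · have : x ≠ j := by omega
        simp only [this, and_false, if_false]
        exact h2 x (by omega)
  · rintro σ' - ⟨h1, -⟩
    exact h1

open Classical in
lemma sumIf {a c : ℕ} {p : ℕ → Prop} {g : ℕ → ℕ} (hac : a ≠ c)
    (hlim : ∀ σ', Frame (.sumIf a c lim t e) σ σ' → lim.eval σ' = L)
    (ht : ∀ j σ', j < L → Frame (.sumIf a c lim t e) σ σ' → σ'.nat c 0 = j →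
      (t.holds σ' ↔ p j) ∧ e.eval σ' = g j) :
    Within (.sumIf a c lim t e) σ (L * 4 + 3)
      (fun σ' => σ'.nat a 0 = ∑ j ∈ Finset.range L, if p j then g j else 0) := by
  refine seqNat (T := L * 4 + 2) ?_
  simp only [eval_const]
  have hF : ∀ σ', Frame (.forUp c 0 lim (.ite t (.setNat a (.const 0) (.add (reg a) e)) .skip))
      (σ.setNat a 0 0) σ' → Frame (.sumIf a c lim t e) σ σ' := by
    intro σ' hf
    have h0 : Frame (.sumIf a c lim t e) σ (σ.setNat a 0 0) :=
      ⟨fun b hb => setNat_nat_of_ne _ _ _ fun h => hb (by simp [h]), fun _ _ => rfl⟩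
    exact h0.trans (hf.mono (fun _ h => Or.inr h) fun _ h => Or.inr h)
  refine (forUp (T := 2) (L := L)
    (I := fun j σ' => σ'.nat a 0 = ∑ x ∈ Finset.range j, if p x then g x else 0) ?_
    (by simp) (fun _ σ' hf _ => hlim σ' (hF σ' hf)) ?_).post (fun _ _ h => h)
  · intro j σ' x h
    rw [setNat_nat_of_ne _ _ _ hac]
    exact h
  · intro j σ' hj hf hc hI
    obtain ⟨h1, h2⟩ := ht j σ' hj (hF σ' hf) hc
    rw [Finset.sum_range_succ, ← hI]
    refine ite (fun h => ?_) (fun h => ?_)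
    · rw [h1] at h
      refine (setNat ?_).mono (by omega) fun _ _ h => h
      simp only [eval_const, eval_add, eval_reg, h2, setNat_nat_same, h, if_true, and_true]
      rw [setNat_nat_of_ne _ _ _ hac.symm]
      exact hc
    · rw [h1] at h
      refine (skip ?_).mono (by omega) fun _ _ h => h
      simp [h, hc]

end Within

end RAM

namespace RAM

open ClawFreeMWIS

variable {n : ℕ} {σ σ' : Store}

/-! ### Graphs in memory -/

namespace Within

variable {lim e : NatExpr} {t : Test}

open Classical in
lemma markFin {b c : ℕ} {p : Fin n → Prop} (hbc : b ≠ c)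
    (hlim : ∀ σ', Frame (.mark b c lim t) σ σ' → lim.eval σ' = n)
    (ht : ∀ (v : Fin n) σ', Frame (.mark b c lim t) σ σ' → σ'.nat c 0 = v →
      (∀ x, (v : ℕ) ≤ x → σ'.nat b x = σ.nat b x) → (t.holds σ' ↔ p v)) :
    Within (.mark b c lim t) σ (n * 4 + 2)
      (fun σ' => ∀ v : Fin n, σ'.nat b v = if p v then 1 else 0) := by
  refine (mark (p := fun j => ∃ h : j < n, p ⟨j, h⟩) hbc hlim fun j σ' hj hf hc hx => ?_).post ?_
  · rw [ht ⟨j, hj⟩ σ' hf hc hx]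
    simp [hj]
  · intro σ' _ h v
    rw [h v v.2]
    simp

open Classical in
lemma sumIfFin {a c : ℕ} {p : Fin n → Prop} {g : Fin n → ℕ} (hac : a ≠ c)
    (hlim : ∀ σ', Frame (.sumIf a c lim t e) σ σ' → lim.eval σ' = n)
    (ht : ∀ (v : Fin n) σ', Frame (.sumIf a c lim t e) σ σ' → σ'.nat c 0 = v →
      (t.holds σ' ↔ p v) ∧ e.eval σ' = g v) :
    Within (.sumIf a c lim t e) σ (n * 4 + 3)
      (fun σ' => σ'.nat a 0 = ∑ v ∈ Finset.univ.filter p, g v) := by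
  refine (sumIf (p := fun j => ∃ h : j < n, p ⟨j, h⟩)
    (g := fun j => if h : j < n then g ⟨j, h⟩ else 0) hac hlim fun j σ' hj hf hc => ?_).post ?_
  · obtain ⟨h1, h2⟩ := ht ⟨j, hj⟩ σ' hf hc
    rw [h1, h2]
    simp [hj]
  · intro σ' _ h
    rw [h, Finset.sum_range, Finset.sum_filter]
    simp

end Within

/-- The array `nat a` holds the indicator function of `A`. -/
def HoldsSet (σ : Store) (a : ℕ) (A : Finset (Fin n)) : Prop :=
  ∀ v : Fin n, σ.nat a v = if v ∈ A then 1 else 0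

lemma HoldsSet.congr {a : ℕ} {A : Finset (Fin n)} (h : HoldsSet σ a A)
    (ha : σ'.nat a = σ.nat a) : HoldsSet σ' a A := fun v => by rw [ha, h v]

lemma HoldsSet.pos_iff {a : ℕ} {A : Finset (Fin n)} (h : HoldsSet σ a A) (v : Fin n) :
    0 < σ.nat a v ↔ v ∈ A := by
  rw [h v]; split_ifs <;> simp_all

lemma HoldsSet.output_eq {A : Finset (Fin n)} (h : HoldsSet σ 2 A) : output σ n = A := by
  ext v
  simp only [output, Finset.mem_filter, Finset.mem_univ, true_and]
  rw [h v]; split_ifs <;> simp_all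

/-- The memory holds a graph and the offsets of the rows of its adjacency matrix. -/
structure GraphMem (σ : Store) (G : SimpleGraph (Fin n)) : Prop where
  size : σ.nat 0 0 = n
  row : ∀ u : Fin n, σ.nat 5 u = u * n
  adj : ∀ u v : Fin n, 0 < σ.nat 1 (u * n + v) ↔ G.Adj u v

lemma GraphMem.congr {G : SimpleGraph (Fin n)} (h : GraphMem σ G) (h0 : σ'.nat 0 = σ.nat 0)
    (h1 : σ'.nat 1 = σ.nat 1) (h5 : σ'.nat 5 = σ.nat 5) : GraphMem σ' G :=
  ⟨by rw [h0, h.size], fun u => by rw [h5, h.row], fun u v => by rw [h1, h.adj]⟩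

/-- The test for adjacency of two vertices. -/
def adjTest (e f : NatExpr) : Test := .natLt (.const 0) (.get 1 (.add (.get 5 e) f))

lemma GraphMem.holds_adjTest {G : SimpleGraph (Fin n)} (h : GraphMem σ G) {e f : NatExpr}
    {u v : Fin n} (he : e.eval σ = u) (hf : f.eval σ = v) :
    (adjTest e f).holds σ ↔ G.Adj u v := by
  rw [← h.adj u v, ← h.row u]
  simp [adjTest, he, hf]

/-- Compute the offsets of the rows of a square matrix. -/
def rowOffsets : Prog :=
  .seq (.setNat 5 (.const 0) (.const 0))
    (.forUp 11 0 (reg 0)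
      (.setNat 5 (.add (reg 11) (.const 1)) (.add (.get 5 (reg 11)) (reg 0))))

lemma within_rowOffsets (h : σ.nat 0 0 = n) :
    Within rowOffsets σ (n * 3 + 3) (fun σ' => ∀ u : Fin n, σ'.nat 5 u = u * n) := by
  refine Within.seqNat (T := n * 3 + 2) ((Within.forUp (T := 1) (L := n)
    (I := fun j σ' => ∀ u ≤ j, σ'.nat 5 u = u * n) ?_ ?_ ?_ ?_).post ?_)
  · intro j σ' x h
    rwa [setNat_nat_of_ne _ _ _ (by decide)]
  · intro u hu
    simp [Nat.le_zero.1 hu]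
  · intro j σ' hf _
    rw [eval_reg, hf.nat 0 (by simp)]
    simpa [setNat_nat] using h
  · intro j σ' hj hf hc hI
    have hn : σ'.nat 0 0 = n := by
      rw [hf.nat 0 (by simp)]
      simpa [setNat_nat] using h
    refine Within.setNat ⟨by simp [setNat_nat, hc], fun u hu => ?_⟩
    simp only [eval_add, eval_reg, eval_const, eval_get, hc, hn, setNat_nat, true_and]
    split_ifs with hu'
    · rw [hu', hI j le_rfl]; ring
    · exact hI u (by omega)
  · intro σ' _ h u
    exact h u u.2.le

/-! ### The greedy algorithm -/

/-- Find a heaviest vertex `v` with `nat 4 v = 0`. -/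
def scan : Prog :=
  .seq (.setNat 13 (.const 0) (reg 0))
    (.forUp 11 0 (reg 0)
      (.ite (.and (.eq (.get 4 (reg 11)) (.const 0))
          (.or (.eq (reg 13) (reg 0)) (.realLt (.get 0 (reg 13)) (.get 0 (reg 11)))))
        (.setNat 13 (.const 0) (reg 11)) .skip))

/-- The value `n` in register `13` means that no admissible vertex has been seen. -/
lemma within_scan {w : Fin n → ℝ} {S : Finset (Fin n)} (hn : σ.nat 0 0 = n)
    (hw : ∀ v : Fin n, σ.real 0 v = w v) (hS : HoldsSet σ 4 S) :
    Within scan σ (n * 4 + 3) (fun σ' => (σ'.nat 13 0 = n ∧ ∀ v, v ∈ S) ∨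
      ∃ b : Fin n, σ'.nat 13 0 = b ∧ b ∉ S ∧ ∀ v, v ∉ S → w v ≤ w b) := by
  refine Within.seqNat (T := n * 4 + 2) ((Within.forUp (T := 2) (L := n)
    (I := fun j σ' => (σ'.nat 13 0 = n ∧ ∀ v : Fin n, (v : ℕ) < j → v ∈ S) ∨
      ∃ b : Fin n, σ'.nat 13 0 = b ∧ b ∉ S ∧ ∀ v : Fin n, (v : ℕ) < j → v ∉ S → w v ≤ w b)
    ?_ ?_ ?_ ?_).post ?_)
  · intro j σ' x h
    rwa [setNat_nat_of_ne _ _ _ (by decide)]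
  · left
    simp [hn]
  · intro j σ' hf _
    rw [eval_reg, hf.nat 0 (by simp)]
    simpa [setNat_nat] using hn
  · intro j σ' hj hf hc hI
    have hn' : σ'.nat 0 0 = n := by
      rw [hf.nat 0 (by simp)]
      simpa [setNat_nat] using hn
    have hS' : HoldsSet σ' 4 S := hS.congr (by
      rw [hf.nat 4 (by simp), setNat_nat_of_ne _ _ _ (by decide)])
    have hw' : ∀ v : Fin n, σ'.real 0 v = w v := fun v => by
      rw [hf.real 0 (by simp)]; exact hw v
    have hmem : σ'.nat 4 j = 0 ↔ (⟨j, hj⟩ : Fin n) ∉ S := by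
      rw [← hS'.pos_iff]; simp
    have hwj := hw' ⟨j, hj⟩
    simp only at hwj
    have hsplit : ∀ v : Fin n, (v : ℕ) < j + 1 → (v : ℕ) < j ∨ v = ⟨j, hj⟩ := fun v hv => by
      rcases Nat.lt_succ_iff_lt_or_eq.1 hv with h | h
      · exact Or.inl h
      · exact Or.inr (Fin.ext h)
    refine Within.ite (fun h => ?_) (fun h => ?_)
    · simp only [holds_and, holds_or, holds_eq, holds_realLt, eval_get, eval_reg, eval_const,
        realEval_get, hc, hn', hmem, hwj] at h
      refine (Within.setNat ?_).mono (by omega) fun _ _ h => h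
      simp only [eval_reg, eval_const, hc, setNat_nat_same]
      refine ⟨by simp [setNat_nat, hc], Or.inr ⟨⟨j, hj⟩, rfl, h.1, fun v hv hvS => ?_⟩⟩
      rcases hsplit v hv with hv | rfl
      · rcases hI with ⟨-, hI⟩ | ⟨b, hb, -, hI⟩
        · exact absurd (hI v hv) hvS
        · rcases h.2 with h2 | h2
          · have := b.2; omega
          · rw [hb, hw' b] at h2
            exact (hI v hv hvS).trans h2.le
      · exact le_rfl
    · simp only [holds_and, holds_or, holds_eq, holds_realLt, eval_get, eval_reg, eval_const,
        realEval_get, hc, hn', hmem, hwj] at h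
      refine (Within.skip ?_).mono (by omega) fun _ _ h => h
      refine ⟨hc, ?_⟩
      rcases hI with ⟨h1, hI⟩ | ⟨b, hb, hbS, hI⟩
      · refine Or.inl ⟨h1, fun v hv => ?_⟩
        rcases hsplit v hv with hv | rfl
        · exact hI v hv
        · by_contra hv
          exact h ⟨hv, Or.inl h1⟩
      · refine Or.inr ⟨b, hb, hbS, fun v hv hvS => ?_⟩
        rcases hsplit v hv with hv | rfl
        · exact hI v hv hvS
        · by_contra hlt
          push Not at hlt
          exact h ⟨hvS, Or.inr (by rwa [hb, hw' b])⟩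
  · rintro σ' - (⟨h1, h2⟩ | ⟨b, h1, h2, h3⟩)
    · exact Or.inl ⟨h1, fun v => h2 v v.2⟩
    · exact Or.inr ⟨b, h1, h2, fun v hv => h3 v v.2 hv⟩

/-- Insert the vertex in register `13` into the set, add its weight, and block its closed
neighbourhood. -/
def insertBest : Prog :=
  .seq (.setNat 2 (reg 13) (.const 1))
    (.seq (.setReal 2 (.const 0) (.add (.get 2 (.const 0)) (.get 0 (reg 13))))
      (.mark 4 11 (reg 0) (.or (.natLt (.const 0) (.get 4 (reg 11)))
        (.or (.eq (reg 13) (reg 11)) (adjTest (reg 13) (reg 11))))))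

/-- The greedy algorithm: the solution is left in `nat 2`, its weight in `real 2`. -/
def greedy : Prog :=
  .seq (.mark 2 11 (reg 0) .false)
    (.seq (.mark 4 11 (reg 0) .false)
      (.seq (.setReal 2 (.const 0) .zero)
        (.seq (.setNat 14 (.const 0) (.const 1))
          (.while (.natLt (.const 0) (reg 14))
            (.seq scan
              (.ite (.natLt (reg 13) (reg 0)) insertBest
                (.setNat 14 (.const 0) (.const 0))))))))

open Classical in
/-- The vertices that are equal or adjacent to a vertex of `A`. -/
noncomputable def blocked (G : SimpleGraph (Fin n)) (A : Finset (Fin n)) : Finset (Fin n) :=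
  Finset.univ.filter (fun v => nbhd G {v} A ≠ ∅)

lemma mem_blocked {G : SimpleGraph (Fin n)} {A : Finset (Fin n)} {v : Fin n} :
    v ∈ blocked G A ↔ nbhd G {v} A ≠ ∅ := by
  simp [blocked]

lemma mem_blocked_insert {G : SimpleGraph (Fin n)} {A : Finset (Fin n)} {b v : Fin n} :
    v ∈ blocked G (insert b A) ↔ v ∈ blocked G A ∨ b = v ∨ G.Adj b v := by
  simp only [mem_blocked, Ne, nbhd_singleton_eq_empty]
  push Not
  simp only [Finset.mem_insert, exists_eq_or_imp]
  constructor
  · rintro ((h | h) | h)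
    · exact Or.inr (Or.inr h.symm)
    · exact Or.inr (Or.inl h.symm)
    · exact Or.inl h
  · rintro (h | h | h)
    · exact Or.inr h
    · exact Or.inl (Or.inr h.symm)
    · exact Or.inl (Or.inl h.symm)

lemma within_insertBest {G : SimpleGraph (Fin n)} {w : Fin n → ℝ} {A : Finset (Fin n)}
    {b : Fin n} (hG : GraphMem σ G) (hw : ∀ v : Fin n, σ.real 0 v = w v) (hA : HoldsSet σ 2 A)
    (hB : HoldsSet σ 4 (blocked G A)) (hW : σ.real 2 0 = wt w A) (hb : σ.nat 13 0 = b)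
    (hbA : b ∉ A) :
    Within insertBest σ (n * 4 + 4) (fun σ' => HoldsSet σ' 2 (insert b A) ∧
      HoldsSet σ' 4 (blocked G (insert b A)) ∧ σ'.real 2 0 = wt w (insert b A)) := by
  refine Within.seqNat (T := n * 4 + 3) (Within.seqReal (T := n * 4 + 2)
    ((Within.markFin (p := fun v => v ∈ blocked G (insert b A)) (by decide) ?_ ?_).post ?_))
  · intro σ' hf
    rw [eval_reg, hf.nat 0 (by simp)]
    simpa [setNat_nat] using hG.size
  · intro v σ' hf hc hx
    have hG' : GraphMem σ' G := hG.congr (by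
      rw [hf.nat 0 (by simp), setReal_nat, setNat_nat_of_ne _ _ _ (by decide)]) (by
      rw [hf.nat 1 (by simp), setReal_nat, setNat_nat_of_ne _ _ _ (by decide)]) (by
      rw [hf.nat 5 (by simp), setReal_nat, setNat_nat_of_ne _ _ _ (by decide)])
    have hb' : σ'.nat 13 0 = b := by
      rw [hf.nat 13 (by simp), setReal_nat, setNat_nat_of_ne _ _ _ (by decide), hb]
    have h4 : σ'.nat 4 v = σ.nat 4 v := by
      rw [hx v le_rfl, setReal_nat, setNat_nat_of_ne _ _ _ (by decide)]
    rw [mem_blocked_insert, holds_or, holds_or, hG'.holds_adjTest (e := reg 13) (f := reg 11) hb' hc,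
      ← hB.pos_iff, ← h4]
    simp only [holds_natLt, holds_eq, eval_const, eval_get, eval_reg, hc, hb', Fin.val_inj]
  · intro σ' hf h4
    refine ⟨fun v => ?_, fun v => by convert h4 v, ?_⟩
    · rw [hf.nat 2 (by simp), setReal_nat, setNat_nat]
      simp only [true_and, eval_reg, eval_const, hb, Fin.val_inj, Finset.mem_insert]
      by_cases hv : v = b
      · simp [hv]
      · simp only [hv, if_false, false_or]
        exact hA v
    · rw [hf.real 2 (by simp)]
      simp only [eval_const, setReal_real_same, realEval_add, realEval_get, eval_reg,
        setNat_real, setNat_nat_of_ne _ _ _ (show 13 ≠ 2 by decide), hb, hW, hw]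
      rw [wt, wt, Finset.sum_insert hbA, add_comm]

/-- Each pass either adds a vertex or clears the flag in register `14`. The budget is therefore `n -
|A| + 1` while the flag is set, and `0` afterwards. -/
lemma within_greedy {G : SimpleGraph (Fin n)} {w : Fin n → ℝ} (hG : GraphMem σ G)
    (hw : ∀ v : Fin n, σ.real 0 v = w v) :
    Within greedy σ (8 * n + 7 + (n + 1) * (8 * n + 9)) (fun σ' => ∃ A : Finset (Fin n),
      IsGreedySolution G w A ∧ HoldsSet σ' 2 A ∧ σ'.real 2 0 = wt w A) := by
  have h1 := Within.markFin (n := n) (σ := σ) (lim := reg 0) (t := .false) (b := 2) (c := 11)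
    (p := fun _ => False) (by decide)
    (fun σ' hf => by rw [eval_reg, hf.nat 0 (by simp), hG.size]) (by simp)
  refine (Within.seq h1 fun σ₁ hf₁ hA₁ => Within.seq (T := n * 4 + 2)
    (Within.markFin (p := fun _ => False) (by decide)
      (fun σ' hf => by rw [eval_reg, hf.nat 0 (by simp), hf₁.nat 0 (by simp), hG.size]) (by simp))
    fun σ₂ hf₂ hB₂ => Within.seqReal (Within.seqNat (Within.post (Within.while_budget
      (T := 8 * n + 8) (I := fun k σ' => ∃ A : Finset (Fin n), GreedyReaches G w A ∧
        HoldsSet σ' 2 A ∧ HoldsSet σ' 4 (blocked G A) ∧ σ'.real 2 0 = wt w A ∧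
        ((σ'.nat 14 0 = 1 ∧ k = n - A.card + 1) ∨
          (σ'.nat 14 0 = 0 ∧ k = 0 ∧ ∀ v, v ∈ blocked G A)))
      (n + 1) ?_ ?_) ?_))).mono (T' := 8 * n + 7 + (n + 1) * (8 * n + 9)) ?_ fun _ _ h => h
  · refine ⟨∅, .start, ?_, ?_, by simp [wt], by simp⟩
    · intro v
      simp only [setReal_nat, setNat_nat_of_ne _ _ _ (show 2 ≠ 14 by decide)]
      rw [hf₂.nat 2 (by simp), hA₁ v]
      simp
    · intro v
      simp only [setReal_nat, setNat_nat_of_ne _ _ _ (show 4 ≠ 14 by decide)]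
      rw [hB₂ v]
      simp [mem_blocked, nbhd_singleton_eq_empty]
  · rintro k σ₃ hf₃ ⟨A, hgr, hA, hB, hW, hk⟩ hflag
    have hnat : ∀ a, a ≠ 2 → a ≠ 4 → a ≠ 11 → a ≠ 13 → a ≠ 14 → σ₃.nat a = σ.nat a := by
      intro a h2 h4 h11 h13 h14
      rw [hf₃.nat a (by simp [scan, insertBest, h2, h4, h11, h13, h14]),
        setNat_nat_of_ne _ _ _ h14, setReal_nat, hf₂.nat a (by simp [h4, h11]),
        hf₁.nat a (by simp [h2, h11])]
    have hG₃ : GraphMem σ₃ G := hG.congr (hnat 0 (by decide) (by decide) (by decide) (by decide)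
      (by decide)) (hnat 1 (by decide) (by decide) (by decide) (by decide) (by decide))
      (hnat 5 (by decide) (by decide) (by decide) (by decide) (by decide))
    have hw₃ : ∀ v : Fin n, σ₃.real 0 v = w v := fun v => by
      rw [hf₃.real 0 (by simp [scan, insertBest]), setNat_real,
        setReal_real_of_ne _ _ _ (by decide), hf₂.real 0 (by simp), hf₁.real 0 (by simp), hw]
    have hk' : σ₃.nat 14 0 = 1 ∧ k = n - A.card + 1 := by
      rcases hk with h | h
      · exact h
      · simp [h.1] at hflag
    refine (Within.seq (within_scan hG₃.size hw₃ hB) (T' := n * 4 + 5) fun σ₄ hf₄ h₄ =>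
      Within.ite (fun hlt => ?_) (fun hge => ?_)).mono (by omega) fun _ _ h => h
    · have hn₄ : σ₄.nat 0 0 = n := by rw [hf₄.nat 0 (by simp [scan]), hG₃.size]
      simp only [holds_natLt, eval_reg, hn₄] at hlt
      rcases h₄ with ⟨h, -⟩ | ⟨b, hb, hbB, hbmax⟩
      · omega
      have hG₄ : GraphMem σ₄ G := hG₃.congr (hf₄.nat 0 (by simp [scan]))
        (hf₄.nat 1 (by simp [scan])) (hf₄.nat 5 (by simp [scan]))
      have hb0 : nbhd G {b} A = ∅ := by
        simpa [mem_blocked] using hbB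
      have hbA : b ∉ A := fun h => (nbhd_singleton_eq_empty.1 hb0) b h (Or.inr rfl)
      refine (within_insertBest (w := w) (A := A) hG₄ (fun v => by
        rw [hf₄.real 0 (by simp [scan]), hw₃]) (hA.congr (hf₄.nat 2 (by simp [scan])))
        (hB.congr (hf₄.nat 4 (by simp [scan]))) (by rw [hf₄.real 2 (by simp [scan]), hW])
        hb hbA).post fun σ₅ hf₅ h₅ => ?_
      have hcard : (insert b A).card = A.card + 1 := Finset.card_insert_of_notMem hbA
      have hle : (insert b A).card ≤ n := by
        simpa using Finset.card_le_univ (insert b A)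
      refine ⟨n - (insert b A).card + 1, by omega, insert b A, ?_, h₅.1, h₅.2.1, h₅.2.2,
        Or.inl ⟨?_, rfl⟩⟩
      · have := GreedyReaches.step hgr hb0 fun u hu => hbmax u (by simpa [mem_blocked] using hu)
        convert this
      · rw [hf₅.nat 14 (by simp [insertBest]), hf₄.nat 14 (by simp [scan]), hk'.1]
    · have hn₄ : σ₄.nat 0 0 = n := by rw [hf₄.nat 0 (by simp [scan]), hG₃.size]
      simp only [holds_natLt, eval_reg, hn₄] at hge
      rcases h₄ with ⟨h, hall⟩ | ⟨b, hb, -, -⟩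
      · refine (Within.setNat ?_).mono (by omega) fun _ _ h => h
        refine ⟨0, by omega, A, hgr, ?_, ?_, ?_, Or.inr ⟨by simp, rfl, hall⟩⟩
        · exact hA.congr (by
            rw [setNat_nat_of_ne _ _ _ (by decide), hf₄.nat 2 (by simp [scan])])
        · exact hB.congr (by
            rw [setNat_nat_of_ne _ _ _ (by decide), hf₄.nat 4 (by simp [scan])])
        · rw [setNat_real, hf₄.real 2 (by simp [scan]), hW]
      · have := b.2; omega
  · rintro σ' - ⟨⟨k, A, hgr, hA, -, hW, hk⟩, hflag⟩
    rcases hk with h | h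
    · simp [h.1] at hflag
    · exact ⟨A, ⟨hgr, fun v => mem_blocked.1 (h.2.2 v)⟩, hA, hW⟩
  · ring_nf
    omega

end RAM

namespace RAM

open ClawFreeMWIS

variable {n : ℕ} {σ σ' : Store}

/-! ### The truncation parameter and the truncated weights -/

/-- Leave in register `19` a number `m + 1` with `m ε ≥ d`, where `ε` is `real 1 0`. -/
def truncParam (d : ℕ) : Prog :=
  .seq (.setNat 19 (.const 0) (.const 0))
    (.seq (.setReal 3 (.const 0) .zero)
      (.seq
        (.while (.realLt (.get 3 (.const 0)) (.ofNat d))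
          (.seq (.setReal 3 (.const 0) (.add (.get 3 (.const 0)) (.get 1 (.const 0))))
            (.setNat 19 (.const 0) (.add (reg 19) (.const 1)))))
        (.setNat 19 (.const 0) (.add (reg 19) (.const 1)))))

/-- Adding up `ε` until `d` is reached replaces a division; the body runs only while `m ε < d ≤ D
ε`, so `m` never exceeds `D`. -/
lemma within_truncParam (d : ℕ) {ε : ℝ} (hε : 0 < ε) (h : σ.real 1 0 = ε) :
    Within (truncParam d) σ (d * ⌈1 / ε⌉₊ * 3 + 4) (fun σ' => ∃ m : ℕ, σ'.nat 19 0 = m + 1 ∧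
      (d : ℝ) ≤ m * ε ∧ m ≤ d * ⌈1 / ε⌉₊) := by
  set D := d * ⌈1 / ε⌉₊ with hD
  have hDε : (d : ℝ) ≤ D * ε := by
    have h1 : 1 / ε ≤ ⌈1 / ε⌉₊ := Nat.le_ceil _
    rw [div_le_iff₀ hε] at h1
    rw [hD]
    push_cast
    nlinarith [Nat.cast_nonneg (α := ℝ) d]
  refine (Within.seqNat (Within.seqReal (Within.seq (Within.while_budget (T := 2)
    (I := fun k σ' => ∃ m : ℕ, σ'.nat 19 0 = m ∧ σ'.real 3 0 = m * ε ∧ m ≤ D ∧ k = D - m)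
    D ⟨0, by simp, by simp, by omega, by omega⟩ ?_) (T' := 1) ?_))).mono
    (by omega) fun _ _ h => h
  · rintro k σ₁ hf ⟨m, hm, hr, hmD, rfl⟩ hlt
    have hε₁ : σ₁.real 1 0 = ε := by
      rw [hf.real 1 (by simp), setReal_real_of_ne _ _ _ (by decide), setNat_real, h]
    simp only [holds_realLt, realEval_get, eval_const, realEval_ofNat, hr] at hlt
    have hmD' : m < D := by
      by_contra hge
      push Not at hge
      have : (D : ℝ) ≤ m := by exact_mod_cast hge
      nlinarith
    refine (Within.seqReal (T := 1) (Within.setNat ?_)).mono (by omega) fun _ _ h => h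
    refine ⟨D - (m + 1), by omega, m + 1, ?_, ?_, by omega, rfl⟩
    · simp [hm]
    · simp only [setNat_real, eval_const, realEval_add, realEval_get, setReal_real_same, hr, hε₁]
      push_cast; ring
  · rintro σ₁ - ⟨⟨k, m, hm, hr, hmD, -⟩, hge⟩
    simp only [holds_realLt, realEval_get, eval_const, realEval_ofNat, hr, not_lt] at hge
    refine Within.setNat ⟨m, by simp [hm], hge, hmD⟩

/-- Compute in register `21` the square of the truncated weight of the vertex in register `11`. -/
def truncSqAt : Prog :=
  .seq (.setReal 3 (.const 0) .zero)
    (.seq (.forUp 12 0 (reg 20)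
      (.setReal 3 (.const 0) (.add (.get 3 (.const 0)) (.get 0 (reg 11)))))
      (.seq (.setReal 4 (.const 0) .zero)
        (.seq (.setNat 18 (.const 0) (.const 0))
          (.seq (.forUp 12 0 (reg 20)
            (.seq (.setReal 4 (.const 0) (.add (.get 4 (.const 0)) (.get 2 (.const 0))))
              (.ite (.not (.realLt (.get 3 (.const 0)) (.get 4 (.const 0))))
                (.setNat 18 (.const 0) (.add (reg 18) (.const 1))) .skip)))
            (.sumIf 21 12 (reg 18) .true (reg 18))))))

/-- `⌊M x / W⌋` is the number of `j < M` with `(j + 1) W ≤ M x`, which needs only additions and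
comparisons; `x ≤ W` ensures that `M` trials suffice. The square is again a repeated sum. -/
lemma within_truncSqAt {v M : ℕ} {W x : ℝ} (hx : 0 < x) (hxW : x ≤ W) (hv : σ.nat 11 0 = v)
    (hM : σ.nat 20 0 = M) (hW : σ.real 2 0 = W) (hwv : σ.real 0 v = x) :
    Within truncSqAt σ (12 * M + 10) (fun σ' => σ'.nat 21 0 = ⌊M / W * x⌋₊ ^ 2) := by
  have hWpos : 0 < W := hx.trans_le hxW
  set F := ⌊M / W * x⌋₊ with hF
  have hFle : F ≤ M := by
    refine Nat.floor_le_of_le ?_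
    rw [div_mul_eq_mul_div, div_le_iff₀ hWpos]
    gcongr
  have hFiff : ∀ j : ℕ, (((j : ℝ) + 1) * W ≤ M * x ↔ j + 1 ≤ F) := fun j => by
    rw [hF, Nat.le_floor_iff (by positivity), div_mul_eq_mul_div, le_div_iff₀ hWpos]
    push_cast
    rfl
  refine (Within.seqReal (Within.seq (Within.forUp (T := 1) (L := M)
    (I := fun j σ' => σ'.real 3 0 = j * x) (fun _ _ _ h => h) (by simp) ?_ ?_)
    fun σ₁ hf₁ hr₁ => Within.seqReal (Within.seqNat (Within.seq
      (Within.forUp (T := 3) (L := M)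
        (I := fun j σ' => σ'.real 4 0 = j * W ∧ σ'.nat 18 0 = min j F) ?_ ?_ ?_ ?_)
      (T' := M * 4 + 3) fun σ₂ hf₂ h₂ => ?_)))).mono (by omega) fun _ _ h => h
  · intro j σ' hf _
    rw [eval_reg, hf.nat 20 (by simp), setReal_nat, hM]
  · intro j σ' hj hf hc hI
    refine Within.setReal ⟨hc, ?_⟩
    have h0 : σ'.real 0 = σ.real 0 := by
      rw [hf.real 0 (by simp), setReal_real_of_ne _ _ _ (by decide)]
    have h11 : σ'.nat 11 0 = v := by rw [hf.nat 11 (by simp), setReal_nat, hv]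
    simp only [eval_const, setReal_real_same, realEval_add, realEval_get, eval_reg, hI, h0, h11,
      hwv]
    push_cast; ring
  · intro j σ' y h
    rwa [setNat_real, setNat_nat_of_ne _ _ _ (by decide)]
  · simp
  · intro j σ' hf _
    rw [eval_reg, hf.nat 20 (by simp), setNat_nat_of_ne _ _ _ (by decide), setReal_nat,
      hf₁.nat 20 (by simp), setReal_nat, hM]
  · rintro j σ' hj hf hc ⟨hI1, hI2⟩
    have h2 : σ'.real 2 0 = W := by
      rw [hf.real 2 (by simp), setNat_real, setReal_real_of_ne _ _ _ (by decide),
        hf₁.real 2 (by simp), setReal_real_of_ne _ _ _ (by decide), hW]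
    have h3 : σ'.real 3 0 = M * x := by
      rw [hf.real 3 (by simp), setNat_real, setReal_real_of_ne _ _ _ (by decide), hr₁]
    refine (Within.seqReal (T := 2) ?_).mono (by omega) fun _ _ h => h
    simp only [realEval_add, realEval_get, eval_const, hI1, h2]
    refine Within.ite (fun hb => ?_) (fun hb => ?_)
    · simp only [holds_not, holds_realLt, realEval_get, eval_const, setReal_real_same,
        setReal_real_of_ne _ _ _ (show 3 ≠ 4 by decide), h3, not_lt] at hb
      have hb' := (hFiff j).1 (by linarith)
      refine Within.setNat ⟨?_, ?_, ?_⟩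
      · simp [setNat_nat, hc]
      · simp only [setNat_real, setReal_real_same]; push_cast; ring
      · simp only [eval_const, eval_add, eval_reg, setReal_nat, setNat_nat_same, hI2]
        omega
    · simp only [holds_not, holds_realLt, realEval_get, eval_const, setReal_real_same,
        setReal_real_of_ne _ _ _ (show 3 ≠ 4 by decide), h3, not_lt] at hb
      have hb' : ¬ j + 1 ≤ F := fun h => hb (by linarith [(hFiff j).2 h])
      refine Within.skip ⟨?_, ?_, ?_⟩
      · simp [hc]
      · simp only [setReal_real_same]; push_cast; ring
      · simp only [setReal_nat, hI2]
        omega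
  · have h18 : σ₂.nat 18 0 = F := by rw [h₂.2, min_eq_right hFle]
    refine (Within.sumIf (L := F) (p := fun _ => True) (g := fun _ => F) (by decide) ?_ ?_).mono
      (by omega) fun σ₃ _ h => ?_
    · intro σ' hf
      rw [eval_reg, hf.nat 18 (by simp), h18]
    · intro j σ' _ hf _
      rw [eval_reg, hf.nat 18 (by simp), h18]
      simp
    · rw [h]
      simp [sq]

/-- Compute in `nat 8` the squares of the truncated weights. -/
def truncSq : Prog :=
  .seq (.sumIf 20 11 (reg 0) .true (reg 19))
    (.forUp 11 0 (reg 0) (.seq truncSqAt (.setNat 8 (reg 11) (reg 21))))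

/-- The bound `hle`, true for the weight of a greedy solution, keeps all truncated weights at most
`N * n`, so repeated addition takes polynomially many steps. -/
lemma within_truncSq {N : ℕ} {W : ℝ} {w : Fin n → ℝ} (hn : σ.nat 0 0 = n) (hN : σ.nat 19 0 = N)
    (hw : ∀ v : Fin n, σ.real 0 v = w v) (hpos : ∀ v, 0 < w v) (hle : ∀ v, w v ≤ W)
    (hW : σ.real 2 0 = W) :
    Within truncSq σ (n * 4 + 5 + n * (12 * (N * n) + 13))
      (fun σ' => ∀ v : Fin n, σ'.nat 8 v = ⌊(N : ℝ) * n / W * w v⌋₊ ^ 2) := by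
  refine (Within.seq (Within.sumIfFin (n := n) (p := fun _ => True) (g := fun _ => N) (by decide)
    ?_ ?_) fun σ₁ hf₁ h₁ => (Within.forUp (T := 12 * (N * n) + 11) (L := n)
      (I := fun j σ' => ∀ v : Fin n, (v : ℕ) < j → σ'.nat 8 v = ⌊(N : ℝ) * n / W * w v⌋₊ ^ 2)
      ?_ ?_ ?_ ?_).post (Q' := fun σ' => ∀ v : Fin n, σ'.nat 8 v = ⌊(N : ℝ) * n / W * w v⌋₊ ^ 2)
      ?_).mono ?_ fun _ _ h => h
  · intro σ' hf
    rw [eval_reg, hf.nat 0 (by simp), hn]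
  · intro v σ' hf _
    rw [eval_reg, hf.nat 19 (by simp), hN]
    simp
  · intro j σ' x h
    rwa [setNat_nat_of_ne _ _ _ (by decide)]
  · simp
  · intro j σ' hf _
    rw [eval_reg, hf.nat 0 (by simp [truncSqAt]), hf₁.nat 0 (by simp), hn]
  · intro j σ' hj hf hc hI
    have h20 : σ'.nat 20 0 = N * n := by
      rw [hf.nat 20 (by simp [truncSqAt]), h₁]
      simp [mul_comm]
    have h2 : σ'.real 2 0 = W := by
      rw [hf.real 2 (by simp [truncSqAt]), hf₁.real 2 (by simp), hW]
    have h0 : σ'.real 0 j = w ⟨j, hj⟩ := by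
      rw [hf.real 0 (by simp [truncSqAt]), hf₁.real 0 (by simp)]
      exact hw ⟨j, hj⟩
    refine (Within.seq (within_truncSqAt (hpos _) (hle _) hc h20 h2 h0) (T' := 1)
      fun σ₂ hf₂ h₂ => Within.setNat ?_)
    have hc₂ : σ₂.nat 11 0 = j := by rw [hf₂.nat 11 (by simp [truncSqAt]), hc]
    refine ⟨by simp [setNat_nat, hc₂], fun v hv => ?_⟩
    simp only [eval_reg, hc₂, setNat_nat, true_and]
    split_ifs with hvj
    · rw [h₂]
      have : v = ⟨j, hj⟩ := Fin.ext hvj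
      rw [this]
      push_cast
      rfl
    · rw [hf₂.nat 8 (by simp [truncSqAt])]
      exact hI v (by omega)
  · intro σ' _ h v
    exact h v v.2
  · apply le_of_eq
    ring

end RAM

namespace RAM

open ClawFreeMWIS

variable {n : ℕ} {σ σ' : Store}

/-! ### Enumeration of tuples -/

/-- Run `P` for all values below `nat 0 0` of the first entries of the array `nat 7`. -/
def search (P : Prog) : ℕ → Prog
  | 0 => P
  | k + 1 => .forUp 7 k (reg 0) (search P k)

lemma search_writesNat {P : Prog} {b : ℕ} (k : ℕ) (hb : b ≠ 7) (hP : ¬ P.writesNat b) :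
    ¬ (search P k).writesNat b := by
  induction k with
  | zero => exact hP
  | succ k ih => simp [search, hb, ih]

/-- If `P` establishes `D c` for the tuple `c` in `nat 7`, and preserves all such facts, then the
enumeration establishes `D c` for all tuples `c`. -/
lemma within_search {P : Prog} {K T : ℕ} {I : Store → Prop} {D : (ℕ → ℕ) → Store → Prop}
    (hI7 : ∀ σ i x, I σ → I (σ.setNat 7 i x))
    (hD7 : ∀ c σ i x, D c σ → D c (σ.setNat 7 i x)) (hIn : ∀ σ, I σ → σ.nat 0 0 = n)
    (hP7 : ¬ P.writesNat 7)
    (hP : ∀ σ, I σ → (∀ j < K, σ.nat 7 j < n) →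
      Within P σ T (fun σ' => I σ' ∧ D (σ.nat 7) σ' ∧ ∀ c, D c σ → D c σ'))
    (k : ℕ) (hk : k ≤ K) (σ : Store) (hI : I σ) (hc : ∀ j, k ≤ j → j < K → σ.nat 7 j < n) :
    Within (search P k) σ ((3 * n + 3) ^ k * (T + 1)) (fun σ' => I σ' ∧ (∀ c, D c σ → D c σ') ∧
      (∀ j, k ≤ j → σ'.nat 7 j = σ.nat 7 j) ∧
      ∀ c, (∀ j < k, c j < n) → (∀ j, k ≤ j → c j = σ.nat 7 j) → D c σ') := by
  induction k generalizing σ with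
  | zero =>
    refine (hP σ hI fun j hj => hc j (Nat.zero_le _) hj).mono (by simp) fun σ' hf h =>
      ⟨h.1, h.2.2, fun j _ => by rw [hf.nat 7 hP7], fun c _ hcc => ?_⟩
    have : c = σ.nat 7 := funext fun j => hcc j (Nat.zero_le _)
    rw [this]
    exact h.2.1
  | succ k ih =>
    refine (Within.forUp (T := (3 * n + 3) ^ k * (T + 1)) (L := n)
      -- Entries beyond `k` belong to the surrounding loops and stay fixed; all tuples with this
      -- tail and with entry `k` below `j` are done.
      (I := fun j σ' => I σ' ∧ (∀ c, D c σ → D c σ') ∧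
        (∀ i, k + 1 ≤ i → σ'.nat 7 i = σ.nat 7 i) ∧
        ∀ c, (∀ i < k + 1, c i < n) → (∀ i, k + 1 ≤ i → c i = σ.nat 7 i) → c k < j → D c σ')
      ?_ ?_ ?_ ?_).mono ?_ ?_
    · rintro j σ' x ⟨h1, h2, h3, h4⟩
      refine ⟨hI7 _ _ _ h1, fun c h => hD7 _ _ _ _ (h2 c h), fun i hi => ?_,
        fun c a b e => hD7 _ _ _ _ (h4 c a b e)⟩
      rw [setNat_nat, if_neg (by omega), h3 i hi]
    · exact ⟨hI, fun c h => h, fun _ _ => rfl, fun c _ _ h => absurd h (by omega)⟩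
    · intro j σ' _ h
      exact hIn σ' h.1
    · rintro j σ' hj - hcj ⟨h1, h2, h3, h4⟩
      refine (ih (by omega) σ' h1 fun i hi hiK => ?_).post ?_
      · rcases hi.eq_or_lt with rfl | hi
        · omega
        · rw [h3 i hi]
          exact hc i hi hiK
      · rintro σ'' - ⟨g1, g2, g3, g4⟩
        refine ⟨by rw [g3 k le_rfl, hcj], g1, fun c h => g2 c (h2 c h), fun i hi => ?_,
          fun c a b e => ?_⟩
        · rw [g3 i (by omega), h3 i hi]
        · rcases Nat.lt_succ_iff_lt_or_eq.1 e with e | e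
          · exact g2 c (h4 c a b e)
          · refine g4 c (fun i hi => a i (by omega)) fun i hi => ?_
            rcases hi.eq_or_lt with rfl | hi
            · rw [e, hcj]
            · rw [b i hi, h3 i hi]
    · have h1 : 1 ≤ (3 * n + 3) ^ k := Nat.one_le_pow _ _ (by omega)
      have h2 : 1 * 1 ≤ (3 * n + 3) ^ k * (T + 1) := Nat.mul_le_mul h1 (by omega)
      rw [pow_succ]
      nlinarith
    · rintro σ' - ⟨h1, h2, h3, h4⟩
      exact ⟨h1, h2, h3, fun c a b => h4 c a b (a k (by omega))⟩

/-! ### The search for a local improvement -/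

/-- The expression for the entry `j` of the tuple. -/
def tup (j : ℕ) : NatExpr := .get 7 (.const j)

/-- The test whether a vertex belongs to the set after the exchange. -/
def newTest (K : ℕ) (e : NatExpr) : Test :=
  .or (.orBelow K fun j => .eq (tup j) e)
    (.and (.natLt (.const 0) (.get 2 e)) (.not (.orBelow K fun j => adjTest (tup j) e)))

/-- The test whether the tuple contains an edge or a deleted vertex. -/
def badTest (K : ℕ) : Test :=
  .orBelow K fun i => .or (.eq (.get 8 (tup i)) (.const 0))
    (.orBelow K fun j => adjTest (tup i) (tup j))

/-- Check the set of entries of the tuple; if it is a local improvement, set register `15` and store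
the set after the exchange in `nat 10`. -/
def checkTuple (K : ℕ) : Prog :=
  .seq (.sumIf 17 11 (reg 0) (newTest K (reg 11)) (.get 8 (reg 11)))
    (.ite (.and (.not (badTest K)) (.natLt (reg 16) (reg 17)))
      (.seq (.setNat 15 (.const 0) (.const 1)) (.mark 10 11 (reg 0) (newTest K (reg 11)))) .skip)

/-- The set of the first `K` entries of a tuple. -/
def tupleSet (n K : ℕ) (c : ℕ → ℕ) : Finset (Fin n) :=
  Finset.univ.filter fun v => ∃ j < K, c j = v

lemma mem_tupleSet {K : ℕ} {c : ℕ → ℕ} {v : Fin n} : v ∈ tupleSet n K c ↔ ∃ j < K, c j = v := by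
  simp [tupleSet]

lemma card_tupleSet_le (K : ℕ) (c : ℕ → ℕ) : (tupleSet n K c).card ≤ K := by
  calc (tupleSet n K c).card ≤ ((Finset.range K).image c).card := by
        refine Finset.card_le_card_of_injOn (fun v => (v : ℕ)) (fun v hv => ?_)
          (Fin.val_injective.injOn)
        obtain ⟨j, hj, h⟩ := mem_tupleSet.1 hv
        exact Finset.mem_coe.2 (Finset.mem_image.2 ⟨j, Finset.mem_range.2 hj, h⟩)
    _ ≤ (Finset.range K).card := Finset.card_image_le
    _ = K := Finset.card_range K

/-- Repetitions in the tuple list sets with fewer than `K` elements. The tail `c₀` is prescribed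
because `within_search` speaks of tuples agreeing with the memory from position `K` on. -/
lemma exists_tuple {K : ℕ} {X : Finset (Fin n)} (hX : X.Nonempty) (hK : X.card ≤ K)
    (c₀ : ℕ → ℕ) : ∃ c : ℕ → ℕ, (∀ j < K, c j < n) ∧ (∀ j, K ≤ j → c j = c₀ j) ∧
      tupleSet n K c = X := by
  have : Nonempty X := hX.coe_sort
  let f : X → Fin K := fun x => Fin.castLE hK (X.equivFin x)
  have hf : Function.Injective f := (Fin.castLE_injective hK).comp X.equivFin.injective
  let g : Fin K → X := Function.invFun f
  have hg : Function.Surjective g := Function.invFun_surjective hf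
  refine ⟨fun j => if h : j < K then ((g ⟨j, h⟩ : Fin n) : ℕ) else c₀ j, fun j hj => ?_,
    fun j hj => ?_, ?_⟩
  · simp [hj]
  · simp [hj]
  · ext v
    rw [mem_tupleSet]
    constructor
    · rintro ⟨j, hj, h⟩
      simp only [hj, dif_pos, Fin.val_inj] at h
      exact h ▸ (g ⟨j, hj⟩).2
    · intro hv
      obtain ⟨j, hj⟩ := hg ⟨v, hv⟩
      exact ⟨j, j.2, by simp [hj]⟩

/-- `X` is an improvement of `A` with respect to the squared weights `q`. -/
def Improves (G : SimpleGraph (Fin n)) (q : Fin n → ℕ) (A X : Finset (Fin n)) : Prop :=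
  (∀ u ∈ X, q u ≠ 0 ∧ ∀ v ∈ X, ¬ G.Adj u v) ∧ ∑ v ∈ A, q v < ∑ v ∈ exchange G A X, q v

/-- The memory holds a graph, squared weights and a current set. -/
structure SearchMem (σ : Store) (G : SimpleGraph (Fin n)) (q : Fin n → ℕ) (A : Finset (Fin n)) :
    Prop where
  graph : GraphMem σ G
  sq : ∀ v : Fin n, σ.nat 8 v = q v
  cur : HoldsSet σ 2 A

lemma SearchMem.congr {G : SimpleGraph (Fin n)} {q : Fin n → ℕ} {A : Finset (Fin n)}
    (h : SearchMem σ G q A)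
    (ha : ∀ a, a = 0 ∨ a = 1 ∨ a = 2 ∨ a = 5 ∨ a = 8 → σ'.nat a = σ.nat a) :
    SearchMem σ' G q A :=
  ⟨h.graph.congr (ha 0 (by simp)) (ha 1 (by simp)) (ha 5 (by simp)),
    fun v => by rw [ha 8 (by simp), h.sq], h.cur.congr (ha 2 (by simp))⟩

section Check

variable {G : SimpleGraph (Fin n)} {q : Fin n → ℕ} {A : Finset (Fin n)} {K : ℕ}

lemma SearchMem.holds_newTest (h : SearchMem σ G q A) (hc : ∀ j < K, σ.nat 7 j < n) {e : NatExpr}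
    {v : Fin n} (he : e.eval σ = v) :
    (newTest K e).holds σ ↔ v ∈ exchange G A (tupleSet n K (σ.nat 7)) := by
  have h1 : (∃ j < K, (adjTest (tup j) e).holds σ) ↔
      ∃ u ∈ tupleSet n K (σ.nat 7), G.Adj u v := by
    constructor
    · rintro ⟨j, hj, hadj⟩
      refine ⟨⟨σ.nat 7 j, hc j hj⟩, mem_tupleSet.2 ⟨j, hj, rfl⟩, ?_⟩
      exact (h.graph.holds_adjTest (e := tup j) (u := ⟨σ.nat 7 j, hc j hj⟩) rfl he).1 hadj
    · rintro ⟨u, hu, hadj⟩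
      obtain ⟨j, hj, hju⟩ := mem_tupleSet.1 hu
      exact ⟨j, hj, (h.graph.holds_adjTest (e := tup j) hju he).2 hadj⟩
  rw [mem_exchange, newTest, holds_or, holds_and, holds_not, holds_orBelow, holds_orBelow, h1,
    mem_tupleSet, holds_natLt, eval_const, eval_get, he, h.cur.pos_iff]
  simp only [holds_eq, tup, eval_get, eval_const, he]
  push Not
  rfl

lemma SearchMem.holds_badTest (h : SearchMem σ G q A) (hc : ∀ j < K, σ.nat 7 j < n) :
    (badTest K).holds σ ↔ ¬ ∀ u ∈ tupleSet n K (σ.nat 7), q u ≠ 0 ∧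
      ∀ v ∈ tupleSet n K (σ.nat 7), ¬ G.Adj u v := by
  push Not
  simp only [badTest, holds_orBelow, holds_or, holds_eq, eval_get, eval_const]
  constructor
  · rintro ⟨i, hi, h0⟩
    refine ⟨⟨σ.nat 7 i, hc i hi⟩, mem_tupleSet.2 ⟨i, hi, rfl⟩, fun hne => ?_⟩
    rcases h0 with h0 | ⟨j, hj, hadj⟩
    · rw [← h.sq] at hne
      exact absurd h0 hne
    · exact ⟨⟨σ.nat 7 j, hc j hj⟩, mem_tupleSet.2 ⟨j, hj, rfl⟩,
        (h.graph.holds_adjTest (e := tup i) (f := tup j) (u := ⟨σ.nat 7 i, hc i hi⟩)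
          (v := ⟨σ.nat 7 j, hc j hj⟩) rfl rfl).1 hadj⟩
  · rintro ⟨u, hu, h0⟩
    obtain ⟨i, hi, hiu⟩ := mem_tupleSet.1 hu
    refine ⟨i, hi, ?_⟩
    by_cases hq : q u = 0
    · left
      rw [← h.sq, ← hiu] at hq
      exact hq
    · obtain ⟨v, hv, hadj⟩ := h0 hq
      obtain ⟨j, hj, hjv⟩ := mem_tupleSet.1 hv
      exact Or.inr ⟨j, hj, (h.graph.holds_adjTest (e := tup i) (f := tup j) hiu hjv).2 hadj⟩

/-- The invariant of the search. -/
def SearchInv (K : ℕ) (G : SimpleGraph (Fin n)) (q : Fin n → ℕ) (A : Finset (Fin n))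
    (σ : Store) : Prop :=
  SearchMem σ G q A ∧ σ.nat 16 0 = ∑ v ∈ A, q v ∧ (σ.nat 15 0 = 0 ∨ (σ.nat 15 0 = 1 ∧
    ∃ X : Finset (Fin n), X.card ≤ K ∧ Improves G q A X ∧ HoldsSet σ 10 (exchange G A X)))

/-- The flag in register `15` is never cleared here, so "an improvement is stored, or this tuple
gives none" survives the remaining search; a later improvement may overwrite the stored one. -/
lemma within_checkTuple (h : SearchInv K G q A σ) (hc : ∀ j < K, σ.nat 7 j < n) :
    Within (checkTuple K) σ (8 * n + 7) (fun σ' => SearchInv K G q A σ' ∧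
      (σ'.nat 15 0 = 1 ∨ ¬ Improves G q A (tupleSet n K (σ.nat 7))) ∧
      (σ.nat 15 0 = 1 → σ'.nat 15 0 = 1)) := by
  obtain ⟨hm, hA, hfound⟩ := h
  refine (Within.seq (Within.sumIfFin (n := n)
    (p := fun v => v ∈ exchange G A (tupleSet n K (σ.nat 7))) (g := q) (by decide) ?_ ?_)
    (T' := n * 4 + 4) fun σ₁ hf₁ h₁ => ?_).mono (by omega) fun _ _ h => h
  · intro σ' hf
    rw [eval_reg, hf.nat 0 (by simp), hm.graph.size]
  · intro v σ' hf hv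
    have hm' : SearchMem σ' G q A := hm.congr fun a ha => hf.nat a (by
      rw [writesNat_sumIf]; omega)
    have h7 := hf.nat 7 (by simp)
    refine ⟨?_, ?_⟩
    · rw [hm'.holds_newTest (e := reg 11) (by rwa [h7]) hv, h7]
    · rw [eval_get, eval_reg, hv, hm'.sq]
  · have hm₁ : SearchMem σ₁ G q A := hm.congr fun a ha => hf₁.nat a (by
      rw [writesNat_sumIf]; omega)
    have h7 := hf₁.nat 7 (by simp)
    have h15 := hf₁.nat 15 (by simp)
    have h16 : σ₁.nat 16 0 = ∑ v ∈ A, q v := by rw [hf₁.nat 16 (by simp), hA]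
    have h17 : σ₁.nat 17 0 = ∑ v ∈ exchange G A (tupleSet n K (σ.nat 7)), q v := by
      rw [h₁]
      congr 1
      ext v
      simp
    have htest : (Test.and (.not (badTest K)) (.natLt (reg 16) (reg 17))).holds σ₁ ↔
        Improves G q A (tupleSet n K (σ.nat 7)) := by
      rw [holds_and, holds_not, hm₁.holds_badTest (by rwa [h7]), holds_natLt, eval_reg, eval_reg,
        h16, h17, h7, not_not, Improves]
    refine Within.ite (fun hb => ?_) (fun hb => ?_)
    · rw [htest] at hb
      refine (Within.seqNat (T := n * 4 + 2) ((Within.markFin (n := n)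
        (p := fun v => v ∈ exchange G A (tupleSet n K (σ.nat 7))) (by decide) ?_ ?_).post
        ?_)).mono (by omega) fun _ _ h => h
      · intro σ' hf
        rw [eval_reg, hf.nat 0 (by simp), setNat_nat_of_ne _ _ _ (by decide), hm₁.graph.size]
      · intro v σ' hf hv _
        have hm' : SearchMem σ' G q A := hm₁.congr fun a ha => by
          rw [hf.nat a (by rw [writesNat_mark]; omega), setNat_nat_of_ne _ _ _ (by omega)]
        have h7' : σ'.nat 7 = σ.nat 7 := by
          rw [hf.nat 7 (by simp), setNat_nat_of_ne _ _ _ (by decide), h7]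
        rw [hm'.holds_newTest (e := reg 11) (by rwa [h7']) hv, h7']
      · intro σ' hf h10
        have hm' : SearchMem σ' G q A := hm₁.congr fun a ha => by
          rw [hf.nat a (by rw [writesNat_mark]; omega), setNat_nat_of_ne _ _ _ (by omega)]
        have h15' : σ'.nat 15 0 = 1 := by
          rw [hf.nat 15 (by simp)]
          simp
        refine ⟨⟨hm', ?_, Or.inr ⟨h15', _, card_tupleSet_le K _, hb, fun v => ?_⟩⟩,
          Or.inl h15', fun _ => h15'⟩
        · rw [hf.nat 16 (by simp), setNat_nat_of_ne _ _ _ (by decide), h16]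
        · convert h10 v
    · rw [htest] at hb
      refine (Within.skip ?_).mono (by omega) fun _ _ h => h
      refine ⟨⟨hm₁, h16, ?_⟩, Or.inr hb, fun h => by rw [h15, h]⟩
      rw [h15]
      refine hfound.imp id fun ⟨a, X, hX, hi, h10⟩ => ⟨a, X, hX, hi, h10.congr ?_⟩
      exact hf₁.nat 10 (by simp)

end Check

/-- One iteration: search for a local improvement and apply it; if there is none, clear
register `14`. -/
def improveStep (K : ℕ) : Prog :=
  .seq (.setNat 15 (.const 0) (.const 0))
    (.seq (.sumIf 16 11 (reg 0) (.natLt (.const 0) (.get 2 (reg 11))) (.get 8 (reg 11)))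
      (.seq (search (checkTuple K) K)
        (.ite (.natLt (.const 0) (reg 15))
          (.mark 2 11 (reg 0) (.natLt (.const 0) (.get 10 (reg 11))))
          (.setNat 14 (.const 0) (.const 0)))))

/-- The local improvement algorithm. -/
def localSearch (K : ℕ) : Prog :=
  .seq (.mark 2 11 (reg 0) .false)
    (.seq (.setNat 14 (.const 0) (.const 1))
      (.while (.natLt (.const 0) (reg 14)) (improveStep K)))

lemma search_checkTuple_writesNat (K k : ℕ) {a : ℕ}
    (ha : a = 0 ∨ a = 1 ∨ a = 2 ∨ a = 5 ∨ a = 8 ∨ a = 14) :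
    ¬ (search (checkTuple K) k).writesNat a :=
  search_writesNat k (by omega) (by
    simp only [checkTuple, writesNat_seq, writesNat_sumIf, writesNat_ite, writesNat_setNat,
      writesNat_mark, writesNat_skip, or_false]
    omega)

lemma within_improveStep {G : SimpleGraph (Fin n)} {q : Fin n → ℕ} {A : Finset (Fin n)} (K : ℕ)
    (h : SearchMem σ G q A) :
    Within (improveStep K) σ (8 * n + 7 + (3 * n + 3) ^ K * (8 * n + 8)) (fun σ' =>
      (σ'.nat 14 0 = σ.nat 14 0 ∧ ∃ X : Finset (Fin n), X.card ≤ K ∧ Improves G q A X ∧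
        HoldsSet σ' 2 (exchange G A X)) ∨
      (σ'.nat 14 0 = 0 ∧ HoldsSet σ' 2 A ∧
        ∀ X : Finset (Fin n), X.card ≤ K → ¬ Improves G q A X)) := by
  have h0 : SearchMem (σ.setNat 15 0 0) G q A := h.congr fun a ha =>
    setNat_nat_of_ne _ _ _ (by omega)
  refine (Within.seqNat (Within.seq (Within.sumIfFin (n := n) (p := fun v => v ∈ A) (g := q)
    (by decide) ?_ ?_) fun σ₁ hf₁ h₁ => Within.seq (within_search (n := n) (K := K)
      (T := 8 * n + 7) (I := SearchInv K G q A)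
      (D := fun c σ' => σ'.nat 15 0 = 1 ∨ ¬ Improves G q A (tupleSet n K c))
      ?_ ?_ ?_ ?_ ?_ K le_rfl σ₁ ?_ ?_) (T' := n * 4 + 3) fun σ₂ hf₂ h₂ => ?_)).mono ?_
      fun _ _ h => h
  · intro σ' hf
    rw [eval_reg, hf.nat 0 (by simp)]
    exact h0.graph.size
  · intro v σ' hf hv
    have hm' : SearchMem σ' G q A := h0.congr fun a ha => hf.nat a (by
      rw [writesNat_sumIf]; omega)
    simp only [holds_natLt, eval_get, eval_const, eval_reg, hv]
    exact ⟨hm'.cur.pos_iff v, hm'.sq v⟩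
  · rintro σ' i x ⟨g1, g2, g3⟩
    refine ⟨g1.congr fun a ha => setNat_nat_of_ne _ _ _ (by omega), ?_, ?_⟩
    · rw [setNat_nat_of_ne _ _ _ (by decide), g2]
    · rw [setNat_nat_of_ne _ _ _ (by decide)]
      exact g3.imp id fun ⟨a, X, hX, hi, h10⟩ => ⟨a, X, hX, hi, h10.congr
        (setNat_nat_of_ne _ _ _ (by decide))⟩
  · intro c σ' i x hD
    rwa [setNat_nat_of_ne _ _ _ (by decide)]
  · intro σ' hI
    exact hI.1.graph.size
  · simp [checkTuple]
  · intro σ' hI hc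
    refine (within_checkTuple hI hc).post fun σ'' _ ⟨g1, g2, g3⟩ => ⟨g1, g2, fun c hD => ?_⟩
    exact hD.imp g3 id
  · refine ⟨h0.congr fun a ha => hf₁.nat a (by rw [writesNat_sumIf]; omega), ?_, Or.inl ?_⟩
    · rw [h₁]
      simp
    · rw [hf₁.nat 15 (by simp)]
      simp
  · intro j hj hjK
    omega
  · obtain ⟨⟨hm₂, -, hfound⟩, -, -, hall⟩ := h₂
    have h14 : σ₂.nat 14 0 = σ.nat 14 0 := by
      rw [hf₂.nat 14 (search_checkTuple_writesNat K K (by simp)), hf₁.nat 14 (by simp),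
        setNat_nat_of_ne _ _ _ (by decide)]
    refine Within.ite (fun hb => ?_) (fun hb => ?_)
    · simp only [holds_natLt, eval_const, eval_reg] at hb
      rcases hfound with h15 | ⟨-, X, hX, hi, h10⟩
      · omega
      refine (Within.markFin (n := n) (p := fun v => v ∈ exchange G A X) (by decide) ?_ ?_).post
        fun σ₃ hf₃ h₃ => Or.inl ⟨?_, X, hX, hi, fun v => by convert h₃ v⟩
      · intro σ' hf
        rw [eval_reg, hf.nat 0 (by simp), hm₂.graph.size]
      · intro v σ' hf hv _
        have h10' := h10.congr (hf.nat 10 (by simp))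
        rw [holds_natLt, eval_const, eval_get, eval_reg, hv, h10'.pos_iff]
      · rw [hf₃.nat 14 (by simp), h14]
    · simp only [holds_natLt, eval_const, eval_reg, not_lt, Nat.le_zero] at hb
      refine (Within.setNat (Or.inr ⟨by simp, ?_, ?_⟩)).mono (by omega) fun _ _ h => h
      · exact hm₂.cur.congr (setNat_nat_of_ne _ _ _ (by decide))
      · intro X hX hi
        -- The empty set need not be listed by a tuple, but exchanging it changes nothing.
        rcases X.eq_empty_or_nonempty with rfl | hne
        · have : exchange G A ∅ = A := by
            ext v
            simp [mem_exchange]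
          have h2 := hi.2
          rw [this] at h2
          exact lt_irrefl _ h2
        · obtain ⟨c, hc1, hc2, hc3⟩ := exists_tuple hne hX (σ₁.nat 7)
          rcases hall c hc1 hc2 with h | h
          · omega
          · exact h (hc3 ▸ hi)
  · apply le_of_eq
    ring

/-- The bound `R` on the length of every run yields the budget `R - i + 1`. By `himp`, the test on
the integers `q` finds exactly the local improvements inside `U`, since `q v ≠ 0` characterises the
kept vertices. -/
lemma within_localSearch {d : ℕ} {G : SimpleGraph (Fin n)} {tw : Fin n → ℝ} {q : Fin n → ℕ}
    {U : Finset (Fin n)} {R : ℕ} (hG : GraphMem σ G) (hq : ∀ v : Fin n, σ.nat 8 v = q v)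
    (htw : ∀ v, (q v : ℝ) = tw v ^ 2) (hU : ∀ v, v ∈ U ↔ tw v ≠ 0)
    (hR : ∀ i A, Run d G tw U i A → i ≤ R) :
    Within (localSearch ((d - 1) ^ 2 + (d - 1))) σ (4 * n + 4 +
      (R + 1) * (8 * n + 8 + (3 * n + 3) ^ ((d - 1) ^ 2 + (d - 1)) * (8 * n + 8)))
      (fun σ' => ∃ A : Finset (Fin n), Returns d G tw U A ∧ HoldsSet σ' 2 A) := by
  set K := (d - 1) ^ 2 + (d - 1) with hK
  have himp : ∀ A X : Finset (Fin n), (X.card ≤ K ∧ Improves G q A X) ↔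
      (X ⊆ U ∧ IsLocalImprovement d G tw A X) := by
    intro A X
    have hsum : ∀ S : Finset (Fin n), wtSq tw S = ((∑ v ∈ S, q v : ℕ) : ℝ) := fun S => by
      simp [wtSq, htw]
    have hq0 : ∀ v, q v ≠ 0 ↔ v ∈ U := fun v => by
      rw [hU, ← pow_ne_zero_iff (a := tw v) (n := 2) (by decide), ← htw, Nat.cast_ne_zero]
    simp only [Improves, IsLocalImprovement, isIndepSet_iff, hsum, Nat.cast_lt, hq0]
    constructor
    · rintro ⟨h1, h2, h3⟩
      exact ⟨fun v hv => (h2 v hv).1, fun v hv => (h2 v hv).2, h1, h3⟩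
    · rintro ⟨h1, h2, h3, h4⟩
      exact ⟨h3, fun v hv => ⟨h1 hv, h2 v hv⟩, h4⟩
  refine (Within.seq (Within.markFin (n := n) (p := fun _ => False) (by decide) ?_ (by simp))
    fun σ₁ hf₁ h₁ => Within.seqNat (Within.post (Within.while_budget
      (T := 8 * n + 7 + (3 * n + 3) ^ K * (8 * n + 8))
      (I := fun k σ' => ∃ (A : Finset (Fin n)) (i : ℕ), Run d G tw U i A ∧ HoldsSet σ' 2 A ∧
        ((σ'.nat 14 0 = 1 ∧ k = R - i + 1) ∨
          (σ'.nat 14 0 = 0 ∧ k = 0 ∧ ∀ X : Finset (Fin n), X.card ≤ K → ¬ Improves G q A X)))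
      (R + 1) ?_ ?_) ?_)).mono (T' := 4 * n + 4 +
      (R + 1) * (8 * n + 8 + (3 * n + 3) ^ K * (8 * n + 8))) ?_ fun _ _ h => h
  · intro σ' hf
    rw [eval_reg, hf.nat 0 (by simp), hG.size]
  · refine ⟨∅, 0, .start, fun v => ?_, by simp⟩
    rw [setNat_nat_of_ne _ _ _ (by decide), h₁ v]
    simp
  · rintro k σ₂ hf₂ ⟨A, i, hrun, hA, hk⟩ hflag
    have hk' : σ₂.nat 14 0 = 1 ∧ k = R - i + 1 := by
      rcases hk with h | h
      · exact h
      · simp [h.1] at hflag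
    have hnat : ∀ a, a = 0 ∨ a = 1 ∨ a = 5 ∨ a = 8 → σ₂.nat a = σ.nat a := fun a ha => by
      have hs : ¬ (search (checkTuple K) K).writesNat a :=
        search_checkTuple_writesNat K K (by omega)
      rw [hf₂.nat a, setNat_nat_of_ne _ _ _ (by omega), hf₁.nat a]
      · rw [writesNat_mark]; omega
      · simp only [improveStep, writesNat_seq, writesNat_setNat, writesNat_sumIf, hs,
          writesNat_ite, writesNat_mark, false_or]
        omega
    have hm : SearchMem σ₂ G q A := ⟨hG.congr (hnat 0 (by simp)) (hnat 1 (by simp))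
      (hnat 5 (by simp)), fun v => by rw [hnat 8 (by simp), hq], hA⟩
    refine (within_improveStep K hm).post fun σ₃ _ h₃ => ?_
    rcases h₃ with ⟨h14, X, hX, hi, h2⟩ | ⟨h14, h2, hno⟩
    · obtain ⟨hXU, hloc⟩ := (himp A X).1 ⟨hX, hi⟩
      have hrun' := Run.step hrun hXU hloc
      have hle := hR _ _ hrun'
      exact ⟨R - (i + 1) + 1, by omega, exchange G A X, i + 1, hrun', h2,
        Or.inl ⟨by rw [h14, hk'.1], rfl⟩⟩
    · exact ⟨0, by omega, A, i, hrun, h2, Or.inr ⟨h14, rfl, hno⟩⟩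
  · rintro σ' - ⟨⟨k, A, i, hrun, hA, hk⟩, hflag⟩
    rcases hk with h | h
    · simp [h.1] at hflag
    · refine ⟨A, ⟨⟨i, hrun⟩, ?_⟩, hA⟩
      rintro ⟨X, hX⟩
      obtain ⟨h1, h2⟩ := (himp A X).2 hX
      exact h.2.2 X h1 h2
  · apply le_of_eq
    ring

end RAM

namespace RAM

open ClawFreeMWIS

variable {n : ℕ} {σ σ' : Store}

/-! ### The scaled and truncated algorithm as a program -/

/-- The scaled and truncated algorithm, where `Q` computes the truncation parameter in
register `19`. -/
def scaledSearch (d : ℕ) (Q : Prog) : Prog :=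
  .seq rowOffsets (.seq greedy (.seq Q (.seq truncSq (localSearch ((d - 1) ^ 2 + (d - 1))))))

/-- The running time of the scaled and truncated algorithm, without the computation of the
truncation parameter `N`. -/
def scaledTime {R : Type*} [CommSemiring R] (d : ℕ) (n N : R) : R :=
  (3 * n + 3) + (8 * n + 7 + (n + 1) * (8 * n + 9)) + (n * 4 + 5 + n * (12 * (N * n) + 13)) +
    (4 * n + 4 + (((d - 1 : ℕ) : R) ^ 2 * N ^ 2 * n ^ 2 + 1) *
      (8 * n + 8 + (3 * n + 3) ^ ((d - 1) ^ 2 + (d - 1)) * (8 * n + 8)))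

lemma scaledTime_mono {d n n' N N' : ℕ} (hn : n ≤ n') (hN : N ≤ N') :
    scaledTime d n N ≤ scaledTime d n' N' := by
  unfold scaledTime
  gcongr

lemma EncodesGraph.graphMem {G : SimpleGraph (Fin n)} {w : Fin n → ℝ} (h : EncodesGraph σ G w)
    (h0 : σ'.nat 0 = σ.nat 0) (h1 : σ'.nat 1 = σ.nat 1)
    (h5 : ∀ u : Fin n, σ'.nat 5 u = u * n) : GraphMem σ' G :=
  ⟨by rw [h0, h.size], h5, fun u v => by rw [h1, h.adj]; split_ifs <;> simp_all⟩

/-- `Q` is left open because the truncation parameter is computed from `ε` in one application and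
constant in another; its bound `B` enters only the running time. -/
theorem within_scaledSearch {d : ℕ} (hd : 2 ≤ d) {Q : Prog} {TQ B : ℕ} {p : ℕ → Prop}
    {G : SimpleGraph (Fin n)} {w : Fin n → ℝ} (hG : ClawFree d G) (hpos : ∀ v, 0 < w v)
    (h : EncodesGraph σ G w)
    (hQ : ∀ σ', σ'.real 1 = σ.real 1 →
      Within Q σ' TQ (fun σ' => ∃ m : ℕ, σ'.nat 19 0 = m + 1 ∧ 0 < m ∧ m + 1 ≤ B ∧ p m))
    (hQnat : ∀ a, a ≠ 19 → ¬ Q.writesNat a) (hQreal : ∀ a, a ≠ 3 → ¬ Q.writesReal a) :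
    Within (scaledSearch d Q) σ (scaledTime d n B + TQ) (fun σ' => ∃ m : ℕ, p m ∧ 0 < m ∧
      ScaledReturns d ((m + 1 : ℕ) : ℝ) G w (output σ' n)) := by
  refine (Within.seq (within_rowOffsets h.size) fun σ₁ hf₁ h₁ => ?_).mono
    (T := (n * 3 + 3) + ((8 * n + 7 + (n + 1) * (8 * n + 9)) + (TQ +
      ((n * 4 + 5 + n * (12 * (B * n) + 13)) + (4 * n + 4 + ((d - 1) ^ 2 * B ^ 2 * n ^ 2 + 1) *
      (8 * n + 8 + (3 * n + 3) ^ ((d - 1) ^ 2 + (d - 1)) * (8 * n + 8))))))) ?_ fun _ _ h => h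
  swap
  · unfold scaledTime
    rw [Nat.cast_id]
    omega
  have hG₁ : GraphMem σ₁ G := h.graphMem (hf₁.nat 0 (by simp [rowOffsets]))
    (hf₁.nat 1 (by simp [rowOffsets])) h₁
  have hw₁ : ∀ v : Fin n, σ₁.real 0 v = w v := fun v => by
    rw [hf₁.real 0 (by simp [rowOffsets]), h.weight]
  refine Within.seq (within_greedy hG₁ hw₁) fun σ₂ hf₂ ⟨A', hA', _, hW⟩ => ?_
  refine Within.seq (hQ σ₂ ?_) fun σ₃ hf₃ ⟨m, hm, hm0, hmB, hp⟩ => ?_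
  · rw [hf₂.real 1 (by simp [greedy, scan, insertBest]), hf₁.real 1 (by simp [rowOffsets])]
  have hN : (1 : ℝ) < ((m + 1 : ℕ) : ℝ) := by
    exact_mod_cast Nat.lt_add_of_pos_left hm0
  have hnat₃ : ∀ a, a = 0 ∨ a = 1 ∨ a = 5 → σ₃.nat a = σ₁.nat a := fun a ha => by
    rw [hf₃.nat a (hQnat a (by omega)), hf₂.nat a]
    rcases ha with rfl | rfl | rfl <;> simp [greedy, scan, insertBest]
  have hG₃ : GraphMem σ₃ G := hG₁.congr (hnat₃ 0 (by simp)) (hnat₃ 1 (by simp))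
    (hnat₃ 5 (by simp))
  have hw₃ : ∀ v : Fin n, σ₃.real 0 v = w v := fun v => by
    rw [hf₃.real 0 (hQreal 0 (by decide)), hf₂.real 0 (by simp [greedy, scan, insertBest]), hw₁]
  have hW₃ : σ₃.real 2 0 = wt w A' := by rw [hf₃.real 2 (hQreal 2 (by decide)), hW]
  refine Within.seq ((within_truncSq hG₃.size hm hw₃ hpos (hA'.weight_le hpos) hW₃).mono ?_
    fun _ _ h => h) fun σ₄ hf₄ h₄ => ?_
  · gcongr
  have hG₄ : GraphMem σ₄ G := hG₃.congr (hf₄.nat 0 (by simp [truncSq, truncSqAt]))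
    (hf₄.nat 1 (by simp [truncSq, truncSqAt])) (hf₄.nat 5 (by simp [truncSq, truncSqAt]))
  refine (within_localSearch (d := d) (tw := truncWeight ((m + 1 : ℕ) : ℝ) w A')
    (U := keptVertices ((m + 1 : ℕ) : ℝ) w A') (R := (d - 1) ^ 2 * B ^ 2 * n ^ 2) hG₄ h₄
    (fun v => ?_) (fun v => ?_) fun i A hrun => ?_).post fun σ₅ _ ⟨A, hA, h2⟩ => ?_
  · simp [truncWeight]
  · simp [keptVertices]
  · have h1 := hrun.iterations_le hG hd hN hpos hA'
    have h2 : (i : ℝ) ≤ (((d - 1) ^ 2 * (m + 1) ^ 2 * n ^ 2 : ℕ) : ℝ) := by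
      refine h1.trans (le_of_eq ?_)
      have : ((d - 1 : ℕ) : ℝ) = (d : ℝ) - 1 := by rw [Nat.cast_sub (by omega)]; simp
      rw [Fintype.card_fin]
      push_cast [this]
      ring
    have h3 : i ≤ (d - 1) ^ 2 * (m + 1) ^ 2 * n ^ 2 := by exact_mod_cast h2
    refine h3.trans ?_
    gcongr
  · refine ⟨m, hp, hm0, A', hA', ?_⟩
    rw [h2.output_eq]
    exact hA

/-- A bound for the running time of the approximation scheme. -/
noncomputable def schemeTime (d : ℕ) : Polynomial ℕ :=
  scaledTime d Polynomial.X ((d : Polynomial ℕ) * Polynomial.X + 1) +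
    ((d : Polynomial ℕ) * Polynomial.X * 3 + 4)

theorem within_scheme {d : ℕ} (hd : 2 ≤ d) {G : SimpleGraph (Fin n)} {w : Fin n → ℝ} {ε : ℝ}
    (hG : ClawFree d G) (hpos : ∀ v, 0 < w v) (hε : 0 < ε) (h : EncodesGraph σ G w)
    (hσε : σ.real 1 0 = ε) :
    Within (scaledSearch d (truncParam d)) σ ((schemeTime d).eval (n + ⌈1 / ε⌉₊)) (fun σ' =>
      (∃ N : ℝ, 1 < N ∧ ScaledReturns d N G w (output σ' n)) ∧
        IsApproxMWIS (approxRatio d + ε) G w (output σ' n)) := by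
  have hdr : (2 : ℝ) ≤ d := by exact_mod_cast hd
  refine (within_scaledSearch hd (p := fun m => (d : ℝ) ≤ m * ε) (B := d * ⌈1 / ε⌉₊ + 1)
    (TQ := d * ⌈1 / ε⌉₊ * 3 + 4) hG hpos h (fun σ' hσ' => ?_) ?_ ?_).mono ?_ ?_
  · refine (within_truncParam d hε (by rw [hσ', hσε])).post fun σ'' _ ⟨m, h1, h2, h3⟩ =>
      ⟨m, h1, ?_, by omega, h2⟩
    rcases Nat.eq_zero_or_pos m with rfl | hm
    · rw [Nat.cast_zero, zero_mul] at h2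
      linarith
    · exact hm
  · intro a ha
    simp [truncParam, ha]
  · intro a ha
    simp [truncParam, ha]
  -- As `scaledTime` makes sense in every commutative semiring, evaluating its polynomial version
  -- gives its numerical version.
  · have h1 : (schemeTime d).eval (n + ⌈1 / ε⌉₊) =
        scaledTime d (n + ⌈1 / ε⌉₊) (d * (n + ⌈1 / ε⌉₊) + 1) +
          (d * (n + ⌈1 / ε⌉₊) * 3 + 4) := by
      simp [schemeTime, scaledTime]
    rw [h1]
    refine Nat.add_le_add (scaledTime_mono (by omega) ?_) ?_
    · gcongr; omega
    · gcongr; omega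
  · rintro σ' - ⟨m, hm, hm0, hret⟩
    refine ⟨⟨((m + 1 : ℕ) : ℝ), ?_, hret⟩, hret.isApproxMWIS_add hG hd hε hm hpos⟩
    exact_mod_cast Nat.lt_add_of_pos_left hm0

/-- For `d ≥ 3` a constant truncation parameter costs at most `1/63700992`, exactly the margin of
`approxRatio d` below `d/2`. For `d = 2` there is no margin, but the greedy solution is already a
`(d - 1)`-approximation and `d - 1 = d/2`. -/
theorem exists_half_approx {d : ℕ} (hd : 2 ≤ d) : ∃ (P : Prog) (p : Polynomial ℕ),
    ∀ (n : ℕ) (G : SimpleGraph (Fin n)) (w : Fin n → ℝ) (σ : Store),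
      ClawFree d G → (∀ v, 0 < w v) → EncodesGraph σ G w →
        Within P σ (p.eval n) (fun σ' => IsApproxMWIS ((d : ℝ) / 2) G w (output σ' n)) := by
  by_cases hd2 : d = 2
  · refine ⟨.seq rowOffsets greedy, (Polynomial.X * 3 + 3) + (8 * Polynomial.X + 7 +
      (Polynomial.X + 1) * (8 * Polynomial.X + 9)), fun n G w σ hG hpos h => ?_⟩
    refine (Within.seq (within_rowOffsets h.size) fun σ₁ hf₁ h₁ => within_greedy
      (G := G) (w := w) ?_ fun v => ?_).mono (by simp) fun σ' _ ⟨A, hA, h2, _⟩ => ?_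
    · exact h.graphMem (hf₁.nat 0 (by simp [rowOffsets])) (hf₁.nat 1 (by simp [rowOffsets])) h₁
    · rw [hf₁.real 0 (by simp [rowOffsets]), h.weight]
    · rw [h2.output_eq]
      have := hA.isApproxMWIS hG hd hpos
      rw [hd2] at this ⊢
      norm_num at this ⊢
      exact this
  · refine ⟨scaledSearch d (.setNat 19 (.const 0) (.const (d * 63700992 + 1))),
      scaledTime d Polynomial.X ((d * 63700992 + 1 : ℕ) : Polynomial ℕ) + 1,
      fun n G w σ hG hpos h => ?_⟩
    refine (within_scaledSearch hd (p := fun m => m = d * 63700992) (B := d * 63700992 + 1)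
      (TQ := 1) hG hpos h (fun σ' _ => Within.setNat ?_) ?_ ?_).mono ?_ ?_
    · exact ⟨d * 63700992, by simp, by omega, le_rfl, rfl⟩
    · intro a ha
      simpa using ha
    · simp
    · apply le_of_eq
      simp [scaledTime]
    · rintro σ' - ⟨m, rfl, -, hret⟩
      have h1 := hret.isApproxMWIS_add hG hd (ε := 1 / 63700992) (by norm_num)
        (by push_cast; linarith) hpos
      rw [approxRatio, if_neg hd2] at h1
      convert h1 using 1
      ring

/-! ### Weighted set packing -/

/-- The `a`-th element of the set with the index in register `r`. -/
def eltExpr (k r a : ℕ) : NatExpr := .get 3 (.add (NatExpr.smul k (reg r)) (.const a))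

/-- The test whether the sets with the indices in the registers `11` and `12` are distinct and
meet. -/
def conflictTest (k : ℕ) : Test :=
  .and (.not (.eq (reg 11) (reg 12)))
    (.orBelow k fun a => .and (.natLt (.const 0) (eltExpr k 11 a))
      (.orBelow k fun b => .eq (eltExpr k 11 a) (eltExpr k 12 b)))

/-- Compute the adjacency matrix of the conflict graph. -/
def conflictMatrix (k : ℕ) : Prog :=
  .seq rowOffsets
    (.forUp 11 0 (reg 0) (.forUp 12 0 (reg 0)
      (.ite (conflictTest k)
        (.setNat 1 (.add (.get 5 (reg 11)) (reg 12)) (.const 1))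
        (.setNat 1 (.add (.get 5 (reg 11)) (reg 12)) (.const 0)))))

/-- The requirement of a positive entry keeps two empty slots from counting as a common element. -/
lemma EncodesSets.holds_conflictTest {k : ℕ} {S : Fin n → Finset ℕ} {w : Fin n → ℝ}
    (h : EncodesSets σ k S w) {i j : Fin n} (hi : σ.nat 11 0 = i) (hj : σ.nat 12 0 = j) :
    (conflictTest k).holds σ ↔ (conflictGraph S).Adj i j := by
  have h1 : ¬ Disjoint (S i) (S j) ↔ ∃ a < k, 0 < σ.nat 3 (i * k + a) ∧
      ∃ b < k, σ.nat 3 (i * k + a) = σ.nat 3 (j * k + b) := by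
    rw [Finset.not_disjoint_iff]
    constructor
    · rintro ⟨x, hx, hx'⟩
      obtain ⟨a, ha, hax⟩ := (h.mem i x).1 hx
      obtain ⟨b, hb, hbx⟩ := (h.mem j x).1 hx'
      exact ⟨a, ha, by omega, b, hb, by omega⟩
    · rintro ⟨a, ha, hpos, b, hb, hab⟩
      exact ⟨σ.nat 3 (i * k + a) - 1, (h.mem i _).2 ⟨a, ha, by omega⟩,
        (h.mem j _).2 ⟨b, hb, by omega⟩⟩
  simp only [conflictTest, conflictGraph, h1, eltExpr, holds_and, holds_not, holds_eq,
    holds_orBelow, holds_natLt, eval_reg, eval_get, eval_add, eval_smul, eval_const, hi, hj,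
    Fin.val_inj, mul_comm k, ne_eq]

lemma matrix_index_inj {n u v i j : ℕ} (hv : v < n) (hj : j < n) (h : u * n + v = i * n + j) :
    u = i ∧ v = j := by
  have h1 : u = i := by
    rcases lt_trichotomy u i with hlt | heq | hgt
    · have := Nat.mul_le_mul_right n (Nat.succ_le_of_lt hlt)
      rw [Nat.succ_mul] at this
      omega
    · exact heq
    · have := Nat.mul_le_mul_right n (Nat.succ_le_of_lt hgt)
      rw [Nat.succ_mul] at this
      omega
  subst h1
  exact ⟨rfl, by omega⟩

open Classical in
lemma within_conflictMatrix {k : ℕ} {S : Fin n → Finset ℕ} {w : Fin n → ℝ}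
    (h : EncodesSets σ k S w) :
    Within (conflictMatrix k) σ (n * 3 + 3 + (n * (n * 4 + 4) + 2))
      (fun σ' => EncodesGraph σ' (conflictGraph S) w) := by
  refine Within.seq (within_rowOffsets h.size) fun σ₁ hf₁ h₁ => ?_
  have hnat : ∀ (P : Prog) σ', (∀ a, a = 0 ∨ a = 3 ∨ a = 5 → ¬ P.writesNat a) →
      (¬ P.writesReal 0) → Frame P σ₁ σ' →
      EncodesSets σ' k S w ∧ ∀ u : Fin n, σ'.nat 5 u = u * n := by
    intro P σ' hP hR hf
    have h0 : σ'.nat 0 = σ.nat 0 := by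
      rw [hf.nat 0 (hP 0 (by simp)), hf₁.nat 0 (by simp [rowOffsets])]
    have h3 : σ'.nat 3 = σ.nat 3 := by
      rw [hf.nat 3 (hP 3 (by simp)), hf₁.nat 3 (by simp [rowOffsets])]
    have hr : σ'.real 0 = σ.real 0 := by
      rw [hf.real 0 hR, hf₁.real 0 (by simp [rowOffsets])]
    exact ⟨⟨by rw [h0, h.size], fun i x => by rw [h3, h.mem], fun i => by rw [hr, h.weight]⟩,
      fun u => by rw [hf.nat 5 (hP 5 (by simp)), h₁]⟩
  refine (Within.forUp (T := n * 4 + 2) (L := n)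
    (I := fun i σ' => ∀ u v : Fin n, (u : ℕ) < i →
      σ'.nat 1 (u * n + v) = if (conflictGraph S).Adj u v then 1 else 0) ?_ ?_ ?_ ?_).post ?_
  · intro i σ' x hI
    rwa [setNat_nat_of_ne _ _ _ (by decide)]
  · simp
  · intro i σ' hf _
    exact (hnat _ σ' (by rintro a (rfl | rfl | rfl) <;> simp) (by simp) hf).1.size
  · intro i σ₂ hi hf₂ hc₂ hI₂
    refine (Within.forUp (T := 2) (L := n)
      (I := fun j σ' => ∀ u v : Fin n, (u : ℕ) < i ∨ ((u : ℕ) = i ∧ (v : ℕ) < j) →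
        σ'.nat 1 (u * n + v) = if (conflictGraph S).Adj u v then 1 else 0) ?_ ?_ ?_ ?_).post ?_
    · intro j σ' x hI
      rwa [setNat_nat_of_ne _ _ _ (by decide)]
    · rintro u v (hu | hu)
      · exact hI₂ u v hu
      · omega
    · intro j σ' hf _
      rw [eval_reg, hf.nat 0 (by simp)]
      exact (hnat _ σ₂ (by rintro a (rfl | rfl | rfl) <;> simp) (by simp) hf₂).1.size
    · intro j σ' hj hf hc hI
      obtain ⟨hS, hrow⟩ := hnat _ σ' (by rintro a (rfl | rfl | rfl) <;> simp) (by simp)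
        (hf₂.trans (hf.mono (fun a ha => by simp at ha ⊢; tauto) fun a ha => by simp at ha))
      have hc' : σ'.nat 11 0 = i := by rw [hf.nat 11 (by simp), hc₂]
      have htest := hS.holds_conflictTest (i := ⟨i, hi⟩) (j := ⟨j, hj⟩) hc' hc
      have hrow' : σ'.nat 5 i = i * n := hrow ⟨i, hi⟩
      -- Distinct pairs have distinct positions in the matrix, so writing one entry preserves those
      -- already computed.
      have key : ∀ x : ℕ, x = (if (conflictGraph S).Adj ⟨i, hi⟩ ⟨j, hj⟩ then 1 else 0) →
          (σ'.setNat 1 (i * n + j) x).nat 12 0 = j ∧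
          ∀ u v : Fin n, (u : ℕ) < i ∨ ((u : ℕ) = i ∧ (v : ℕ) < j + 1) →
            (σ'.setNat 1 (i * n + j) x).nat 1 (u * n + v) =
              if (conflictGraph S).Adj u v then 1 else 0 := by
        intro x hx
        refine ⟨by rw [setNat_nat_of_ne _ _ _ (by decide), hc], fun u v huv => ?_⟩
        rw [setNat_nat]
        simp only [true_and]
        by_cases hidx : (u : ℕ) * n + v = i * n + j
        · obtain ⟨h1, h2⟩ := matrix_index_inj v.2 hj hidx
          have hu : u = ⟨i, hi⟩ := Fin.ext h1
          have hv : v = ⟨j, hj⟩ := Fin.ext h2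
          rw [if_pos hidx, hx, hu, hv]
        · rw [if_neg hidx]
          refine hI u v (huv.imp id fun hh => ⟨hh.1, ?_⟩)
          rcases Nat.lt_succ_iff_lt_or_eq.1 hh.2 with hlt | heq
          · exact hlt
          · exact absurd (by rw [hh.1, heq]) hidx
      refine Within.ite (fun hb => Within.setNat ?_) (fun hb => Within.setNat ?_)
      all_goals
        rw [htest] at hb
        simp only [eval_add, eval_get, eval_reg, eval_const, hc, hc', hrow']
        exact key _ (by simp [hb])
    · intro σ₃ hf₃ hI₃
      refine ⟨by rw [hf₃.nat 11 (by simp), hc₂], fun u v hu => hI₃ u v ?_⟩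
      rcases Nat.lt_succ_iff_lt_or_eq.1 hu with hu | hu
      · exact Or.inl hu
      · exact Or.inr ⟨hu, v.2⟩
  · intro σ₂ hf₂ hI
    obtain ⟨hS, -⟩ := hnat _ σ₂ (by rintro a (rfl | rfl | rfl) <;> simp) (by simp) hf₂
    exact ⟨hS.size, fun u v => hI u v u.2, hS.weight⟩

theorem within_packing {k : ℕ} (hk : 1 ≤ k) {S : Fin n → Finset ℕ} {w : Fin n → ℝ} {ε : ℝ}
    (hS : ∀ i, (S i).card ≤ k) (hpos : ∀ i, 0 < w i) (hε : 0 < ε) (h : EncodesSets σ k S w)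
    (hσε : σ.real 1 0 = ε) :
    Within (.seq (conflictMatrix k) (scaledSearch (k + 1) (truncParam (k + 1)))) σ
      ((Polynomial.X * 3 + 3 + (Polynomial.X * (Polynomial.X * 4 + 4) + 2) +
        schemeTime (k + 1)).eval (n + ⌈1 / ε⌉₊)) (fun σ' =>
      (∃ N : ℝ, 1 < N ∧ ScaledReturns (k + 1) N (conflictGraph S) w (output σ' n)) ∧
        IsApproxPacking (approxRatio (k + 1) + ε) S w (output σ' n)) := by
  refine (Within.seq (within_conflictMatrix h) fun σ₁ hf₁ h₁ => within_scheme (by omega)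
    (clawFree_conflictGraph hS) hpos hε h₁ ?_).mono ?_ fun σ' _ h => ⟨h.1, h.2.isApproxPacking⟩
  · rw [hf₁.real 1 (by simp [conflictMatrix, rowOffsets]), hσε]
  · rw [Polynomial.eval_add]
    refine Nat.add_le_add_right ?_ _
    simp only [Polynomial.eval_add, Polynomial.eval_mul, Polynomial.eval_X, Polynomial.eval_ofNat]
    gcongr <;> omega

end RAM

/-! ### The main theorem. -/

open ClawFreeMWIS RAM in
theorem mainTheorem2 :
    -- every run of the scaled and truncated algorithm: number of iterations and guarantee
    (∀ (d : ℕ), 2 ≤ d → ∀ (N : ℝ), 1 < N → ∀ (V : Type*) [Fintype V] (G : SimpleGraph V)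
      (w : V → ℝ), ClawFree d G → (∀ v, 0 < w v) →
        (∀ A', IsGreedySolution G w A' → ∀ i A,
          Run d G (truncWeight N w A') (keptVertices N w A') i A →
            (i : ℝ) ≤ ((d : ℝ) - 1) ^ 2 * N ^ 2 * (Fintype.card V : ℝ) ^ 2) ∧
        (∀ A, ScaledReturns d N G w A →
          IsApproxMWIS (approxRatio d * (N / (N - 1))) G w A)) ∧
    -- it yields a polynomial time approximation algorithm, also polynomial in `1 / ε`
    (∀ (d : ℕ), 2 ≤ d → ∃ (P : Prog) (p : Polynomial ℕ),
      ∀ (n : ℕ) (G : SimpleGraph (Fin n)) (w : Fin n → ℝ) (ε : ℝ) (σ : Store),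
        ClawFree d G → (∀ v, 0 < w v) → 0 < ε → EncodesGraph σ G w → σ.real 1 0 = ε →
          ∃ (t : ℕ) (σ' : Store), Exec P σ t σ' ∧ t ≤ p.eval (n + ⌈1 / ε⌉₊) ∧
            (∃ N : ℝ, 1 < N ∧ ScaledReturns d N G w (output σ' n)) ∧
            IsApproxMWIS (approxRatio d + ε) G w (output σ' n)) ∧
    -- polynomial time `d / 2`-approximation
    (∀ (d : ℕ), 2 ≤ d → ∃ (P : Prog) (p : Polynomial ℕ),
      ∀ (n : ℕ) (G : SimpleGraph (Fin n)) (w : Fin n → ℝ) (σ : Store),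
        ClawFree d G → (∀ v, 0 < w v) → EncodesGraph σ G w →
          ∃ (t : ℕ) (σ' : Store), Exec P σ t σ' ∧ t ≤ p.eval n ∧
            IsApproxMWIS ((d : ℝ) / 2) G w (output σ' n)) ∧
    -- the conflict graph of sets of size at most `k` is `(k + 1)`-claw free
    (∀ (k : ℕ) (ι α : Type*) (S : ι → Finset α), (∀ i, (S i).card ≤ k) →
      ClawFree (k + 1) (conflictGraph S)) ∧
    -- weighted `k`-set packing
    (∀ (k : ℕ), 1 ≤ k → ∃ (P : Prog) (p : Polynomial ℕ),
      ∀ (n : ℕ) (S : Fin n → Finset ℕ) (w : Fin n → ℝ) (ε : ℝ) (σ : Store),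
        (∀ i, (S i).card ≤ k) → (∀ i, 0 < w i) → 0 < ε → EncodesSets σ k S w → σ.real 1 0 = ε →
          ∃ (t : ℕ) (σ' : Store), Exec P σ t σ' ∧ t ≤ p.eval (n + ⌈1 / ε⌉₊) ∧
            (∃ N : ℝ, 1 < N ∧ ScaledReturns (k + 1) N (conflictGraph S) w (output σ' n)) ∧
            IsApproxPacking (approxRatio (k + 1) + ε) S w (output σ' n)) := by
  refine ⟨?_, ?_, ?_, ?_, ?_⟩
  · intro d hd N hN V _ G w hG hpos
    exact ⟨fun A' hA' i A h => h.iterations_le hG hd hN hpos hA',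
      fun A h => h.isApproxMWIS hG hd hN hpos⟩
  · intro d hd
    refine ⟨scaledSearch d (truncParam d), schemeTime d, fun n G w ε σ hG hpos hε h hσε => ?_⟩
    obtain ⟨t, σ', hex, ht, hQ⟩ := within_scheme hd hG hpos hε h hσε
    exact ⟨t, σ', hex, ht, hQ⟩
  · intro d hd
    obtain ⟨P, p, hP⟩ := exists_half_approx hd
    exact ⟨P, p, hP⟩
  · intro k ι α S hS
    exact clawFree_conflictGraph hS
  · intro k hk
    refine ⟨.seq (conflictMatrix k) (scaledSearch (k + 1) (truncParam (k + 1))),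
      Polynomial.X * 3 + 3 + (Polynomial.X * (Polynomial.X * 4 + 4) + 2) + schemeTime (k + 1),
      fun n S w ε σ hS hpos hε h hσε => ?_⟩
    obtain ⟨t, σ', hex, ht, hQ⟩ := within_packing hk hS hpos hε h hσε
    exact ⟨t, σ', hex, ht, hQ⟩
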